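/- **Setting.** Let $d\ge 1$, $\alpha>1/2$, positive weights $\gamma_1,\gamma_2,\dots$, and put $r(\boldsymbol k)=\prod_{j=1}^d\max\{1,|k_j|^\alpha/\gamma_j\}$ for $\boldsymbol k\in\mathbb Z^d$. Let $\mathcal K$ be the weighted Korobov space of continuous one-periodic $f:\mathbb R^d\to\mathbb C$ with $\|f\|_{\mathcal K}^2=\sum_{\boldsymbol k}|\widehat f(\boldsymbol k)|^2r(\boldsymbol k)^2<\infty$. Fix a threshold $t\in(0,1)$. For a prime $N$ let $$M=\sup_{1/\alpha<\lambda\le 2}\Big(\frac N2\prod_{j=1}^d\big(1+2\gamma_j^\lambda\zeta(\alpha\lambda)\big)^{-1}\Big)^{1/\lambda},\qquad A=\{\boldsymbol k\in\mathbb Z^d: r(\boldsymbol k)<M\}.$$ **Generating vector.** Let $\boldsymbol g\in\{1,\dots,N-1\}^d$ be constructed component by component: $g_1=1$, and $g_{s+1}$ ($s=1,\dots,d-1$) minimizes $P(g_1,\dots,g_{s+1})=\sum_{\boldsymbol k}r(\boldsymbol k)^{-2\beta/\alpha}$, where the sum is over $\boldsymbol k\in\mathbb Z^{s+1}\setminus\{\boldsymbol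 0\}$ with $\boldsymbol k\cdot(g_1,\dots,g_{s+1})\equiv0\pmod N$ and $r$ is taken in dimension $s+1$. Here either $\beta=\alpha$, or $\alpha\ge1$ and $\beta=\lfloor\alpha\rfloor$. The fiber of $\boldsymbol\ell\in A$ is $\Gamma(\boldsymbol\ell)=\{\boldsymbol k\in A:\boldsymbol k\cdot\boldsymbol g\equiv\boldsymbol\ell\cdot\boldsymbol g \pmod N\}$; $R$ is the largest cardinality of a fiber; $\mathcal H$ is the set of all differences of two elements of a common fiber, and $\mathcal H^*=\mathcal H\setminus\{\boldsymbol 0\}$. **Shifts.** The finite family $Y=(\boldsymbol y_1,\dots,\boldsymbol y_S)$ of points mod 1 is constructed as follows. If $R=1$ or $\mathcal H=\emptyset$, then $S=1$ and $\boldsymbol y_1=\boldsymbol 0$. Otherwise: 1. Define $\boldsymbol z\in\mathbb Z^d$ successively: $z_j$ is the first of $0,1,-1,2,-2,\dots$ with $\sum_{l<j}h_lz_l+h_jz_j\ne0$ for all $\boldsymbol h\in\mathcal H^*$ whose last nonzero entry is $h_j$. Put $X_{\boldsymbol h}=|\boldsymbol h\cdot\boldsymbol z|$ and $V=\max_{\boldsymbol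 h\in\mathcal H}X_{\boldsymbol h}$. For a finite list $L$ of primes let $Y_L$ be the union, with multiplicities, of the lattices $\{s\boldsymbol z/p \bmod 1:0\le s<p\}$, $p\in L$. 2. Let $p_1<\dots<p_k$ be consecutive primes, where $p_1$ is the least prime $\ge\frac{2(R-1)\ln V}{0.32\,t}$ and $k=\max\{1,\lceil\frac{2(R-1)\ln V}{t\ln p_1}\rceil\}$. Initialize $Y=Y_{\{p_1,\dots,p_k\}}$, let $L$ be empty, and put $p_{\min}=\lfloor(\gamma_1M)^{1/\alpha}\rfloor\lfloor(\gamma_2M)^{1/\alpha}\rfloor/N$. Let $S$ always denote the current size of $Y$. 3. Run through the primes $p\ge R$ in increasing order, as long as $p<S$. (A) With $Y^{\rm poly}_p=\{(s,s^2,\dots,s^d)/p \bmod 1:0\le s<p\}$, if $\max_{\boldsymbol h\in\mathcal H^*}\big|\sum_{\boldsymbol y\in Y^{\rm poly}_p}e^{2\pi i\boldsymbol h\cdot\boldsymbol y}\big|\le\frac{tp}{R-1}$, set $Y=Y^{\rm poly}_p$ and stop. (B) Otherwise, if $p\ge p_{\min}$ and $p\nmid X_{\boldsymbol h}$ for all $\boldsymbol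 h\in\mathcal H^*$, set $Y=Y_{\{p\}}$ and stop. (C) Otherwise, unless the inequality below has already held at an earlier prime, append $p$ to $L$; if now $\max_{\boldsymbol h\in\mathcal H^*}\sum_{q\in L,\,q\mid X_{\boldsymbol h}}q\big/\sum_{q\in L}q\le\frac t{R-1}$ and $\sum_{q\in L}q<S$, replace $Y$ by $Y_L$. **Algorithm.** For $\boldsymbol\ell\in A$ with $\Gamma(\boldsymbol\ell)=\{\boldsymbol\ell_1,\dots,\boldsymbol\ell_v\}$, let $B=(e^{2\pi i\boldsymbol\ell_m\cdot\boldsymbol y_s})_{s,m}\in\mathbb C^{S\times v}$ and $b_s=\frac1N\sum_{n=0}^{N-1}f(\{n\boldsymbol g/N+\boldsymbol y_s\})e^{-2\pi i\boldsymbol\ell\cdot(n\boldsymbol g/N)}$. The entries of $(B^HB)^{-1}B^H\boldsymbol b$ are the estimates $\mathcal B_N(f,\boldsymbol\ell_m)$ of $\widehat f(\boldsymbol\ell_m)$; they depend on $\boldsymbol\ell$ only through its fiber. Put $\mathcal A(f)(\boldsymbol x)=\sum_{\boldsymbol k\in A}\mathcal B_N(f,\boldsymbol k)e^{2\pi i\boldsymbol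 k\cdot\boldsymbol x}$. The algorithm uses $N_{tot}=NS$ function evaluations. Its worst-case error is $$e_\infty^{\rm wor}(\mathcal A)=\sup_{\|f\|_{\mathcal K}\le1}\ \sup_{\boldsymbol x\in[0,1]^d}|f(\boldsymbol x)-\mathcal A(f)(\boldsymbol x)|.$$ **Theorem.** For every $\tau\in(0,1]$ there is a constant $C>0$, depending only on $d,\alpha,\gamma_1,\gamma_2,\dots,t,\tau$, such that for every prime $N$ and every such $\boldsymbol g$ all the matrices $B$ have linearly independent columns (so that $\mathcal A$ is well defined) and $$e_\infty^{\rm wor}(\mathcal A)\le C(\log N)^{(d-1)/2}N^{-\alpha+1/2+\tau},\qquad e_\infty^{\rm wor}(\mathcal A)\le C(\log N_{tot})^{(2\alpha-1/2-2\tau)d-1/2}N_{tot}^{-\alpha+1/2+\tau}.$$ Moreover, if $\tau\le\alpha-1/2$, then also $$(\log N)^{(d-1)/2}N^{-\alpha+1/2+\tau}\le C(\log N_{tot})^{(2\alpha-1/2-2\tau)d-1/2}N_{tot}^{-\alpha+1/2+\tau}.$$ -/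

import Mathlib

open Real Finset
open scoped ENNReal Matrix

noncomputable section

namespace Korobov

/-! Conventions.  A weight sequence is `γ : ℕ → ℝ`, indexed from `0` (`γ 0` is the first weight).
A one-periodic function on `ℝ^d` is a function on the torus `UnitAddTorus (Fin d)`, and
`UnitAddTorus.mFourier k x` is `exp (2 π i k · x)`. -/

/-- The weight `r_{α,γ}(k) = ∏ j, max 1 (|k_j|^α / γ_j)` of a frequency. -/
def weight {d : ℕ} (α : ℝ) (γ : ℕ → ℝ) (k : Fin d → ℤ) : ℝ :=
  ∏ j, max 1 (|(k j : ℝ)| ^ α / γ j)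

/-- Membership in the closed unit ball of the weighted Korobov space:
`∑ k, |f̂(k)|^2 r(k)^2` converges and is at most `1`.  For `α > 1/2` the elements of the space
have absolutely convergent Fourier series, so that they are continuous. -/
def InUnitBall {d : ℕ} (α : ℝ) (γ : ℕ → ℝ) (f : C(UnitAddTorus (Fin d), ℂ)) : Prop :=
  Summable (fun k : Fin d → ℤ =>
      ‖UnitAddTorus.mFourierCoeff (⇑f) k‖ ^ 2 * weight α γ k ^ 2) ∧
    ∑' k : Fin d → ℤ, ‖UnitAddTorus.mFourierCoeff (⇑f) k‖ ^ 2 * weight α γ k ^ 2 ≤ 1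

/-- The worst-case uniform error, over the unit ball, of an approximation operator `A`. -/
def worstCaseError {d : ℕ} (α : ℝ) (γ : ℕ → ℝ)
    (A : C(UnitAddTorus (Fin d), ℂ) → UnitAddTorus (Fin d) → ℂ) : ℝ≥0∞ :=
  ⨆ (f : C(UnitAddTorus (Fin d), ℂ)) (_ : InUnitBall α γ f) (x : UnitAddTorus (Fin d)),
    ‖f x - A f x‖ₑ

/-- The hyperbolic cross `{k : r_{α,γ}(k) < M}`. -/
def crossSet (d : ℕ) (α : ℝ) (γ : ℕ → ℝ) (M : ℝ) : Set (Fin d → ℤ) :=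
  {k | weight α γ k < M}

theorem crossSet_finite (d : ℕ) {α : ℝ} {γ : ℕ → ℝ} (hα : 0 < α) (hγ : ∀ j, 0 < γ j) (M : ℝ) :
    (crossSet d α γ M).Finite := by
  have hsub : crossSet d α γ M ⊆
      Set.pi Set.univ fun j : Fin d =>
        Set.Icc (-⌈(γ j * M) ^ (1 / α)⌉) ⌈(γ j * M) ^ (1 / α)⌉ := by
    intro k hk j _
    have h1 : |(k j : ℝ)| ^ α / γ j ≤ weight α γ k := by
      refine (le_max_right 1 _).trans ?_
      unfold weight
      rw [← Finset.mul_prod_erase _ _ (Finset.mem_univ j)]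
      refine le_mul_of_one_le_right (le_trans zero_le_one (le_max_left _ _)) ?_
      exact Finset.prod_induction _ (fun x : ℝ => 1 ≤ x) (fun a b ha hb => one_le_mul_of_one_le_of_one_le ha hb)
        le_rfl fun i _ => le_max_left _ _
    have h2 : |(k j : ℝ)| ^ α ≤ γ j * M := by
      have := (div_le_iff₀ (hγ j)).1 (h1.trans (le_of_lt hk))
      linarith
    have h3 : |(k j : ℝ)| ≤ (γ j * M) ^ (1 / α) := by
      have := Real.rpow_le_rpow (by positivity) h2 (by positivity : 0 ≤ 1 / α)
      rwa [← Real.rpow_mul (abs_nonneg _), mul_one_div_cancel hα.ne', Real.rpow_one] at this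
    have h4 := h3.trans (Int.le_ceil _)
    rw [abs_le] at h4
    exact ⟨by exact_mod_cast h4.1, by exact_mod_cast h4.2⟩
  exact (Set.Finite.pi' fun j => Set.finite_Icc _ _).subset
    (fun k hk j => hsub hk j (Set.mem_univ j))

open Classical in
/-- The hyperbolic cross as a `Finset`. -/
def cross (d : ℕ) (α : ℝ) (γ : ℕ → ℝ) (M : ℝ) : Finset (Fin d → ℤ) :=
  if h : (crossSet d α γ M).Finite then h.toFinset else ∅

theorem mem_cross {d : ℕ} {α : ℝ} {γ : ℕ → ℝ} (hα : 0 < α) (hγ : ∀ j, 0 < γ j) (M : ℝ)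
    (k : Fin d → ℤ) : k ∈ cross d α γ M ↔ weight α γ k < M := by
  rw [cross, dif_pos (crossSet_finite d hα hγ M), Set.Finite.mem_toFinset]
  rfl

/-- The truncation parameter
`M = sup_{1/α < q ≤ 2} (N/2 * ∏ j, (1 + 2 γ_j^q ζ(α q))⁻¹)^{1/q}`. -/
def truncation (d : ℕ) (α : ℝ) (γ : ℕ → ℝ) (N : ℕ) : ℝ :=
  sSup ((fun q : ℝ =>
      ((N : ℝ) / 2 * ∏ j : Fin d,
        (1 + 2 * γ j ^ q * (riemannZeta ((α * q : ℝ) : ℂ)).re)⁻¹) ^ (1 / q)) ''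
    Set.Ioc (1 / α) 2)

/-! ### Rank-1 lattices -/

/-- The dual lattice `{k : k · g ≡ 0 mod N}`. -/
def dualLattice {d : ℕ} (N : ℕ) (g : Fin d → ℕ) : Set (Fin d → ℤ) :=
  {k | (N : ℤ) ∣ ∑ j, k j * (g j : ℤ)}

/-- The squared worst-case integration error
`P_{α,γ,N}(g) = ∑ r_{α,γ}(k)^{-2}`, over nonzero `k` in the dual lattice. -/
def integrationError {d : ℕ} (α : ℝ) (γ : ℕ → ℝ) (N : ℕ) (g : Fin d → ℕ) : ℝ :=
  ∑' k : ↥(dualLattice N g \ {0}), 1 / weight α γ k.1 ^ 2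

/-- `g` is an output of the component-by-component algorithm for `P_{α,γ,N}`: `g_1 = 1`, and each
further component minimizes `P` over `{1, …, N-1}`, the earlier components being fixed
(ties are broken arbitrarily). -/
def IsCBC {d : ℕ} (α : ℝ) (γ : ℕ → ℝ) (N : ℕ) (g : Fin d → ℕ) : Prop :=
  (∀ j, 1 ≤ g j ∧ g j ≤ N - 1) ∧
  (∀ h : 0 < d, g ⟨0, h⟩ = 1) ∧
  ∀ (s : ℕ) (hs : s < d), 1 ≤ s → ∀ x : ℕ, 1 ≤ x → x ≤ N - 1 →
    integrationError α γ N
        (Fin.snoc (α := fun _ => ℕ) (fun i : Fin s => g (Fin.castLE hs.le i)) (g ⟨s, hs⟩)) ≤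
      integrationError α γ N
        (Fin.snoc (α := fun _ => ℕ) (fun i : Fin s => g (Fin.castLE hs.le i)) x)

open Classical in
/-- The fiber of `l`: the frequencies `k` of the hyperbolic cross `A` with `k · g ≡ l · g`. -/
def fiber {d : ℕ} (A : Finset (Fin d → ℤ)) (N : ℕ) (g : Fin d → ℕ) (l : Fin d → ℤ) :
    Finset (Fin d → ℤ) :=
  A.filter fun k => k - l ∈ dualLattice N g

/-- The maximum fiber length `R`. -/
def maxFiber {d : ℕ} (A : Finset (Fin d → ℤ)) (N : ℕ) (g : Fin d → ℕ) : ℕ :=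
  A.sup fun l => (fiber A N g l).card

open Classical in
/-- The set of all differences of two frequencies from a common fiber. -/
def differences {d : ℕ} (A : Finset (Fin d → ℤ)) (N : ℕ) (g : Fin d → ℕ) :
    Finset (Fin d → ℤ) :=
  A.biUnion fun l => (fiber A N g l).image fun k => k - l

/-! ### The projection vector -/

/-- The enumeration `0, 1, -1, 2, -2, …` of the integers. -/
def symmEnum (n : ℕ) : ℤ :=
  if n % 2 = 1 then ((n : ℤ) + 1) / 2 else -((n : ℤ) / 2)

open Classical in
/-- The values forbidden for `z_j`: the integers `-C / h_j` with `C = ∑ l < j, h_l z_l`, for those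
`h` in `H \ {0}` whose last nonzero entry is in position `j` and for which `h_j` divides `C`. -/
def forbidden {d : ℕ} (H : Finset (Fin d → ℤ)) (z : Fin d → ℤ) (j : Fin d) : Finset ℤ :=
  (H.filter fun h => (h j ≠ 0 ∧ ∀ l, j < l → h l = 0) ∧ h j ∣ ∑ l ∈ Finset.Iio j, h l * z l).image
    fun h => -(∑ l ∈ Finset.Iio j, h l * z l) / h j

/-- The vector `z` after `n` steps of the symmetric component-by-component construction: step `j`
sets `z_j` to the first of `0, 1, -1, 2, -2, …` that is not forbidden. -/
def projectionStep {d : ℕ} (H : Finset (Fin d → ℤ)) : ℕ → (Fin d → ℤ)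
  | 0 => 0
  | n + 1 =>
    if hn : n < d then
      Function.update (projectionStep H n) ⟨n, hn⟩
        (symmEnum (sInf {m | symmEnum m ∉ forbidden H (projectionStep H n) ⟨n, hn⟩}))
    else projectionStep H n

/-- The projection vector `z`. -/
def projection {d : ℕ} (H : Finset (Fin d → ℤ)) : Fin d → ℤ :=
  projectionStep H d

/-- The projection integer `X_h = |h · z|`. -/
def projInt {d : ℕ} (z h : Fin d → ℤ) : ℕ :=
  (∑ j, h j * z j).natAbs

/-! ### Shift sets -/

/-- The class in the torus of a point of `ℝ^d`. -/
def toTorus {d : ℕ} (x : Fin d → ℝ) : UnitAddTorus (Fin d) :=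
  fun j => ((x j : ℝ) : UnitAddCircle)

/-- The `p` points `(s, s^2, …, s^d) / p mod 1`. -/
def polyShifts (d p : ℕ) : List (UnitAddTorus (Fin d)) :=
  (List.range p).map fun s => toTorus fun j => (s : ℝ) ^ ((j : ℕ) + 1) / p

/-- The union, with multiplicities, of the lattices `{s z / p mod 1 : 0 ≤ s < p}`, for `p` in the
list `ps`. -/
def latticeShifts {d : ℕ} (z : Fin d → ℤ) (ps : List ℕ) : List (UnitAddTorus (Fin d)) :=
  ps.flatMap fun p => (List.range p).map fun s => toTorus fun j => (s : ℝ) * (z j : ℝ) / p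

theorem length_polyShifts (d p : ℕ) : (polyShifts d p).length = p := by
  simp [polyShifts]

theorem length_latticeShifts {d : ℕ} (z : Fin d → ℤ) (ps : List ℕ) :
    (latticeShifts z ps).length = ps.sum := by
  simp [latticeShifts, List.length_flatMap]

/-- The least prime `≥ n`. -/
def nextPrime (n : ℕ) : ℕ :=
  Nat.find (Nat.exists_infinite_primes n)

theorem le_nextPrime (n : ℕ) : n ≤ nextPrime n :=
  (Nat.find_spec (Nat.exists_infinite_primes n)).1

theorem prime_nextPrime (n : ℕ) : (nextPrime n).Prime :=
  (Nat.find_spec (Nat.exists_infinite_primes n)).2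

/-- The first `k` primes that are `≥ n`, in increasing order. -/
def primesFrom : ℕ → ℕ → List ℕ
  | _, 0 => []
  | n, k + 1 => nextPrime n :: primesFrom (nextPrime n + 1) k

/-- The theoretical prime sequence: `k` consecutive primes `p_1 < … < p_k`, where `p_1` is the
least prime with `p_1 ≥ 2 (R-1) ln V / (c t)`, `c = 0.32`, and
`k = ⌈2 (R-1) ln V / (t ln p_1)⌉` (but at least one prime), with `V = max_{h ∈ H} |h · z|`. -/
def theoreticalPrimes {d : ℕ} (H : Finset (Fin d → ℤ)) (z : Fin d → ℤ) (R : ℕ) (t : ℝ) :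
    List ℕ :=
  let V : ℕ := H.sup (projInt z)
  let p₁ : ℕ := nextPrime ⌈2 * ((R : ℝ) - 1) * Real.log V / (0.32 * t)⌉₊
  primesFrom p₁ (max 1 ⌈2 * ((R : ℝ) - 1) * Real.log V / (t * Real.log p₁)⌉₊)

/-- The test of the polynomial strategy:
`max_{h ∈ H \ {0}} |∑ s, exp (2 π i h · y_s)| ≤ t p / (R - 1)`. -/
def PolyTest {d : ℕ} (H : Finset (Fin d → ℤ)) (R : ℕ) (t : ℝ) (p : ℕ) : Prop :=
  ∀ h ∈ H, h ≠ 0 →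
    ‖((polyShifts d p).map fun y => UnitAddTorus.mFourier h y).sum‖ ≤ t * p / ((R : ℝ) - 1)

/-- The test of the single-lattice strategy. -/
def SingleTest {d : ℕ} (H : Finset (Fin d → ℤ)) (z : Fin d → ℤ) (pmin : ℝ) (p : ℕ) : Prop :=
  pmin ≤ p ∧ ∀ h ∈ H, h ≠ 0 → ¬ p ∣ projInt z h

open Classical in
/-- The test of the greedy multi-lattice strategy: with `S = ∑ p` and with `N_h` the sum of those
`p` in the list that divide `X_h`, one has `N_h / S ≤ t / (R - 1)` for all `h ∈ H \ {0}`. -/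
def GreedyTest {d : ℕ} (H : Finset (Fin d → ℤ)) (z : Fin d → ℤ) (R : ℕ) (t : ℝ)
    (ps : List ℕ) : Prop :=
  ∀ h ∈ H, h ≠ 0 →
    (((ps.filter fun p => p ∣ projInt z h).sum : ℕ) : ℝ) / ((ps.sum : ℕ) : ℝ) ≤
      t / ((R : ℝ) - 1)

open Classical in
/-- The search loop of the adaptive construction.  Its state consists of the current prime `p`,
the best shift set `Y` so far (`S_best` is its length), the primes `ps` accumulated greedily, and
the flag `found` of the greedy strategy. -/
def adaptiveLoop {d : ℕ} (H : Finset (Fin d → ℤ)) (z : Fin d → ℤ) (R : ℕ) (t pmin : ℝ)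
    (p : ℕ) (Y : List (UnitAddTorus (Fin d))) (ps : List ℕ) (found : Bool) :
    List (UnitAddTorus (Fin d)) :=
  if p < Y.length then
    if PolyTest H R t p then polyShifts d p
    else if SingleTest H z pmin p then latticeShifts z [p]
    else if found = true then
      adaptiveLoop H z R t pmin (nextPrime (p + 1)) Y ps true
    else if GreedyTest H z R t (ps ++ [p]) then
      adaptiveLoop H z R t pmin (nextPrime (p + 1))
        (if (latticeShifts z (ps ++ [p])).length < Y.length then latticeShifts z (ps ++ [p]) else Y)
        (ps ++ [p]) true
    else
      adaptiveLoop H z R t pmin (nextPrime (p + 1)) Y (ps ++ [p]) false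
  else Y
  termination_by Y.length - p
  decreasing_by
    all_goals
      have := le_nextPrime (p + 1)
      try split_ifs
      all_goals omega

open Classical in
/-- The adaptive deterministic shift construction. -/
def adaptiveShifts (d : ℕ) (α : ℝ) (γ : ℕ → ℝ) (N : ℕ) (g : Fin d → ℕ) (M t : ℝ) :
    List (UnitAddTorus (Fin d)) :=
  let A := cross d α γ M
  let H := differences A N g
  let R := maxFiber A N g
  let z := projection H
  let pmin : ℝ := (⌊(γ 0 * M) ^ (1 / α)⌋ : ℝ) * (⌊(γ 1 * M) ^ (1 / α)⌋ : ℝ) / N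
  if R = 1 ∨ H = ∅ then [0]
  else
    adaptiveLoop H z R t pmin (nextPrime R) (latticeShifts z (theoreticalPrimes H z R t)) [] false

/-! ### The multiple shift algorithm -/

/-- The lattice point `n g / N mod 1`. -/
def latticePoint {d : ℕ} (N : ℕ) (g : Fin d → ℕ) (n : ℕ) : UnitAddTorus (Fin d) :=
  toTorus fun j => (n : ℝ) * (g j : ℝ) / N

/-- The observation `(1/N) ∑_{n < N} f({n g / N + y}) exp (-2 π i l · (n g / N))`; it depends on `l`
only through the fiber of `l`. -/
def observation {d : ℕ} (N : ℕ) (g : Fin d → ℕ) (f : C(UnitAddTorus (Fin d), ℂ))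
    (l : Fin d → ℤ) (y : UnitAddTorus (Fin d)) : ℂ :=
  (1 / (N : ℂ)) * ∑ n ∈ Finset.range N,
    f (latticePoint N g n + y) * UnitAddTorus.mFourier (-l) (latticePoint N g n)

/-- The matrix `B`, with entries `exp (2 π i l_m · y_s)`, of a set `Γ` of frequencies `l_m`. -/
def systemMatrix {d : ℕ} (Γ : Finset (Fin d → ℤ)) (Y : List (UnitAddTorus (Fin d))) :
    Matrix (Fin Y.length) ↥Γ ℂ :=
  Matrix.of fun s m => UnitAddTorus.mFourier m.1 (Y.get s)

open Classical in
/-- The vector `(Bᴴ B)⁻¹ Bᴴ b` of estimated Fourier coefficients on the fiber of `l`. -/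
def fiberCoeff {d : ℕ} (A : Finset (Fin d → ℤ)) (N : ℕ) (g : Fin d → ℕ)
    (Y : List (UnitAddTorus (Fin d))) (f : C(UnitAddTorus (Fin d), ℂ)) (l : Fin d → ℤ) :
    ↥(fiber A N g l) → ℂ :=
  ((systemMatrix (fiber A N g l) Y)ᴴ * systemMatrix (fiber A N g l) Y)⁻¹ *ᵥ
    ((systemMatrix (fiber A N g l) Y)ᴴ *ᵥ fun s => observation N g f l (Y.get s))

theorem mem_fiber_self {d : ℕ} {A : Finset (Fin d → ℤ)} (N : ℕ) (g : Fin d → ℕ)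
    {l : Fin d → ℤ} (hl : l ∈ A) : l ∈ fiber A N g l := by
  simp [fiber, dualLattice, hl]

/-- The approximation `∑_{k ∈ A} B_N(f, k) exp (2 π i k · x)`.  The fibers partition `A`, and `k`
itself serves as the representative of its fiber. -/
def approx {d : ℕ} (A : Finset (Fin d → ℤ)) (N : ℕ) (g : Fin d → ℕ)
    (Y : List (UnitAddTorus (Fin d))) (f : C(UnitAddTorus (Fin d), ℂ))
    (x : UnitAddTorus (Fin d)) : ℂ :=
  ∑ k : ↥A, fiberCoeff A N g Y f k.1 ⟨k.1, mem_fiber_self N g k.2⟩ * UnitAddTorus.mFourier k.1 x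

end Korobov

end

noncomputable section

namespace Korobov

/-! The truncation error and the aliasing error are both governed by the sum of |f̂(k)| over the
frequencies k outside A. Suppose every Gram matrix BᴴB has smallest eigenvalue at least 1 - t. Then
least squares turns a data error E into a coefficient error of at most √(S/(1-t)) E. On one fiber, E
is at most the sum of |f̂(k)| over the outside frequencies aliased to it, and each outside frequency
is aliased to at most R elements of A. Hence the uniform error is at most (1 + √(S/(1-t)) R) ∑_{k ∉
A} |f̂(k)| (`norm_sub_approx_le`). By Cauchy-Schwarz the last sum is O(M^{q/2-1}) for each q in
(1/α, 2] (`outerSum_le`). Since M ≥ c N^{1/q}, a value of q close to 1/α gives N^{-α+1/2+τ/2}. It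
remains to show that R and S are polylogarithmic in N, for then they cost only another N^{τ/2}
(`exists_length_adaptiveShifts_le`).

Bound for R: averaging over the choices of each component shows that nonzero vectors h of the dual
lattice satisfy r(h) ≥ cM (`le_weight_of_isCBC`, `exists_mul_truncation_le_weight`). So a fiber is a
subset of a hyperbolic cross whose elements differ by vectors outside a comparable hyperbolic cross.
The cross is covered by O((log N)^{d-1}) dyadic boxes, each of which contains boundedly many such
points (`exists_maxFiber_le`).

Bound for S: the search never returns more shifts than the theoretical primes provide. The integers
X_h are nonzero and polynomially bounded in N, so few primes ≥ p_1 can divide one of them. With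
Chebyshev's lower bound for π, the theoretical primes sum to O(p_1²) = O((log N)^{2d})
(`sum_theoreticalPrimes_le`). Stability of whichever shift set is returned is Gershgorin's theorem
(`le_re_functional`, `adaptiveShifts_spec`).

The rate in N_tot follows from S ≤ K (log N)^{2d} when τ ≤ α - 1/2. For larger τ the claimed bound
stays away from 0 while the error is bounded. -/

/-! ### Weights and the sums of their negative powers. -/

theorem one_le_weight {d : ℕ} (α : ℝ) (γ : ℕ → ℝ) (k : Fin d → ℤ) : 1 ≤ weight α γ k :=
  Finset.prod_induction _ (fun x : ℝ => 1 ≤ x)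
    (fun _ _ ha hb => one_le_mul_of_one_le_of_one_le ha hb) le_rfl fun _ _ => le_max_left _ _

theorem weight_pos {d : ℕ} (α : ℝ) (γ : ℕ → ℝ) (k : Fin d → ℤ) : 0 < weight α γ k :=
  zero_lt_one.trans_le (one_le_weight α γ k)

theorem max_one_rpow {x p : ℝ} (hx : 0 ≤ x) (hp : 0 ≤ p) : max 1 (x ^ p) = max 1 x ^ p := by
  rcases le_total x 1 with h | h
  · rw [max_eq_left h, Real.one_rpow, max_eq_left (Real.rpow_le_one hx h hp)]
  · rw [max_eq_right h, max_eq_right (Real.one_le_rpow h hp)]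

/-- Running the construction with smoothness β and weights γ_j^{β/α} therefore minimizes the sum of
r^{-2β/α}, so that everything can be stated in terms of r alone. -/
theorem weight_rescale {d : ℕ} {α β : ℝ} {γ : ℕ → ℝ} (hα : 0 < α) (hβ : 0 ≤ β)
    (hγ : ∀ j, 0 < γ j) (k : Fin d → ℤ) :
    weight β (fun j => γ j ^ (β / α)) k = weight α γ k ^ (β / α) := by
  unfold weight
  rw [← Real.finsetProd_rpow _ _ fun j _ => le_trans zero_le_one (le_max_left _ _)]
  refine Finset.prod_congr rfl fun j _ => ?_
  rw [← max_one_rpow (div_nonneg (Real.rpow_nonneg (abs_nonneg _) _) (hγ j).le) (by positivity),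
    Real.div_rpow (Real.rpow_nonneg (abs_nonneg _) _) (hγ j).le, ← Real.rpow_mul (abs_nonneg _),
    mul_div_cancel₀ _ hα.ne']

theorem tsum_pi_prod {d : ℕ} (F : Fin d → ℤ → ℝ≥0∞) :
    ∑' k : Fin d → ℤ, ∏ j, F j (k j) = ∏ j, ∑' m, F j m := by
  induction d with
  | zero => simp
  | succ n ih =>
    rw [← (Fin.consEquiv fun _ : Fin (n + 1) => ℤ).tsum_eq, ENNReal.tsum_prod', Fin.prod_univ_succ,
      ← ih fun j => F j.succ, ← ENNReal.tsum_mul_right]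
    refine tsum_congr fun m => ?_
    rw [← ENNReal.tsum_mul_left]
    refine tsum_congr fun k => ?_
    simp [Fin.consEquiv, Fin.prod_univ_succ]

/-- The summand `c^q |m|^{-α q}` for `m ≠ 0`, extended by `0`. -/
def tailTerm (α c q : ℝ) (m : ℤ) : ℝ≥0∞ :=
  if m = 0 then 0 else ENNReal.ofReal (c ^ q * |(m : ℝ)| ^ (-(α * q)))

/-- The real value `2 c^q ζ(α q)` of the sum of `tailTerm`. -/
def tailSum (α c q : ℝ) : ℝ :=
  2 * c ^ q * (riemannZeta ((α * q : ℝ) : ℂ)).re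

theorem riemannZeta_re_eq_tsum {s : ℝ} (hs : 1 < s) :
    (riemannZeta (s : ℂ)).re = ∑' n : ℕ, ((n : ℝ) + 1) ^ (-s) := by
  rw [zeta_eq_tsum_one_div_nat_add_one_cpow (by simpa using hs)]
  have : ∀ n : ℕ, (1 : ℂ) / ((n : ℂ) + 1) ^ (s : ℂ) = ((((n : ℝ) + 1) ^ (-s) : ℝ) : ℂ) := by
    intro n
    rw [Real.rpow_neg (by positivity), Complex.ofReal_inv,
      Complex.ofReal_cpow (by positivity), one_div]
    push_cast
    rfl
  simp_rw [this]
  rw [← Complex.ofReal_tsum, Complex.ofReal_re]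

theorem tsum_tailTerm {α c q : ℝ} (hc : 0 < c) (hq : 1 < α * q) :
    ∑' m, tailTerm α c q m = ENNReal.ofReal (tailSum α c q) := by
  have hs : Summable fun n : ℕ => ((n : ℝ) + 1) ^ (-(α * q)) := by
    have := (summable_nat_add_iff 1).2 (Real.summable_nat_rpow.2 (neg_lt_neg hq))
    simpa using this
  have hn : ∑' n : ℕ, ENNReal.ofReal (c ^ q * ((n : ℝ) + 1) ^ (-(α * q))) =
      ENNReal.ofReal (c ^ q * (riemannZeta ((α * q : ℝ) : ℂ)).re) := by
    rw [riemannZeta_re_eq_tsum hq, ← tsum_mul_left,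
      ENNReal.ofReal_tsum_of_nonneg (fun n => by positivity) (hs.mul_left _)]
  have h0 : 0 ≤ (riemannZeta ((α * q : ℝ) : ℂ)).re := by
    rw [riemannZeta_re_eq_tsum hq]
    exact tsum_nonneg fun n => by positivity
  rw [tsum_of_nat_of_neg_add_one ENNReal.summable ENNReal.summable,
    tsum_eq_zero_add' ENNReal.summable]
  have h1 : ∀ n : ℕ, tailTerm α c q ((n + 1 : ℕ) : ℤ) =
      ENNReal.ofReal (c ^ q * ((n : ℝ) + 1) ^ (-(α * q))) := by
    intro n
    rw [tailTerm, if_neg (by omega)]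
    push_cast
    rw [abs_of_nonneg (by positivity)]
  have h2 : ∀ n : ℕ, tailTerm α c q (-((n : ℤ) + 1)) =
      ENNReal.ofReal (c ^ q * ((n : ℝ) + 1) ^ (-(α * q))) := by
    intro n
    rw [tailTerm, if_neg (by omega)]
    push_cast
    rw [abs_neg, abs_of_nonneg (by positivity)]
  simp_rw [h1, h2, hn]
  simp only [Nat.cast_zero, tailTerm, if_true, zero_add]
  rw [← ENNReal.ofReal_add (by positivity) (by positivity), tailSum]
  congr 1
  ring

theorem tailSum_pos {α c q : ℝ} (hc : 0 < c) (hq : 1 < α * q) : 0 < tailSum α c q := by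
  have h : 0 < ∑' m, tailTerm α c q m := by
    refine lt_of_lt_of_le ?_ (ENNReal.le_tsum 1)
    simp [tailTerm, Real.rpow_pos_of_pos hc]
  rw [tsum_tailTerm hc hq] at h
  exact ENNReal.ofReal_pos.1 h

/-- Separating the zero frequency from the others is what produces the factors 1 + 2γ_j^q ζ(αq) in
the definition of M. -/
theorem ofReal_max_rpow_le {α c q : ℝ} (hc : 0 < c) (hq : 0 ≤ q) (m : ℤ) :
    ENNReal.ofReal (max 1 (|(m : ℝ)| ^ α / c) ^ (-q)) ≤
      (if m = 0 then 1 else 0) + tailTerm α c q m := by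
  by_cases hm : m = 0
  · simp only [hm, tailTerm, if_true, add_zero]
    rw [← ENNReal.ofReal_one]
    exact ENNReal.ofReal_le_ofReal (Real.rpow_le_one_of_one_le_of_nonpos (le_max_left _ _) (by linarith))
  · simp only [hm, tailTerm, if_false, zero_add]
    refine ENNReal.ofReal_le_ofReal ?_
    have hm' : 0 < |(m : ℝ)| := by positivity
    have : c ^ q * |(m : ℝ)| ^ (-(α * q)) = (|(m : ℝ)| ^ α / c) ^ (-q) := by
      rw [Real.div_rpow (by positivity) hc.le, ← Real.rpow_mul hm'.le, Real.rpow_neg hc.le]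
      field_simp
    rw [this]
    exact Real.rpow_le_rpow_of_nonpos (by positivity) (le_max_right _ _) (by linarith)

/-- The product `∏ j, (1 + 2 γ_j^q ζ(α q))`. -/
def zetaProd (d : ℕ) (α : ℝ) (γ : ℕ → ℝ) (q : ℝ) : ℝ :=
  ∏ j : Fin d, (1 + tailSum α (γ j) q)

theorem one_le_zetaProd (d : ℕ) {α : ℝ} {γ : ℕ → ℝ} {q : ℝ} (hγ : ∀ j, 0 < γ j)
    (hq : 1 < α * q) : 1 ≤ zetaProd d α γ q :=
  Finset.prod_induction _ (fun x : ℝ => 1 ≤ x)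
    (fun _ _ ha hb => one_le_mul_of_one_le_of_one_le ha hb) le_rfl
    fun j _ => by linarith [tailSum_pos (hγ j) hq]

theorem ofReal_weight_rpow {d : ℕ} (α : ℝ) (γ : ℕ → ℝ) (q : ℝ) (k : Fin d → ℤ) :
    ENNReal.ofReal (weight α γ k ^ (-q)) =
      ∏ j, ENNReal.ofReal (max 1 (|(k j : ℝ)| ^ α / γ j) ^ (-q)) := by
  rw [weight, ← Real.finsetProd_rpow _ _ fun j _ => le_trans zero_le_one (le_max_left _ _),
    ENNReal.ofReal_prod_of_nonneg fun j _ => by positivity]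

theorem tsum_weight_rpow_le (d : ℕ) {α : ℝ} {γ : ℕ → ℝ} {q : ℝ} (hγ : ∀ j, 0 < γ j) (hq0 : 0 ≤ q)
    (hq : 1 < α * q) :
    ∑' k : Fin d → ℤ, ENNReal.ofReal (weight α γ k ^ (-q)) ≤
      ENNReal.ofReal (zetaProd d α γ q) := by
  simp_rw [ofReal_weight_rpow]
  rw [tsum_pi_prod fun (j : Fin d) (m : ℤ) => ENNReal.ofReal (max 1 (|(m : ℝ)| ^ α / γ j) ^ (-q)),
    zetaProd, ENNReal.ofReal_prod_of_nonneg fun j _ => by linarith [tailSum_pos (hγ j) hq]]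
  refine Finset.prod_le_prod' fun j _ => ?_
  rw [ENNReal.ofReal_add zero_le_one (tailSum_pos (hγ j) hq).le, ← tsum_tailTerm (hγ j) hq,
    ENNReal.ofReal_one]
  refine (ENNReal.tsum_le_tsum fun m => ofReal_max_rpow_le (hγ j) hq0 m).trans ?_
  rw [ENNReal.tsum_add, tsum_ite_eq]

theorem summable_weight_rpow (d : ℕ) {α : ℝ} {γ : ℕ → ℝ} {q : ℝ} (hγ : ∀ j, 0 < γ j) (hq0 : 0 ≤ q)
    (hq : 1 < α * q) : Summable fun k : Fin d → ℤ => weight α γ k ^ (-q) := by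
  have h := ENNReal.summable_toReal
    (((tsum_weight_rpow_le d hγ hq0 hq).trans_lt ENNReal.ofReal_lt_top).ne)
  refine h.congr fun k => ?_
  rw [ENNReal.toReal_ofReal (Real.rpow_nonneg (weight_pos _ _ _).le _)]

theorem tsum_real_weight_rpow_le (d : ℕ) {α : ℝ} {γ : ℕ → ℝ} {q : ℝ} (hγ : ∀ j, 0 < γ j)
    (hq0 : 0 ≤ q) (hq : 1 < α * q) :
    ∑' k : Fin d → ℤ, weight α γ k ^ (-q) ≤ zetaProd d α γ q := by
  have h := tsum_weight_rpow_le d hγ hq0 hq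
  rw [← ENNReal.ofReal_tsum_of_nonneg (fun k => Real.rpow_nonneg (weight_pos _ _ _).le _)
    (summable_weight_rpow d hγ hq0 hq)] at h
  exact (ENNReal.ofReal_le_ofReal_iff (zero_le_one.trans (one_le_zetaProd d hγ hq))).1 h

/-! ### Component-by-component construction: averaging argument. -/

/-- Jensen's inequality, from subadditivity of x ↦ x^μ. It trades the exponent 2β/α of the minimized
error for any smaller q. -/
theorem rpow_tsum_le_tsum_rpow {ι : Type*} (a : ι → ℝ≥0∞) {μ : ℝ} (h0 : 0 < μ) (h1 : μ ≤ 1) :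
    (∑' i, a i) ^ μ ≤ ∑' i, a i ^ μ := by
  rw [← ENNReal.le_rpow_inv_iff h0, ENNReal.tsum_eq_iSup_sum]
  refine iSup_le fun s => ?_
  rw [ENNReal.le_rpow_inv_iff h0]
  refine le_trans ?_ (ENNReal.sum_le_tsum s)
  classical
  induction s using Finset.induction_on with
  | empty => simp [h0]
  | insert i s hi ih =>
    rw [Finset.sum_insert hi, Finset.sum_insert hi]
    exact (ENNReal.rpow_add_le_add_rpow _ _ h0.le h1).trans (by gcongr)

open Classical in
theorem tsum_tailTerm_multiples {α c q : ℝ} (hc : 0 < c) (hq : 1 < α * q) {N : ℕ} (hN : 0 < N) :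
    ∑' m : ℤ, (if (N : ℤ) ∣ m then tailTerm α c q m else 0) =
      ENNReal.ofReal ((N : ℝ) ^ (-(α * q))) * ENNReal.ofReal (tailSum α c q) := by
  have hinj : Function.Injective fun m : ℤ => (N : ℤ) * m :=
    fun a b h => mul_left_cancel₀ (by omega : (N : ℤ) ≠ 0) h
  rw [← hinj.tsum_eq, ← tsum_tailTerm hc hq, ← ENNReal.tsum_mul_left]
  · refine tsum_congr fun m => ?_
    rw [if_pos (dvd_mul_right _ _)]
    have hN' : (N : ℤ) ≠ 0 := by omega
    by_cases hm : m = 0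
    · simp [hm, tailTerm]
    · rw [tailTerm, tailTerm, if_neg (mul_ne_zero hN' hm), if_neg hm,
        ← ENNReal.ofReal_mul (by positivity)]
      congr 1
      push_cast
      rw [abs_mul, Nat.abs_cast, Real.mul_rpow (by positivity) (by positivity), mul_left_comm]
  · intro m hm
    by_contra h
    refine hm (if_neg fun ⟨x, hx⟩ => h ⟨x, hx.symm⟩)

theorem eq_of_dvd_add_mul {N : ℕ} (hN : N.Prime) {a m : ℤ} (hm : ¬ (N : ℤ) ∣ m) {x y : ℕ}
    (hx : x < N) (hy : y < N) (h1 : (N : ℤ) ∣ a + m * x) (h2 : (N : ℤ) ∣ a + m * y) : x = y := by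
  have h3 : (N : ℤ) ∣ m * ((x : ℤ) - y) := by
    have := dvd_sub h1 h2
    rwa [show a + m * x - (a + m * y) = m * ((x : ℤ) - y) by ring] at this
  have h4 := ((Nat.prime_iff_prime_int.1 hN).dvd_or_dvd h3).resolve_left hm
  have h5 := Int.eq_zero_of_abs_lt_dvd h4 (by rw [abs_lt]; constructor <;> omega)
  omega

-- If N divides a, the congruence says N ∣ m for every x, and the N - 1 equal sums are each smaller
-- by N^{-αq} ≤ 1/N. Otherwise no multiple m of N contributes, and any other m is counted for at
-- most one x.
open Classical in
theorem sum_tsum_tailTerm_congruent_le {α c q : ℝ} (hc : 0 < c) (hq : 1 < α * q) {N : ℕ}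
    (hN : N.Prime) (a : ℤ) :
    ∑ x ∈ Icc 1 (N - 1), ∑' m : ℤ, (if (N : ℤ) ∣ a + m * x then tailTerm α c q m else 0) ≤
      ENNReal.ofReal (tailSum α c q) := by
  by_cases ha : (N : ℤ) ∣ a
  · have hx : ∀ x ∈ Icc 1 (N - 1),
        ∑' m : ℤ, (if (N : ℤ) ∣ a + m * x then tailTerm α c q m else 0) =
        ENNReal.ofReal ((N : ℝ) ^ (-(α * q))) * ENNReal.ofReal (tailSum α c q) := by
      intro x hx
      rw [← tsum_tailTerm_multiples hc hq hN.pos]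
      refine tsum_congr fun m => ?_
      have : (N : ℤ) ∣ a + m * x ↔ (N : ℤ) ∣ m := by
        rw [(Int.dvd_add_right ha)]
        refine ⟨fun h => ((Nat.prime_iff_prime_int.1 hN).dvd_or_dvd h).resolve_right fun h' => ?_,
          fun h => h.mul_right _⟩
        rw [mem_Icc] at hx
        have := Nat.le_of_dvd (by omega) (Int.natCast_dvd_natCast.1 h')
        have := hN.two_le
        omega
      simp only [this]
    rw [sum_congr rfl hx, sum_const, nsmul_eq_mul, ← mul_assoc]
    refine mul_le_of_le_one_left' ?_
    rw [← ENNReal.ofReal_natCast, ← ENNReal.ofReal_mul (by positivity), ← ENNReal.ofReal_one]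
    refine ENNReal.ofReal_le_ofReal ?_
    have h1 : (1 : ℝ) ≤ N := by exact_mod_cast hN.one_le
    have h2 : (N : ℝ) ^ (-(α * q)) ≤ (N : ℝ) ^ (-1 : ℝ) :=
      Real.rpow_le_rpow_of_exponent_le h1 (by linarith)
    rw [Real.rpow_neg_one] at h2
    calc ((Icc 1 (N - 1)).card : ℝ) * (N : ℝ) ^ (-(α * q)) ≤ N * (N : ℝ)⁻¹ := by
          gcongr
          simp
      _ = 1 := mul_inv_cancel₀ (by positivity)
  · rw [← tsum_tailTerm hc hq]
    rw [← Summable.tsum_finsetSum fun _ _ => ENNReal.summable]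
    refine ENNReal.tsum_le_tsum fun m => ?_
    by_cases hm : (N : ℤ) ∣ m
    · have : ∀ x : ℕ, ¬ (N : ℤ) ∣ a + m * x := fun x h =>
        ha ((Int.dvd_add_left (hm.mul_right _)).1 h)
      simp [this]
    · rw [← sum_filter, sum_const]
      have hcard : #{x ∈ Icc 1 (N - 1) | (N : ℤ) ∣ a + m * (x : ℕ)} ≤ 1 := by
        rw [card_le_one]
        intro x hx y hy
        rw [mem_filter, mem_Icc] at hx hy
        have := hN.two_le
        exact eq_of_dvd_add_mul hN hm (by omega) (by omega) hx.2 hy.2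
      calc _ ≤ 1 • tailTerm α c q m := nsmul_le_nsmul_left (zero_le) hcard
        _ = _ := one_nsmul _

open Classical in
/-- The contribution of the frequencies with nonzero last component to the squared integration
error of the generating vector `(g, x)`. -/
def lastPart {s : ℕ} (α : ℝ) (γ : ℕ → ℝ) (N : ℕ) (g : Fin s → ℕ) (x : ℕ) : ℝ≥0∞ :=
  ∑' k : Fin (s + 1) → ℤ,
    if k (Fin.last s) ≠ 0 ∧ k ∈ dualLattice N (Fin.snoc (α := fun _ => ℕ) g x) then
      ENNReal.ofReal (1 / weight α γ k ^ 2) else 0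

theorem one_div_weight_sq {d : ℕ} (α : ℝ) (γ : ℕ → ℝ) (k : Fin d → ℤ) :
    1 / weight α γ k ^ 2 = weight α γ k ^ (-2 : ℝ) := by
  rw [Real.rpow_neg (weight_pos _ _ _).le, one_div, Real.rpow_two]

-- The condition 2β > 1 makes the real series converge; otherwise the real sum would be the default
-- value 0. From here on the sums live in `ℝ≥0∞`, where rearranging is free.
open Classical in
theorem ofReal_integrationError {s : ℕ} {β : ℝ} {γ : ℕ → ℝ} (hβ : 1 < 2 * β) (hγ : ∀ j, 0 < γ j)
    (N : ℕ) (g : Fin s → ℕ) :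
    ENNReal.ofReal (integrationError β γ N g) =
      ∑' k : Fin s → ℤ, if k ≠ 0 ∧ k ∈ dualLattice N g then
        ENNReal.ofReal (1 / weight β γ k ^ 2) else 0 := by
  have hs : Summable fun k : Fin s → ℤ => 1 / weight β γ k ^ 2 := by
    simp_rw [one_div_weight_sq]
    exact summable_weight_rpow s hγ zero_le_two (by linarith)
  have hsub : Summable fun k : ↥(dualLattice N g \ {0} : Set (Fin s → ℤ)) =>
      1 / weight β γ k.1 ^ 2 := hs.subtype _
  rw [integrationError, ENNReal.ofReal_tsum_of_nonneg (fun k => by positivity) hsub,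
    tsum_subtype (dualLattice N g \ {0} : Set (Fin s → ℤ)) fun k : Fin s → ℤ =>
      ENNReal.ofReal (1 / weight β γ k ^ 2)]
  refine tsum_congr fun k => ?_
  rw [Set.indicator_apply]
  congr 1
  simp [and_comm]

theorem mem_dualLattice_snoc {s N : ℕ} {g : Fin s → ℕ} {x : ℕ} {k : Fin (s + 1) → ℤ} :
    k ∈ dualLattice N (Fin.snoc (α := fun _ => ℕ) g x) ↔
      (N : ℤ) ∣ ∑ j : Fin s, k j.castSucc * (g j : ℤ) + k (Fin.last s) * x := by
  simp [dualLattice, Fin.sum_univ_castSucc]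

-- The frequencies with vanishing last component contribute an amount independent of the last
-- generator, and it is finite, so it cancels. Minimizing the error is thus minimizing the last
-- part.
open Classical in
theorem lastPart_le_of_integrationError_le {s : ℕ} {β : ℝ} {γ : ℕ → ℝ} (hβ : 1 < 2 * β)
    (hγ : ∀ j, 0 < γ j) (N : ℕ) (g : Fin s → ℕ) (x y : ℕ)
    (h : integrationError β γ N (Fin.snoc (α := fun _ => ℕ) g x) ≤
      integrationError β γ N (Fin.snoc (α := fun _ => ℕ) g y)) :
    lastPart β γ N g x ≤ lastPart β γ N g y := by
  set base : ℝ≥0∞ := ∑' k : Fin (s + 1) → ℤ,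
    if k (Fin.last s) = 0 ∧ k ≠ 0 ∧ (N : ℤ) ∣ ∑ j : Fin s, k j.castSucc * (g j : ℤ) then
      ENNReal.ofReal (1 / weight β γ k ^ 2) else 0 with hbase
  have hsplit : ∀ z, ENNReal.ofReal (integrationError β γ N (Fin.snoc (α := fun _ => ℕ) g z)) =
      base + lastPart β γ N g z := by
    intro z
    rw [ofReal_integrationError hβ hγ, hbase, lastPart, ← ENNReal.tsum_add]
    refine tsum_congr fun k => ?_
    rw [mem_dualLattice_snoc]
    by_cases hk : k (Fin.last s) = 0
    · simp [hk]
    · have : k ≠ 0 := fun h0 => hk (by simp [h0])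
      simp [hk, this]
  have hfin : base ≠ ∞ := by
    have h1 : base ≤ ∑' k : Fin (s + 1) → ℤ, ENNReal.ofReal (weight β γ k ^ (-2 : ℝ)) := by
      refine ENNReal.tsum_le_tsum fun k => ?_
      rw [one_div_weight_sq]
      split_ifs
      exacts [le_rfl, zero_le]
    exact ((h1.trans (tsum_weight_rpow_le _ hγ zero_le_two (by linarith))).trans_lt
      ENNReal.ofReal_lt_top).ne
  have := ENNReal.ofReal_le_ofReal h
  rw [hsplit, hsplit] at this
  exact (ENNReal.add_le_add_iff_left hfin).1 this

-- Jensen with μ = qα/(2β) reduces the last part to a sum of r^{-q}. For each fixed choice of the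
-- first components, the sum over x and the last frequency is controlled by the congruence count.
open Classical in
theorem sum_lastPart_rpow_le {s : ℕ} {α β : ℝ} {γ : ℕ → ℝ} {q : ℝ} (hα : 0 < α) (hβ : 0 < β)
    (hγ : ∀ j, 0 < γ j) (hq : 1 < α * q) (hqβ : q ≤ 2 * β / α) {N : ℕ} (hN : N.Prime)
    (g : Fin s → ℕ) :
    ∑ x ∈ Icc 1 (N - 1), lastPart β (fun j => γ j ^ (β / α)) N g x ^ (q * α / (2 * β)) ≤
      ENNReal.ofReal (zetaProd s α γ q * tailSum α (γ s) q) := by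
  have hq0 : 0 < q := by
    by_contra h
    nlinarith
  have hμ0 : 0 < q * α / (2 * β) := by positivity
  have hμ1 : q * α / (2 * β) ≤ 1 := by
    rw [div_le_one (by positivity)]
    exact (le_div_iff₀ hα).1 hqβ
  have hterm : ∀ x, lastPart β (fun j => γ j ^ (β / α)) N g x ^ (q * α / (2 * β)) ≤
      ∑' k : Fin s → ℤ, ENNReal.ofReal (weight α γ k ^ (-q)) *
        ∑' m : ℤ, if (N : ℤ) ∣ ∑ j : Fin s, k j * (g j : ℤ) + m * x then
          tailTerm α (γ s) q m else 0 := by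
    intro x
    refine (rpow_tsum_le_tsum_rpow _ hμ0 hμ1).trans ?_
    rw [← (Fin.snocEquiv fun _ : Fin (s + 1) => ℤ).tsum_eq, ENNReal.tsum_prod', ENNReal.tsum_comm]
    refine ENNReal.tsum_le_tsum fun k => ?_
    rw [← ENNReal.tsum_mul_left]
    refine ENNReal.tsum_le_tsum fun m => ?_
    simp only [Fin.snocEquiv, Equiv.coe_fn_mk, mem_dualLattice_snoc, Fin.snoc_castSucc,
      Fin.snoc_last]
    by_cases hm : m = 0
    · simp [hm, hμ0]
    · by_cases hd : (N : ℤ) ∣ ∑ j : Fin s, k j * (g j : ℤ) + m * x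
      · rw [if_pos ⟨hm, hd⟩, if_pos hd, one_div_weight_sq, weight_rescale hα hβ.le hγ,
          ENNReal.ofReal_rpow_of_nonneg (Real.rpow_nonneg (Real.rpow_nonneg (weight_pos _ _ _).le _) _)
            hμ0.le, ← Real.rpow_mul (weight_pos _ _ _).le,
            ← Real.rpow_mul (weight_pos _ _ _).le]
        have he : β / α * -2 * (q * α / (2 * β)) = -q := by field_simp
        rw [he, ofReal_weight_rpow, ofReal_weight_rpow, Fin.prod_univ_castSucc]
        simp only [Fin.snoc_castSucc, Fin.snoc_last, Fin.val_castSucc, Fin.val_last]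
        gcongr
        refine (ofReal_max_rpow_le (hγ s) hq0.le m).trans ?_
        simp [hm]
      · rw [if_neg fun h => hd h.2, if_neg hd, ENNReal.zero_rpow_of_pos hμ0, mul_zero]
  refine (sum_le_sum fun x _ => hterm x).trans ?_
  rw [← Summable.tsum_finsetSum fun _ _ => ENNReal.summable]
  simp_rw [← Finset.mul_sum]
  calc _ ≤ ∑' k : Fin s → ℤ, ENNReal.ofReal (weight α γ k ^ (-q)) *
        ENNReal.ofReal (tailSum α (γ s) q) := by
        refine ENNReal.tsum_le_tsum fun k => ?_
        gcongr
        exact sum_tsum_tailTerm_congruent_le (hγ s) hq hN _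
    _ ≤ _ := by
        rw [ENNReal.tsum_mul_right, ENNReal.ofReal_mul
          (zero_le_one.trans (one_le_zetaProd s hγ hq))]
        gcongr
        exact tsum_weight_rpow_le s hγ hq0.le hq

theorem exists_last_ne_zero {d : ℕ} {h : Fin d → ℤ} (hh : h ≠ 0) :
    ∃ s : Fin d, h s ≠ 0 ∧ ∀ j, s < j → h j = 0 := by
  classical
  obtain ⟨i, hi⟩ := Function.ne_iff.1 hh
  obtain ⟨s, hs, hmax⟩ := (univ.filter fun j => h j ≠ 0).exists_max_image id
    ⟨i, mem_filter.2 ⟨mem_univ _, hi⟩⟩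
  refine ⟨s, (mem_filter.1 hs).2, fun j hj => ?_⟩
  by_contra hne
  exact absurd (hmax j (mem_filter.2 ⟨mem_univ _, hne⟩)) (not_le.2 hj)

theorem not_mem_range_castLE {d s : ℕ} (hs : s < d) {j : Fin d}
    (hj : j ∉ Set.range (Fin.castLE (show s + 1 ≤ d by omega))) : (⟨s, hs⟩ : Fin d) < j := by
  by_contra hlt
  refine hj ⟨⟨j, ?_⟩, rfl⟩
  have : (j : ℕ) ≤ s := by simpa [Fin.lt_def] using hlt
  omega

/-- A zero coordinate contributes the factor 1, since 0^α = 0. A dual vector can thus be cut off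
after its last nonzero entry and treated at the step that chose that component. -/
theorem weight_castLE {d s : ℕ} (hs : s < d) (α : ℝ) (γ : ℕ → ℝ) {h : Fin d → ℤ}
    (hα : 0 < α) (hz : ∀ j, ⟨s, hs⟩ < j → h j = 0) :
    weight α γ (fun i : Fin (s + 1) => h (Fin.castLE hs i)) = weight α γ h := by
  refine Fintype.prod_of_injective (Fin.castLE hs) (Fin.castLE_injective hs) _ _ (fun j hj => ?_)
    fun i => rfl
  rw [hz j (not_mem_range_castLE hs hj)]
  simp [Real.zero_rpow hα.ne']

/-- The dual lattice of a generating vector obtained component by component avoids a hyperbolic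
cross. -/
theorem le_weight_of_isCBC {d : ℕ} {α β : ℝ} {γ : ℕ → ℝ} {q : ℝ} (hα : 0 < α) (hβ : 1 < 2 * β)
    (hγ : ∀ j, 0 < γ j) (hq : 1 < α * q) (hqβ : q ≤ 2 * β / α) {N : ℕ} (hN : N.Prime)
    {g : Fin d → ℕ} (hg : IsCBC β (fun j => γ j ^ (β / α)) N g) {h : Fin d → ℤ}
    (hh : h ∈ dualLattice N g) (h0 : h ≠ 0) :
    ((N : ℝ) / 2 * (zetaProd d α γ q)⁻¹) ^ (1 / q) ≤ weight α γ h := by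
  have hq0 : 0 < q := by
    by_contra h
    nlinarith
  have hβ0 : 0 < β := by linarith
  have hr := weight_pos α γ h
  have hN2 : (2 : ℝ) ≤ N := by exact_mod_cast hN.two_le
  have hZ := one_le_zetaProd d hγ hq
  suffices hmain : weight α γ h ^ (-q) ≤ 2 / N * zetaProd d α γ q by
    rw [Real.rpow_neg hr.le] at hmain
    have h1 : (N : ℝ) / 2 * (zetaProd d α γ q)⁻¹ ≤ weight α γ h ^ q := by
      have hrq := Real.rpow_pos_of_pos hr q
      rw [inv_le_comm₀ hrq (by positivity)] at hmain
      refine le_trans (le_of_eq ?_) hmain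
      field_simp
    refine (Real.rpow_le_rpow (by positivity) h1 (by positivity)).trans (le_of_eq ?_)
    rw [← Real.rpow_mul hr.le, mul_one_div_cancel hq0.ne', Real.rpow_one]
  obtain ⟨⟨s, hs⟩, hhs, hz⟩ := exists_last_ne_zero h0
  set k : Fin (s + 1) → ℤ := fun i => h (Fin.castLE hs i) with hk
  have hkw : weight α γ k = weight α γ h := weight_castLE hs α γ hα hz
  have hgk : Fin.snoc (α := fun _ => ℕ) (fun i : Fin s => g (Fin.castLE hs.le i)) (g ⟨s, hs⟩) =
      fun i : Fin (s + 1) => g (Fin.castLE hs i) := by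
    refine funext fun i => Fin.lastCases ?_ (fun j => ?_) i
    · rw [Fin.snoc_last]; rfl
    · rw [Fin.snoc_castSucc]; rfl
  have hkd : k ∈ dualLattice N (Fin.snoc (α := fun _ => ℕ)
      (fun i : Fin s => g (Fin.castLE hs.le i)) (g ⟨s, hs⟩)) := by
    rw [hgk]
    change (N : ℤ) ∣ _
    have : ∑ j, h j * (g j : ℤ) = ∑ i : Fin (s + 1), k i * (g (Fin.castLE hs i) : ℤ) := by
      refine (Fintype.sum_of_injective (Fin.castLE hs) (Fin.castLE_injective hs) _ _
        (fun j hj => ?_) fun i => rfl).symm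
      rw [hz j (not_mem_range_castLE hs hj), zero_mul]
    rw [← this]
    exact hh
  have hklast : k (Fin.last s) ≠ 0 := hhs
  have hone : ∀ j, 0 < 1 + tailSum α (γ j) q := fun j => by linarith [tailSum_pos (hγ j) hq]
  have hprod : zetaProd s α γ q * (1 + tailSum α (γ s) q) ≤ zetaProd d α γ q := by
    have : zetaProd s α γ q * (1 + tailSum α (γ s) q) = zetaProd (s + 1) α γ q := by
      simp [zetaProd, Fin.prod_univ_castSucc]
    rw [this, zetaProd, zetaProd]
    simp_rw [Fin.prod_univ_eq_prod_range (fun j => 1 + tailSum α (γ j) q)]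
    exact Finset.prod_le_prod_of_subset_of_one_le (range_subset_range.2 hs)
      (fun j _ => (hone j).le) fun j _ _ => by linarith [tailSum_pos (hγ j) hq]
  have hZs := one_le_zetaProd s hγ hq
  have hT := tailSum_pos (hγ s) hq
  -- The first component is fixed to 1 rather than optimized. Here the remaining frequency is a
  -- nonzero multiple of N, and its weight is bounded directly.
  rcases Nat.eq_zero_or_pos s with rfl | hs0
  · have hg1 := hg.2.1 hs
    have hdvd : (N : ℤ) ∣ k (Fin.last 0) := by
      rw [mem_dualLattice_snoc, hg1] at hkd
      simpa using hkd
    have hle : (N : ℝ) ≤ |(k (Fin.last 0) : ℝ)| := by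
      have := Int.le_of_dvd (abs_pos.2 hklast) ((dvd_abs _ _).2 hdvd)
      exact_mod_cast this
    have htail : γ 0 ^ q ≤ tailSum α (γ 0) q := by
      have h1 : tailTerm α (γ 0) q 1 ≤ ∑' m, tailTerm α (γ 0) q m := ENNReal.le_tsum 1
      rw [tsum_tailTerm (hγ 0) hq] at h1
      simp only [tailTerm, one_ne_zero, if_false, Int.cast_one, abs_one, Real.one_rpow,
        mul_one] at h1
      exact (ENNReal.ofReal_le_ofReal_iff hT.le).1 h1
    have hw : |(k (Fin.last 0) : ℝ)| ^ α / γ 0 ≤ weight α γ h := by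
      rw [← hkw]
      exact (le_max_right 1 _).trans_eq
        (Fin.prod_univ_one fun j : Fin 1 => max 1 (|(k j : ℝ)| ^ α / γ j)).symm
    have hNα : (N : ℝ) ^ α / γ 0 ≤ weight α γ h :=
      le_trans (div_le_div_of_nonneg_right (Real.rpow_le_rpow (by positivity) hle hα.le)
        (hγ 0).le) hw
    calc weight α γ h ^ (-q) ≤ ((N : ℝ) ^ α / γ 0) ^ (-q) :=
          Real.rpow_le_rpow_of_nonpos (div_pos (by positivity) (hγ 0)) hNα (by linarith)
      _ = (N : ℝ) ^ (-(α * q)) * γ 0 ^ q := by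
          rw [Real.div_rpow (by positivity) (hγ 0).le, ← Real.rpow_mul (by positivity),
            Real.rpow_neg (hγ 0).le]
          field_simp
      _ ≤ (N : ℝ) ^ (-1 : ℝ) * tailSum α (γ 0) q := by
          gcongr
          · exact (Real.rpow_pos_of_pos (hγ 0) q).le
          · linarith
      _ ≤ 2 / N * zetaProd d α γ q := by
          rw [Real.rpow_neg_one]
          have h2 : tailSum α (γ 0) q ≤ zetaProd d α γ q := by
            refine le_trans ?_ hprod
            nlinarith
          rw [div_eq_mul_inv]
          have : (0 : ℝ) < (N : ℝ)⁻¹ := by positivity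
          nlinarith [mul_le_mul_of_nonneg_left h2 this.le]
  · have hβα : ∀ j, 0 < γ j ^ (β / α) := fun j => Real.rpow_pos_of_pos (hγ j) _
    set θ := lastPart β (fun j => γ j ^ (β / α)) N (fun i : Fin s => g (Fin.castLE hs.le i)) with hθ
    have hmin : ∀ x ∈ Icc 1 (N - 1), θ (g ⟨s, hs⟩) ≤ θ x := fun x hx =>
      lastPart_le_of_integrationError_le hβ hβα N _ _ _
        (hg.2.2 s hs hs0 x (mem_Icc.1 hx).1 (mem_Icc.1 hx).2)
    have hμ0 : 0 < q * α / (2 * β) := by positivity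
    have hkθ : ENNReal.ofReal (weight α γ h ^ (-q)) ≤ θ (g ⟨s, hs⟩) ^ (q * α / (2 * β)) := by
      have h1 : ENNReal.ofReal (1 / weight β (fun j => γ j ^ (β / α)) k ^ 2) ≤ θ (g ⟨s, hs⟩) := by
        rw [hθ, lastPart]
        refine le_trans (le_of_eq ?_) (ENNReal.le_tsum k)
        rw [if_pos ⟨hklast, hkd⟩]
      refine le_trans (le_of_eq ?_) (ENNReal.rpow_le_rpow h1 hμ0.le)
      rw [one_div_weight_sq, weight_rescale hα hβ0.le hγ,
          ENNReal.ofReal_rpow_of_nonneg (Real.rpow_nonneg (Real.rpow_nonneg (weight_pos _ _ _).le _) _)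
            hμ0.le, ← Real.rpow_mul (weight_pos _ _ _).le,
            ← Real.rpow_mul (weight_pos _ _ _).le, hkw]
      congr 2
      field_simp
    have hsum := sum_lastPart_rpow_le (s := s) hα hβ0 hγ hq hqβ hN
      (fun i : Fin s => g (Fin.castLE hs.le i))
    -- The minimum is at most the average over the N - 1 candidates, and the single vector h is at
    -- most the whole sum.
    have h2 : ((N - 1 : ℕ) : ℝ≥0∞) * ENNReal.ofReal (weight α γ h ^ (-q)) ≤
        ENNReal.ofReal (zetaProd s α γ q * tailSum α (γ s) q) := by
      refine le_trans ?_ hsum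
      calc _ = ∑ x ∈ Icc 1 (N - 1), ENNReal.ofReal (weight α γ h ^ (-q)) := by simp
        _ ≤ _ := sum_le_sum fun x hx => hkθ.trans (ENNReal.rpow_le_rpow (hmin x hx) hμ0.le)
    rw [← ENNReal.ofReal_natCast, ← ENNReal.ofReal_mul (by positivity),
      ENNReal.ofReal_le_ofReal_iff (by positivity)] at h2
    rw [Nat.cast_sub hN.one_le, Nat.cast_one] at h2
    -- N/2 ≤ N - 1 explains the factor 1/2 in the definition of M.
    have h3 : (N : ℝ) / 2 * weight α γ h ^ (-q) ≤ zetaProd d α γ q := by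
      have := Real.rpow_pos_of_pos hr (-q)
      nlinarith
    rw [div_mul_eq_mul_div, le_div_iff₀ (by positivity)]
    linarith

/-! ### The truncation parameter M. -/

/-- The expression whose supremum over `q` is the truncation parameter. -/
def truncTerm (d : ℕ) (α : ℝ) (γ : ℕ → ℝ) (N : ℕ) (q : ℝ) : ℝ :=
  ((N : ℝ) / 2 * (zetaProd d α γ q)⁻¹) ^ (1 / q)

theorem truncation_eq (d : ℕ) (α : ℝ) (γ : ℕ → ℝ) (N : ℕ) :
    truncation d α γ N = sSup (truncTerm d α γ N '' Set.Ioc (1 / α) 2) := by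
  unfold truncation truncTerm zetaProd tailSum
  simp_rw [Finset.prod_inv_distrib]

section

variable {d : ℕ} {α : ℝ} {γ : ℕ → ℝ} {q : ℝ} {N : ℕ}

theorem one_lt_mul_of_mem_Ioc (hα : 0 < α) (hq : q ∈ Set.Ioc (1 / α) 2) : 1 < α * q := by
  have := (div_lt_iff₀ hα).1 hq.1
  linarith

theorem pos_of_mem_Ioc (hα : 0 < α) (hq : q ∈ Set.Ioc (1 / α) 2) : 0 < q :=
  lt_trans (by positivity) hq.1

theorem truncTerm_le (hα : 0 < α) (hγ : ∀ j, 0 < γ j) (hN : 2 ≤ N)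
    (hq : q ∈ Set.Ioc (1 / α) 2) {q₀ : ℝ} (hq₀ : 0 < q₀) (h : q₀ ≤ q) :
    truncTerm d α γ N q ≤ ((N : ℝ) / 2) ^ (1 / q₀) := by
  have hZ := one_le_zetaProd d hγ (one_lt_mul_of_mem_Ioc hα hq)
  have hq0 := pos_of_mem_Ioc hα hq
  have hN' : (2 : ℝ) ≤ N := by exact_mod_cast hN
  refine (Real.rpow_le_rpow (by positivity)
    (mul_le_of_le_one_right (by positivity) (inv_le_one_of_one_le₀ hZ)) (by positivity)).trans ?_
  exact Real.rpow_le_rpow_of_exponent_le (by linarith) (one_div_le_one_div_of_le hq₀ h)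

theorem truncTerm_le_rpow (hα : 0 < α) (hγ : ∀ j, 0 < γ j) (hN : 2 ≤ N)
    (hq : q ∈ Set.Ioc (1 / α) 2) : truncTerm d α γ N q ≤ ((N : ℝ) / 2) ^ α := by
  have := truncTerm_le (d := d) hα hγ hN hq (one_div_pos.2 hα) hq.1.le
  rwa [one_div_one_div] at this

theorem bddAbove_truncTerm (hα : 0 < α) (hγ : ∀ j, 0 < γ j) (hN : 2 ≤ N) :
    BddAbove (truncTerm d α γ N '' Set.Ioc (1 / α) 2) := by
  refine ⟨((N : ℝ) / 2) ^ α, ?_⟩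
  rintro _ ⟨q, hq, rfl⟩
  exact truncTerm_le_rpow hα hγ hN hq

theorem truncTerm_le_truncation (hα : 0 < α) (hγ : ∀ j, 0 < γ j) (hN : 2 ≤ N)
    (hq : q ∈ Set.Ioc (1 / α) 2) : truncTerm d α γ N q ≤ truncation d α γ N := by
  rw [truncation_eq]
  exact le_csSup (bddAbove_truncTerm hα hγ hN) ⟨q, hq, rfl⟩

theorem two_mem_Ioc (hα : 1 / 2 < α) : (2 : ℝ) ∈ Set.Ioc (1 / α) 2 :=
  ⟨by rw [div_lt_iff₀ (by linarith)]; linarith, le_rfl⟩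

theorem truncation_le_rpow (hα : 1 / 2 < α) (hγ : ∀ j, 0 < γ j) (hN : 2 ≤ N) :
    truncation d α γ N ≤ (N : ℝ) ^ α := by
  have hα0 : 0 < α := by linarith
  rw [truncation_eq]
  refine csSup_le ⟨_, 2, two_mem_Ioc hα, rfl⟩ ?_
  rintro _ ⟨q, hq, rfl⟩
  exact (truncTerm_le_rpow hα0 hγ hN hq).trans
    (Real.rpow_le_rpow (by positivity) (by linarith [Nat.cast_nonneg (α := ℝ) N]) hα0.le)

theorem truncTerm_pos (hα : 0 < α) (hγ : ∀ j, 0 < γ j) (hN : 2 ≤ N)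
    (hq : q ∈ Set.Ioc (1 / α) 2) : 0 < truncTerm d α γ N q := by
  have hZ := one_le_zetaProd d hγ (one_lt_mul_of_mem_Ioc hα hq)
  have hN' : (2 : ℝ) ≤ N := by exact_mod_cast hN
  unfold truncTerm
  positivity

theorem truncation_pos (hα : 1 / 2 < α) (hγ : ∀ j, 0 < γ j) (hN : 2 ≤ N) :
    0 < truncation d α γ N :=
  (truncTerm_pos (by linarith) hγ hN (two_mem_Ioc hα)).trans_le
    (truncTerm_le_truncation (by linarith) hγ hN (two_mem_Ioc hα))

theorem truncTerm_eq (hα : 0 < α) (hγ : ∀ j, 0 < γ j) (hq : q ∈ Set.Ioc (1 / α) 2) (N : ℕ) :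
    truncTerm d α γ N q = ((zetaProd d α γ q)⁻¹) ^ (1 / q) * ((N : ℝ) / 2) ^ (1 / q) := by
  have hZ := one_le_zetaProd d hγ (one_lt_mul_of_mem_Ioc hα hq)
  rw [truncTerm, Real.mul_rpow (by positivity) (by positivity), mul_comm]

end

/-- Up to a constant, the truncation parameter is a lower bound for the weights of the nonzero
elements of the dual lattice. -/
theorem exists_mul_truncation_le_weight_of_le (d : ℕ) {α β : ℝ} {γ : ℕ → ℝ} (hα : 0 < α)
    (hβ : 1 < 2 * β) (hβα : β ≤ α) (hγ : ∀ j, 0 < γ j) :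
    ∃ c : ℝ, 0 < c ∧ ∀ N : ℕ, N.Prime → ∀ g : Fin d → ℕ,
      IsCBC β (fun j => γ j ^ (β / α)) N g → ∀ h ∈ dualLattice N g, h ≠ 0 →
      c * truncation d α γ N ≤ weight α γ h := by
  have hq₀ : 2 * β / α ∈ Set.Ioc (1 / α) 2 :=
    ⟨by gcongr, by rw [div_le_iff₀ hα]; linarith⟩
  have hZ := one_le_zetaProd d hγ (one_lt_mul_of_mem_Ioc hα hq₀)
  have hq0 := pos_of_mem_Ioc hα hq₀
  set q₀ := 2 * β / α with hq₀def
  set c := ((zetaProd d α γ q₀)⁻¹) ^ (1 / q₀) with hc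
  have hc0 : 0 < c := by positivity
  have hc1 : c ≤ 1 := Real.rpow_le_one (by positivity) (inv_le_one_of_one_le₀ hZ) (by positivity)
  refine ⟨c, hc0, fun N hN g hg h hh h0 => ?_⟩
  rw [truncation_eq, ← le_div_iff₀' hc0]
  refine csSup_le ⟨_, q₀, hq₀, rfl⟩ ?_
  rintro _ ⟨q, hq, rfl⟩
  rw [le_div_iff₀' hc0]
  -- The averaging bound is available only up to q₀ = 2β/α. For q beyond q₀ the term is at most
  -- (N/2)^{1/q₀}, which the term at q₀ matches up to the constant c.
  rcases le_total q q₀ with hle | hle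
  · refine le_trans (mul_le_of_le_one_left (truncTerm_pos hα hγ hN.two_le hq).le hc1) ?_
    exact le_weight_of_isCBC hα hβ hγ (one_lt_mul_of_mem_Ioc hα hq) hle hN hg hh h0
  · have h1 := truncTerm_le (d := d) hα hγ hN.two_le hq hq0 hle
    have h2 : truncTerm d α γ N q₀ ≤ weight α γ h :=
      le_weight_of_isCBC hα hβ hγ (one_lt_mul_of_mem_Ioc hα hq₀) le_rfl hN hg hh h0
    rw [truncTerm_eq hα hγ hq₀] at h2
    exact (mul_le_mul_of_nonneg_left h1 hc0.le).trans h2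

/-- Only two values of β occur, so the smaller of the two constants serves uniformly. -/
theorem exists_mul_truncation_le_weight (d : ℕ) {α : ℝ} {γ : ℕ → ℝ} (hα : 1 / 2 < α)
    (hγ : ∀ j, 0 < γ j) :
    ∃ c : ℝ, 0 < c ∧ ∀ N : ℕ, N.Prime → ∀ β : ℝ, (β = α ∨ (1 ≤ α ∧ β = ⌊α⌋)) →
      ∀ g : Fin d → ℕ,
      IsCBC β (fun j => γ j ^ (β / α)) N g → ∀ h ∈ dualLattice N g, h ≠ 0 →
      c * truncation d α γ N ≤ weight α γ h := by
  have hα0 : 0 < α := by linarith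
  obtain ⟨c₁, hc₁, h₁⟩ := exists_mul_truncation_le_weight_of_le d (β := α) hα0 (by linarith) le_rfl hγ
  by_cases h1 : 1 ≤ α
  · have hfl : (1 : ℝ) ≤ (⌊α⌋ : ℝ) := by exact_mod_cast Int.le_floor.2 (by simpa using h1)
    obtain ⟨c₂, hc₂, h₂⟩ := exists_mul_truncation_le_weight_of_le d (β := (⌊α⌋ : ℝ)) hα0
      (by linarith) (Int.floor_le α) hγ
    refine ⟨min c₁ c₂, lt_min hc₁ hc₂, fun N hN β hβ g hg h hh h0 => ?_⟩
    have hM := (truncation_pos (d := d) hα hγ hN.two_le).le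
    rcases hβ with rfl | ⟨-, rfl⟩
    · exact (mul_le_mul_of_nonneg_right (min_le_left _ _) hM).trans (h₁ N hN g hg h hh h0)
    · exact (mul_le_mul_of_nonneg_right (min_le_right _ _) hM).trans (h₂ N hN g hg h hh h0)
  · refine ⟨c₁, hc₁, fun N hN β hβ g hg h hh h0 => ?_⟩
    rcases hβ with rfl | ⟨h2, -⟩
    · exact h₁ N hN g hg h hh h0
    · exact absurd h2 h1

/-! ### Fiber lengths: separated points in a hyperbolic cross. -/

theorem mem_fiber {d : ℕ} {A : Finset (Fin d → ℤ)} {N : ℕ} {g : Fin d → ℕ} {k l : Fin d → ℤ} :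
    k ∈ fiber A N g l ↔ k ∈ A ∧ k - l ∈ dualLattice N g := by
  simp [fiber]

theorem sub_mem_dualLattice {d : ℕ} {N : ℕ} {g : Fin d → ℕ} {k l : Fin d → ℤ}
    (hk : k ∈ dualLattice N g) (hl : l ∈ dualLattice N g) : k - l ∈ dualLattice N g := by
  simp only [dualLattice, Set.mem_ofPred_eq] at *
  simpa [sub_mul] using dvd_sub hk hl

/-- The product `∏ j, max 1 |k_j|`. -/
def crossNorm {d : ℕ} (k : Fin d → ℤ) : ℝ :=
  ∏ j, max 1 |(k j : ℝ)|

theorem one_le_crossNorm {d : ℕ} (k : Fin d → ℤ) : 1 ≤ crossNorm k :=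
  Finset.prod_induction _ (fun x : ℝ => 1 ≤ x)
    (fun _ _ ha hb => one_le_mul_of_one_le_of_one_le ha hb) le_rfl fun _ _ => le_max_left _ _

theorem max_one_abs_le_crossNorm {d : ℕ} (k : Fin d → ℤ) (j : Fin d) :
    max 1 |(k j : ℝ)| ≤ crossNorm k := by
  unfold crossNorm
  rw [← Finset.mul_prod_erase _ _ (Finset.mem_univ j)]
  refine le_mul_of_one_le_right (le_trans zero_le_one (le_max_left _ _)) ?_
  exact Finset.prod_induction _ (fun x : ℝ => 1 ≤ x)
    (fun a b ha hb => one_le_mul_of_one_le_of_one_le ha hb) le_rfl fun i _ => le_max_left _ _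

theorem crossNorm_rpow {d : ℕ} (k : Fin d → ℤ) (α : ℝ) :
    crossNorm k ^ α = ∏ j, max 1 |(k j : ℝ)| ^ α :=
  (Real.finsetProd_rpow _ _ (fun _ _ => le_trans zero_le_one (le_max_left _ _)) _).symm

theorem exists_crossNorm_rpow_le_weight (d : ℕ) {α : ℝ} {γ : ℕ → ℝ} (hα : 0 < α)
    (hγ : ∀ j, 0 < γ j) :
    ∃ c : ℝ, 0 < c ∧ ∀ k : Fin d → ℤ, c * crossNorm k ^ α ≤ weight α γ k := by
  refine ⟨∏ j : Fin d, min 1 (γ j)⁻¹,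
    prod_pos fun j _ => lt_min one_pos (inv_pos.2 (hγ j)), fun k => ?_⟩
  rw [crossNorm_rpow, weight, ← prod_mul_distrib]
  refine prod_le_prod (fun j _ => ?_) fun j _ => ?_
  · have := inv_pos.2 (hγ j)
    positivity
  · rw [← max_one_rpow (abs_nonneg _) hα.le]
    have hγj := inv_pos.2 (hγ j)
    rw [mul_max_of_nonneg _ _ (by positivity), mul_one]
    refine max_le_max (min_le_left _ _) ?_
    rw [div_eq_inv_mul]
    gcongr
    exact min_le_right _ _

theorem exists_weight_le_crossNorm_rpow (d : ℕ) {α : ℝ} (γ : ℕ → ℝ) (hα : 0 < α) :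
    ∃ C : ℝ, 0 < C ∧ ∀ k : Fin d → ℤ, weight α γ k ≤ C * crossNorm k ^ α := by
  refine ⟨∏ j : Fin d, max 1 (γ j)⁻¹,
    prod_pos fun j _ => lt_max_of_lt_left one_pos, fun k => ?_⟩
  rw [crossNorm_rpow, weight, ← prod_mul_distrib]
  refine prod_le_prod (fun j _ => by positivity) fun j _ => ?_
  rw [← max_one_rpow (abs_nonneg _) hα.le, mul_max_of_nonneg _ _ (by positivity), mul_one]
  refine max_le_max (le_max_left _ _) ?_
  rw [div_eq_inv_mul]
  gcongr
  exact le_max_right _ _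

theorem card_le_of_crossNorm_le {d : ℕ} (D : Finset (Fin d → ℤ)) (b : ℕ)
    (hD : ∀ k ∈ D, crossNorm k ≤ b) : D.card ≤ (2 * b + 1) ^ d := by
  have hsub : D ⊆ Fintype.piFinset fun _ : Fin d => Icc (-(b : ℤ)) b := by
    intro k hk
    rw [Fintype.mem_piFinset]
    intro j
    have := ((le_max_right _ _).trans (max_one_abs_le_crossNorm k j)).trans (hD k hk)
    rw [abs_le] at this
    rw [mem_Icc]
    exact ⟨by exact_mod_cast this.1, by exact_mod_cast this.2⟩
  refine (card_le_card hsub).trans (le_of_eq ?_)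
  rw [Fintype.card_piFinset_const, Int.card_Icc]
  congr 1
  omega

section Dyadic

variable {n : ℕ}

/-- The dyadic levels of all components but the first. -/
def dyadicLevel (k : Fin (n + 1) → ℤ) (j : Fin n) : ℕ :=
  Nat.log 2 (max 1 (k j.succ).natAbs)

/-- The side lengths of the box with dyadic levels `a` in a hyperbolic cross of size `T`. -/
def dyadicSide (T : ℝ) (a : Fin n → ℕ) : Fin (n + 1) → ℝ :=
  Fin.cons (T / ∏ j, (2 : ℝ) ^ a j) fun j => (2 : ℝ) ^ a j

theorem two_pow_dyadicLevel_le (k : Fin (n + 1) → ℤ) (j : Fin n) :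
    (2 : ℝ) ^ dyadicLevel k j ≤ max 1 |(k j.succ : ℝ)| := by
  have h := Nat.pow_log_le_self 2 (x := max 1 (k j.succ).natAbs) (by omega)
  have h' : ((2 ^ dyadicLevel k j : ℕ) : ℝ) ≤ ((max 1 (k j.succ).natAbs : ℕ) : ℝ) := by
    exact_mod_cast h
  simpa [Nat.cast_natAbs] using h'

theorem max_lt_two_pow_dyadicLevel (k : Fin (n + 1) → ℤ) (j : Fin n) :
    max 1 |(k j.succ : ℝ)| < 2 * (2 : ℝ) ^ dyadicLevel k j := by
  have h := Nat.lt_pow_succ_log_self (b := 2) one_lt_two (max 1 (k j.succ).natAbs)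
  have h' : ((max 1 (k j.succ).natAbs : ℕ) : ℝ) < ((2 ^ (dyadicLevel k j + 1) : ℕ) : ℝ) := by
    exact_mod_cast h
  simpa [Nat.cast_natAbs, pow_succ, mul_comm] using h'

theorem prod_dyadicSide (T : ℝ) (a : Fin n → ℕ) : ∏ j, dyadicSide T a j = T := by
  rw [dyadicSide, Fin.prod_univ_succ]
  simp only [Fin.cons_zero, Fin.cons_succ]
  rw [div_mul_cancel₀]
  exact (prod_pos fun j _ => by positivity).ne'

theorem max_le_dyadicSide_zero {T : ℝ} {k : Fin (n + 1) → ℤ} (hk : crossNorm k ≤ T) :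
    max 1 |(k 0 : ℝ)| ≤ dyadicSide T (dyadicLevel k) 0 := by
  rw [dyadicSide, Fin.cons_zero, le_div_iff₀ (prod_pos fun j _ => by positivity)]
  refine le_trans ?_ hk
  rw [crossNorm, Fin.prod_univ_succ]
  gcongr with j
  exact two_pow_dyadicLevel_le k j

theorem one_le_dyadicSide {T : ℝ} {k : Fin (n + 1) → ℤ} (hk : crossNorm k ≤ T) (j : Fin (n + 1)) :
    1 ≤ dyadicSide T (dyadicLevel k) j := by
  refine Fin.cases ((le_max_left _ _).trans (max_le_dyadicSide_zero hk)) (fun i => ?_) j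
  simp only [dyadicSide, Fin.cons_succ]
  exact one_le_pow₀ one_le_two

theorem abs_le_dyadicSide {T : ℝ} {k : Fin (n + 1) → ℤ} (hk : crossNorm k ≤ T) (j : Fin (n + 1)) :
    |(k j : ℝ)| ≤ 2 * dyadicSide T (dyadicLevel k) j := by
  refine Fin.cases ?_ (fun i => ?_) j
  · have h := (le_max_right 1 |(k 0 : ℝ)|).trans (max_le_dyadicSide_zero hk)
    linarith [abs_nonneg (k 0 : ℝ)]
  · have h := (le_max_right 1 _).trans (max_lt_two_pow_dyadicLevel k i).le
    simpa only [dyadicSide, Fin.cons_succ] using h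

theorem dyadicLevel_le {T : ℝ} {k : Fin (n + 1) → ℤ} (hk : crossNorm k ≤ T) (j : Fin n) :
    dyadicLevel k j ≤ Nat.log 2 ⌊T⌋₊ := by
  refine Nat.log_mono_right (Nat.le_floor ?_)
  have := (max_one_abs_le_crossNorm k j.succ).trans hk
  simpa [Nat.cast_natAbs] using this

/-- A set of points of a hyperbolic cross with well separated elements is small. -/
theorem card_le_of_separated_of_lt {T ρ : ℝ} (hρ0 : 0 < ρ) (hρ1 : ρ ≤ 1)
    (hT : (1 / ρ) ^ (n + 1) < T) {J : ℕ} (hJ : 4 ≤ ρ * J) (D : Finset (Fin (n + 1) → ℤ))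
    (hD : ∀ k ∈ D, crossNorm k ≤ T)
    (hsep : ∀ k ∈ D, ∀ k' ∈ D, k ≠ k' → ρ * T ≤ crossNorm (k - k')) :
    D.card ≤ (2 * J + 1) ^ (n + 1) * (Nat.log 2 ⌊T⌋₊ + 1) ^ n := by
  have hJ4 : (4 : ℝ) ≤ J := hJ.trans (mul_le_of_le_one_left (Nat.cast_nonneg _) hρ1)
  -- Each point of the cross lies in a dyadic box of side lengths comparable to numbers with product
  -- T, cut into boundedly many cells. Only n = d - 1 levels are free, because the first side is
  -- determined by the others; hence the power n of the logarithm.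
  set cell : (Fin (n + 1) → ℤ) → Fin (n + 1) → ℤ := fun k j =>
    ⌊(k j : ℝ) * J / (4 * dyadicSide T (dyadicLevel k) j)⌋ with hcell
  set box : Finset ((Fin (n + 1) → ℤ) × (Fin n → ℕ)) :=
    (Fintype.piFinset fun _ => Icc (-(J : ℤ)) J) ×ˢ
      (Fintype.piFinset fun _ => range (Nat.log 2 ⌊T⌋₊ + 1)) with hbox
  have hcard : box.card = (2 * J + 1) ^ (n + 1) * (Nat.log 2 ⌊T⌋₊ + 1) ^ n := by
    rw [hbox, card_product, Fintype.card_piFinset_const, Fintype.card_piFinset_const, Int.card_Icc,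
      card_range]
    congr 2
    omega
  rw [← hcard]
  refine card_le_card_of_injOn (fun k => (cell k, dyadicLevel k)) (fun k hk => ?_) ?_
  · have hk' := hD k hk
    simp only [hbox, coe_product, Set.mem_prod, mem_coe, Fintype.mem_piFinset, mem_Icc, mem_range]
    refine ⟨fun j => ?_, fun j => Nat.lt_succ_of_le (dyadicLevel_le hk' j)⟩
    have h1 := one_le_dyadicSide hk' j
    have h2 := abs_le_dyadicSide hk' j
    rw [abs_le] at h2
    simp only [hcell]
    rw [Int.le_floor, ← Int.lt_add_one_iff, Int.floor_lt]
    push_cast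
    rw [le_div_iff₀ (by linarith), div_lt_iff₀ (by linarith)]
    constructor <;> nlinarith
  · intro k hk k' hk' heq
    by_contra hne
    rw [mem_coe] at hk hk'
    simp only [Prod.mk.injEq] at heq
    refine absurd (hsep k hk k' hk' hne) (not_le.2 ?_)
    have hs1 : ∀ j, 1 ≤ dyadicSide T (dyadicLevel k) j := one_le_dyadicSide (hD k hk)
    -- A cell has width 4/J times the side, which is at most ρ times the side.
    have hdiff : ∀ j, |((k - k') j : ℝ)| < ρ * dyadicSide T (dyadicLevel k) j := by
      intro j
      have hs : 0 < dyadicSide T (dyadicLevel k) j := by linarith [hs1 j]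
      have h1 := congrFun heq.1 j
      simp only [hcell] at h1
      rw [← heq.2] at h1
      have h2 := Int.abs_sub_lt_one_of_floor_eq_floor h1
      rw [← sub_div, ← sub_mul, abs_div, abs_mul, Nat.abs_cast,
        abs_of_pos (by linarith : 0 < 4 * dyadicSide T (dyadicLevel k) j),
        div_lt_one (by linarith)] at h2
      simp only [Pi.sub_apply, Int.cast_sub]
      by_contra hcon
      rw [not_lt] at hcon
      have h3 := mul_le_mul_of_nonneg_right hcon (Nat.cast_nonneg (α := ℝ) J)
      nlinarith
    -- One long side is needed: max(1, ·) hides the gain ρ in a coordinate unless ρ times its side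
    -- exceeds 1. As T > (1/ρ)^{n+1}, not all sides are short, and one factor ρ is enough.
    obtain ⟨j₀, hj₀⟩ : ∃ j, 1 / ρ < dyadicSide T (dyadicLevel k) j := by
      by_contra hcon
      push Not at hcon
      have : ∏ j, dyadicSide T (dyadicLevel k) j ≤ (1 / ρ) ^ (n + 1) := by
        refine (prod_le_prod (fun j _ => by linarith [hs1 j]) fun j _ => hcon j).trans ?_
        simp
      rw [prod_dyadicSide] at this
      linarith
    rw [← prod_dyadicSide T (dyadicLevel k), crossNorm, ← mul_prod_erase _ _ (mem_univ j₀),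
      ← mul_prod_erase univ (dyadicSide T (dyadicLevel k)) (mem_univ j₀), ← mul_assoc]
    refine mul_lt_mul (max_lt ?_ (hdiff j₀)) (prod_le_prod (fun j _ => by positivity) fun j _ => ?_)
      (prod_pos fun j _ => by positivity) ?_
    · rwa [div_lt_iff₀' hρ0] at hj₀
    · refine max_le (hs1 j) ((hdiff j).le.trans (mul_le_of_le_one_left (by linarith [hs1 j]) hρ1))
    · have := hs1 j₀
      positivity

end Dyadic

theorem exists_card_le_of_separated (n : ℕ) {ρ : ℝ} (hρ0 : 0 < ρ) (hρ1 : ρ ≤ 1) :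
    ∃ C : ℕ, ∀ (T : ℝ) (D : Finset (Fin (n + 1) → ℤ)), (∀ k ∈ D, crossNorm k ≤ T) →
      (∀ k ∈ D, ∀ k' ∈ D, k ≠ k' → ρ * T ≤ crossNorm (k - k')) →
      D.card ≤ C * (Nat.log 2 ⌊T⌋₊ + 1) ^ n := by
  obtain ⟨J, hJ⟩ := exists_nat_ge (4 / ρ)
  rw [div_le_iff₀' hρ0] at hJ
  refine ⟨max ((2 * J + 1) ^ (n + 1)) ((2 * ⌊(1 / ρ) ^ (n + 1)⌋₊ + 1) ^ (n + 1)),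
    fun T D hD hsep => ?_⟩
  by_cases hT : (1 / ρ) ^ (n + 1) < T
  · refine (card_le_of_separated_of_lt hρ0 hρ1 hT hJ D hD hsep).trans ?_
    gcongr
    exact le_max_left _ _
  · refine (card_le_of_crossNorm_le D ⌊(1 / ρ) ^ (n + 1)⌋₊ fun k hk => ?_).trans ?_
    · have hnat : ∃ m : ℕ, crossNorm k = m := by
        refine ⟨∏ j, max 1 (k j).natAbs, ?_⟩
        simp [crossNorm, Nat.cast_natAbs]
      obtain ⟨m, hm⟩ := hnat
      rw [hm]
      have : (m : ℝ) ≤ (1 / ρ) ^ (n + 1) := hm ▸ (hD k hk).trans (not_lt.1 hT)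
      exact_mod_cast Nat.le_floor this
    · refine le_trans (le_max_right ((2 * J + 1) ^ (n + 1)) _) (Nat.le_mul_of_pos_right _ (by positivity))

theorem log_natLog_le {T : ℝ} (hT : 1 ≤ T) : (Nat.log 2 ⌊T⌋₊ : ℝ) ≤ Real.log T / Real.log 2 := by
  rw [le_div_iff₀ (Real.log_pos one_lt_two), ← Real.log_pow]
  refine Real.log_le_log (by positivity) ?_
  have h := Nat.pow_log_le_self 2 (x := ⌊T⌋₊) (Nat.floor_pos.2 hT).ne'
  calc (2 : ℝ) ^ Nat.log 2 ⌊T⌋₊ ≤ (⌊T⌋₊ : ℝ) := by exact_mod_cast h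
    _ ≤ T := Nat.floor_le (by linarith)

/-- The largest fiber has at most logarithmic size. -/
theorem exists_maxFiber_le (d : ℕ) (hd : 1 ≤ d) {α : ℝ} {γ : ℕ → ℝ} (hα : 0 < α)
    (hγ : ∀ j, 0 < γ j) {c : ℝ} (hc : 0 < c) :
    ∃ C : ℝ, 0 < C ∧ ∀ N : ℕ, 2 ≤ N → ∀ (g : Fin d → ℕ) (M : ℝ), M ≤ (N : ℝ) ^ α →
      (∀ h ∈ dualLattice N g, h ≠ 0 → c * M ≤ weight α γ h) →
      (maxFiber (cross d α γ M) N g : ℝ) ≤ C * Real.log N ^ (d - 1) := by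
  obtain ⟨n, rfl⟩ : ∃ n, d = n + 1 := ⟨d - 1, by omega⟩
  obtain ⟨c₁, hc₁, h₁⟩ := exists_crossNorm_rpow_le_weight (n + 1) hα hγ
  obtain ⟨C₁, hC₁, h₂⟩ := exists_weight_le_crossNorm_rpow (n + 1) γ hα
  -- This ρ converts the lower bound cM for weights of differences, relative to the upper bound M on
  -- the fiber, into the separation of products of coordinates relative to T.
  set ρ : ℝ := min 1 ((c * c₁ / C₁) ^ (1 / α)) with hρ
  have hρ0 : 0 < ρ := lt_min one_pos (by positivity)
  obtain ⟨K, hK⟩ := exists_card_le_of_separated n hρ0 (min_le_left _ _)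
  have hl2 : 0 < Real.log 2 := Real.log_pos one_lt_two
  set b : ℝ := |Real.log ((1 / c₁) ^ (1 / α))| with hb
  set B : ℝ := ((1 + b / Real.log 2) / Real.log 2 + 1 / Real.log 2) with hB
  have hB0 : 0 < B := by positivity
  refine ⟨(K + 1) * B ^ n, by positivity, fun N hN g M hM hdual => ?_⟩
  have hlogN : Real.log 2 ≤ Real.log N :=
    Real.log_le_log two_pos (by exact_mod_cast hN)
  have hN0 : (0 : ℝ) < N := by positivity
  rw [Nat.add_sub_cancel, mul_assoc, ← mul_pow]
  have hmain : ∀ l ∈ cross (n + 1) α γ M, ((fiber (cross (n + 1) α γ M) N g l).card : ℝ) ≤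
      (K + 1) * (B * Real.log N) ^ n := by
    intro l hl
    have hlM := (mem_cross hα hγ M l).1 hl
    have hM0 : 0 < M := (weight_pos α γ l).trans hlM
    set T : ℝ := (M / c₁) ^ (1 / α) with hT
    have hcr : ∀ k ∈ fiber (cross (n + 1) α γ M) N g l, crossNorm k ≤ T := by
      intro k hk
      have hkM := (mem_cross hα hγ M k).1 (mem_fiber.1 hk).1
      have hk0 : 0 ≤ crossNorm k := zero_le_one.trans (one_le_crossNorm k)
      have h3 : crossNorm k ^ α ≤ M / c₁ := by
        rw [le_div_iff₀' hc₁]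
        exact (h₁ k).trans hkM.le
      have h4 := Real.rpow_le_rpow (by positivity) h3 (by positivity : 0 ≤ 1 / α)
      rwa [← Real.rpow_mul hk0, mul_one_div_cancel hα.ne', Real.rpow_one] at h4
    have hT1 : 1 ≤ T := (one_le_crossNorm l).trans (hcr l (mem_fiber_self N g hl))
    have hsep : ∀ k ∈ fiber (cross (n + 1) α γ M) N g l, ∀ k' ∈ fiber (cross (n + 1) α γ M) N g l,
        k ≠ k' → ρ * T ≤ crossNorm (k - k') := by
      intro k hk k' hk' hne
      have hmem : k - k' ∈ dualLattice N g := by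
        have := sub_mem_dualLattice (mem_fiber.1 hk).2 (mem_fiber.1 hk').2
        rwa [sub_sub_sub_cancel_right] at this
      have h3 := (hdual _ hmem (sub_ne_zero.2 hne)).trans (h₂ _)
      have hk0 : 0 ≤ crossNorm (k - k') := zero_le_one.trans (one_le_crossNorm _)
      have h4 : c * c₁ / C₁ * (M / c₁) ≤ crossNorm (k - k') ^ α := by
        rw [← div_le_iff₀' hC₁] at h3
        refine le_trans (le_of_eq ?_) h3
        field_simp
      have h5 := Real.rpow_le_rpow (by positivity) h4 (by positivity : 0 ≤ 1 / α)
      rw [← Real.rpow_mul hk0, mul_one_div_cancel hα.ne', Real.rpow_one,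
        Real.mul_rpow (by positivity) (by positivity)] at h5
      exact (mul_le_mul_of_nonneg_right (min_le_right _ _) (by positivity)).trans h5
    have hcard := hK T _ hcr hsep
    have hTN : Real.log T ≤ Real.log N + b := by
      have h3 : T ≤ N * (1 / c₁) ^ (1 / α) := by
        have h4 : M / c₁ ≤ (N : ℝ) ^ α * (1 / c₁) := by
          rw [div_eq_mul_one_div]
          gcongr
        refine (Real.rpow_le_rpow (by positivity) h4 (by positivity)).trans (le_of_eq ?_)
        rw [Real.mul_rpow (by positivity) (by positivity), ← Real.rpow_mul (by positivity),
          mul_one_div_cancel hα.ne', Real.rpow_one]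
      refine (Real.log_le_log (by linarith) h3).trans ?_
      rw [Real.log_mul hN0.ne' (by positivity)]
      gcongr
      exact le_abs_self _
    have hlog : (Nat.log 2 ⌊T⌋₊ : ℝ) + 1 ≤ B * Real.log N := by
      have h3 := log_natLog_le hT1
      have h4 : Real.log T / Real.log 2 ≤ (Real.log N + b) / Real.log 2 := by gcongr
      have h5 : b ≤ b / Real.log 2 * Real.log N := by
        rw [div_mul_eq_mul_div, le_div_iff₀ hl2]
        gcongr
      have h6 : 1 ≤ 1 / Real.log 2 * Real.log N := by
        rw [one_div_mul_eq_div, one_le_div hl2]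
        exact hlogN
      have h7 : (Real.log N + b) / Real.log 2 ≤ (1 + b / Real.log 2) / Real.log 2 * Real.log N := by
        rw [div_mul_eq_mul_div]
        gcongr
        linarith
      rw [hB, add_mul]
      linarith
    calc ((fiber (cross (n + 1) α γ M) N g l).card : ℝ)
        ≤ ((K * (Nat.log 2 ⌊T⌋₊ + 1) ^ n : ℕ) : ℝ) := by exact_mod_cast hcard
      _ = K * ((Nat.log 2 ⌊T⌋₊ : ℝ) + 1) ^ n := by push_cast; ring
      _ ≤ (K + 1) * (B * Real.log N) ^ n := by
        gcongr
        linarith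
  have hfloor : maxFiber (cross (n + 1) α γ M) N g ≤ ⌊(K + 1) * (B * Real.log N) ^ n⌋₊ :=
    Finset.sup_le fun l hl => Nat.le_floor (hmain l hl)
  exact (Nat.le_floor_iff (by positivity)).1 hfloor

/-! ### The projection vector and the size of the projection integers. -/

theorem symmEnum_injective : Function.Injective symmEnum := by
  intro m n h
  unfold symmEnum at h
  split_ifs at h <;> omega

theorem abs_symmEnum_le (n : ℕ) : |symmEnum n| ≤ n := by
  unfold symmEnum
  rw [abs_le]
  split_ifs <;> constructor <;> omega

theorem exists_symmEnum_notMem (F : Finset ℤ) : ∃ m ≤ F.card, symmEnum m ∉ F := by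
  by_contra! h
  have : (range (F.card + 1)).card ≤ F.card :=
    card_le_card_of_injOn symmEnum (fun m hm => h m (by simpa [Nat.lt_succ_iff] using hm))
      symmEnum_injective.injOn
  simp at this

section Projection

variable {d : ℕ} (H : Finset (Fin d → ℤ))

theorem projectionStep_succ {n : ℕ} (hn : n < d) :
    projectionStep H (n + 1) = Function.update (projectionStep H n) ⟨n, hn⟩
        (symmEnum (sInf {m | symmEnum m ∉ forbidden H (projectionStep H n) ⟨n, hn⟩})) := by
  rw [projectionStep, dif_pos hn]

/-- Step n changes coordinate n only, so a coordinate is final once it has been set. -/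
theorem projectionStep_stable (j : Fin d) {n : ℕ} (hn : (j : ℕ) + 1 ≤ n) :
    projectionStep H n j = projectionStep H (j + 1) j := by
  induction n, hn using Nat.le_induction with
  | base => rfl
  | succ n hn ih =>
    rw [← ih, projectionStep]
    split_ifs with h
    · rw [Function.update_of_ne]
      intro h'
      have := congrArg Fin.val h'
      simp only at this
      omega
    · rfl

theorem projection_apply (j : Fin d) :
    projection H j = symmEnum (sInf {m | symmEnum m ∉ forbidden H (projectionStep H j) j}) := by
  rw [projection, projectionStep_stable H j j.2, projectionStep_succ H j.2, Fin.eta,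
    Function.update_self]

theorem projectionStep_eq_projection {l j : Fin d} (h : l < j) :
    projectionStep H j l = projection H l := by
  rw [projection, projectionStep_stable H l h, projectionStep_stable H l l.2]

theorem projection_notMem_forbidden (j : Fin d) :
    projection H j ∉ forbidden H (projectionStep H j) j := by
  rw [projection_apply]
  obtain ⟨m, -, hm⟩ := exists_symmEnum_notMem (forbidden H (projectionStep H j) j)
  exact Nat.sInf_mem (s := {m | symmEnum m ∉ forbidden H (projectionStep H j) j}) ⟨m, hm⟩

theorem card_forbidden_le (z : Fin d → ℤ) (j : Fin d) : (forbidden H z j).card ≤ H.card :=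
  card_image_le.trans (card_filter_le _ _)

/-- At most |H| values are forbidden, and the first m + 1 terms of the enumeration are distinct
integers of size at most m. -/
theorem abs_projection_le (j : Fin d) : |projection H j| ≤ H.card := by
  rw [projection_apply]
  obtain ⟨m, hm, hm'⟩ := exists_symmEnum_notMem (forbidden H (projectionStep H j) j)
  refine (abs_symmEnum_le _).trans ?_
  have h1 : sInf {m | symmEnum m ∉ forbidden H (projectionStep H j) j} ≤ m := Nat.sInf_le hm'
  exact_mod_cast h1.trans (hm.trans (card_forbidden_le H _ j))

/-- If the sum vanished, solving for z_j at the last nonzero entry h_j would exhibit z_j as a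
forbidden value. -/
theorem sum_mul_projection_ne_zero {h : Fin d → ℤ} (hH : h ∈ H) (h0 : h ≠ 0) :
    ∑ j, h j * projection H j ≠ 0 := by
  obtain ⟨j, hj, hz⟩ := exists_last_ne_zero h0
  intro hsum
  have hC : ∑ l ∈ Iio j, h l * projectionStep H j l = ∑ l ∈ Iio j, h l * projection H l :=
    sum_congr rfl fun l hl => by rw [projectionStep_eq_projection H (mem_Iio.1 hl)]
  have hsplit : ∑ l, h l * projection H l =
      ∑ l ∈ Iio j, h l * projectionStep H j l + h j * projection H j := by
    rw [hC, ← sum_subset (subset_univ (insert j (Iio j))), sum_insert (by simp), add_comm]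
    intro l _ hl
    rw [mem_insert, mem_Iio, not_or, not_lt] at hl
    rw [hz l (lt_of_le_of_ne hl.2 (Ne.symm hl.1)), zero_mul]
  rw [hsplit] at hsum
  refine projection_notMem_forbidden H j ?_
  have hC' : -∑ l ∈ Iio j, h l * projectionStep H j l = h j * projection H j := by linarith
  unfold forbidden
  refine mem_image.2 ⟨h, mem_filter.2 ⟨hH, ⟨hj, hz⟩, ?_⟩, ?_⟩
  · exact (dvd_neg).1 ⟨_, hC'⟩
  · rw [hC', Int.mul_ediv_cancel_left _ hj]

theorem projInt_projection_pos {h : Fin d → ℤ} (hH : h ∈ H) (h0 : h ≠ 0) :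
    0 < projInt (projection H) h :=
  Int.natAbs_pos.2 (sum_mul_projection_ne_zero H hH h0)

theorem projInt_projection_le {h : Fin d → ℤ} {b : ℕ} (hb : ∀ j, |h j| ≤ b) :
    projInt (projection H) h ≤ d * (b * H.card) := by
  have h1 : |∑ j, h j * projection H j| ≤ (d * (b * H.card) : ℕ) := by
    refine (abs_sum_le_sum_abs _ _).trans ?_
    calc ∑ j, |h j * projection H j| ≤ ∑ _j : Fin d, (b : ℤ) * H.card := by
          refine sum_le_sum fun j _ => ?_
          rw [abs_mul]
          exact mul_le_mul (hb j) (abs_projection_le H j) (abs_nonneg _) (by positivity)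
      _ = _ := by simp
  rw [projInt]
  rw [Int.abs_eq_natAbs] at h1
  exact_mod_cast h1

end Projection

theorem mem_differences {d : ℕ} {A : Finset (Fin d → ℤ)} {N : ℕ} {g : Fin d → ℕ} {h : Fin d → ℤ} :
    h ∈ differences A N g ↔ ∃ l ∈ A, ∃ k ∈ fiber A N g l, k - l = h := by
  simp [differences]

theorem sub_mem_differences {d : ℕ} {A : Finset (Fin d → ℤ)} {N : ℕ} {g : Fin d → ℕ}
    {k k' l : Fin d → ℤ} (hk : k ∈ fiber A N g l) (hk' : k' ∈ fiber A N g l) :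
    k - k' ∈ differences A N g := by
  rw [mem_fiber] at hk hk'
  refine mem_differences.2 ⟨k', hk'.1, k, mem_fiber.2 ⟨hk.1, ?_⟩, rfl⟩
  have := sub_mem_dualLattice hk.2 hk'.2
  rwa [sub_sub_sub_cancel_right] at this

theorem card_differences_le {d : ℕ} (A : Finset (Fin d → ℤ)) (N : ℕ) (g : Fin d → ℕ) :
    (differences A N g).card ≤ A.card * A.card := by
  classical
  have hsub : differences A N g ⊆ (A ×ˢ A).image fun p => p.1 - p.2 := by
    intro h hh
    obtain ⟨l, hl, k, hk, rfl⟩ := mem_differences.1 hh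
    exact mem_image.2 ⟨(k, l), mem_product.2 ⟨(mem_fiber.1 hk).1, hl⟩, rfl⟩
  exact (card_le_card hsub).trans (card_image_le.trans (card_product _ _).le)

theorem exists_crossNorm_le (d : ℕ) {α : ℝ} {γ : ℕ → ℝ} (hα : 0 < α) (hγ : ∀ j, 0 < γ j) :
    ∃ K : ℕ, 1 ≤ K ∧ ∀ (N : ℕ) (M : ℝ), M ≤ (N : ℝ) ^ α → ∀ k ∈ cross d α γ M,
      crossNorm k ≤ (K * N : ℕ) := by
  obtain ⟨c, hc, h⟩ := exists_crossNorm_rpow_le_weight d hα hγ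
  obtain ⟨K, hK⟩ := exists_nat_ge ((1 / c) ^ (1 / α))
  refine ⟨K + 1, by omega, fun N M hM k hk => ?_⟩
  have hk0 : 0 ≤ crossNorm k := zero_le_one.trans (one_le_crossNorm k)
  have h1 : crossNorm k ^ α ≤ 1 / c * (N : ℝ) ^ α := by
    rw [one_div_mul_eq_div, le_div_iff₀' hc]
    exact (h k).trans (((mem_cross hα hγ M k).1 hk).le.trans hM)
  have h4 := Real.rpow_le_rpow (by positivity) h1 (by positivity : 0 ≤ 1 / α)
  rw [← Real.rpow_mul hk0, mul_one_div_cancel hα.ne', Real.rpow_one,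
    Real.mul_rpow (by positivity) (by positivity), ← Real.rpow_mul (by positivity),
    mul_one_div_cancel hα.ne', Real.rpow_one] at h4
  refine h4.trans ?_
  push_cast
  gcongr
  linarith

/-- The projection integers of the differences are polynomially bounded. -/
theorem exists_log_sup_projInt_le (d : ℕ) {α : ℝ} {γ : ℕ → ℝ} (hα : 0 < α)
    (hγ : ∀ j, 0 < γ j) :
    ∃ C : ℝ, 0 < C ∧ ∀ N : ℕ, 2 ≤ N → ∀ (g : Fin d → ℕ) (M : ℝ), M ≤ (N : ℝ) ^ α →
      Real.log (((differences (cross d α γ M) N g).sup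
        (projInt (projection (differences (cross d α γ M) N g))) : ℕ) : ℝ) ≤ C * Real.log N := by
  obtain ⟨K, hK1, hK⟩ := exists_crossNorm_le d hα hγ
  have hl2 : 0 < Real.log 2 := Real.log_pos one_lt_two
  -- With |k_j| ≤ KN on A one has |A| ≤ (3KN)^d, |H| ≤ |A|² and X_h ≤ d · 2KN · |H|; this gives the
  -- degree 2d + 1 in N. Writing d + 1 for d keeps B positive.
  set B : ℕ := (d + 1) * (2 * K * ((3 * K) ^ d * (3 * K) ^ d)) with hB
  have hB0 : 0 < B := by positivity
  refine ⟨Real.log B / Real.log 2 + (2 * d + 1), ?_, fun N hN g M hM => ?_⟩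
  · have : 0 ≤ Real.log B := Real.log_natCast_nonneg B
    positivity
  set A := cross d α γ M with hA
  set H := differences A N g with hH
  have hlogN : Real.log 2 ≤ Real.log N := Real.log_le_log two_pos (by exact_mod_cast hN)
  have hcardA : A.card ≤ (3 * (K * N)) ^ d := by
    refine (card_le_of_crossNorm_le A (K * N) fun k hk => hK N M hM k hk).trans ?_
    gcongr
    nlinarith
  have hcardH : H.card ≤ (3 * (K * N)) ^ d * (3 * (K * N)) ^ d :=
    (card_differences_le A N g).trans (Nat.mul_le_mul hcardA hcardA)
  have hV : H.sup (projInt (projection H)) ≤ B * N ^ (2 * d + 1) := by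
    refine Finset.sup_le fun h hh => ?_
    obtain ⟨l, hl, k, hk, rfl⟩ := mem_differences.1 hh
    have habs : ∀ x ∈ A, ∀ j, |x j| ≤ ((K * N : ℕ) : ℤ) := by
      intro x hx j
      have := ((le_max_right 1 _).trans (max_one_abs_le_crossNorm x j)).trans (hK N M hM x hx)
      exact_mod_cast this
    have hb : ∀ j, |(k - l) j| ≤ ((2 * (K * N) : ℕ) : ℤ) := by
      intro j
      have h1 := abs_sub (k j) (l j)
      have h2 := habs k (mem_fiber.1 hk).1 j
      have h3 := habs l hl j
      rw [Pi.sub_apply]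
      push_cast at *
      linarith
    refine (projInt_projection_le H hb).trans ?_
    calc d * (2 * (K * N) * H.card)
        ≤ (d + 1) * (2 * (K * N) * ((3 * (K * N)) ^ d * (3 * (K * N)) ^ d)) := by
          gcongr
          omega
      _ = B * N ^ (2 * d + 1) := by
          rw [hB]
          ring
  rcases Nat.eq_zero_or_pos (H.sup (projInt (projection H))) with h0 | h0
  · rw [h0, Nat.cast_zero, Real.log_zero]
    have : 0 ≤ Real.log B := Real.log_natCast_nonneg B
    have : 0 < Real.log N := hl2.trans_le hlogN
    positivity
  · have h1 : Real.log ((H.sup (projInt (projection H)) : ℕ) : ℝ) ≤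
        Real.log ((B * N ^ (2 * d + 1) : ℕ) : ℝ) :=
      Real.log_le_log (by exact_mod_cast h0) (by exact_mod_cast hV)
    refine h1.trans ?_
    push_cast
    rw [Real.log_mul (by positivity) (by positivity), Real.log_pow, add_mul]
    have h2 : Real.log B ≤ Real.log B / Real.log 2 * Real.log N := by
      rw [div_mul_eq_mul_div, le_div_iff₀ hl2]
      exact mul_le_mul_of_nonneg_left hlogN (Real.log_natCast_nonneg B)
    push_cast
    linarith

/-! ### Consecutive primes: size and divisibility. -/

theorem nextPrime_le_of_prime {n p : ℕ} (hn : n ≤ p) (hp : p.Prime) : nextPrime n ≤ p :=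
  Nat.find_min' _ ⟨hn, hp⟩

theorem nextPrime_le (n : ℕ) : nextPrime n ≤ 2 * (n + 1) := by
  obtain ⟨p, hp, hlt, hle⟩ := Nat.exists_prime_lt_and_le_two_mul (n + 1) (by omega)
  exact (nextPrime_le_of_prime (by omega) hp).trans hle

theorem length_primesFrom (n k : ℕ) : (primesFrom n k).length = k := by
  induction k generalizing n with
  | zero => rfl
  | succ k ih => rw [primesFrom, List.length_cons, ih]

theorem prime_of_mem_primesFrom {n k q : ℕ} (h : q ∈ primesFrom n k) : q.Prime ∧ n ≤ q := by
  induction k generalizing n with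
  | zero => simp [primesFrom] at h
  | succ k ih =>
    rw [primesFrom, List.mem_cons] at h
    rcases h with rfl | h
    · exact ⟨prime_nextPrime n, le_nextPrime n⟩
    · have := ih h
      have := le_nextPrime n
      exact ⟨(ih h).1, by omega⟩

theorem nodup_primesFrom (n k : ℕ) : (primesFrom n k).Nodup := by
  induction k generalizing n with
  | zero => simp [primesFrom]
  | succ k ih =>
    rw [primesFrom, List.nodup_cons]
    refine ⟨fun h => ?_, ih _⟩
    have := (prime_of_mem_primesFrom h).2
    omega

theorem card_primes_lt_of_mem_primesFrom {n k q : ℕ} (h : q ∈ primesFrom n k) :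
    #{p ∈ range q | p.Prime ∧ n ≤ p} < k := by
  induction k generalizing n with
  | zero => simp [primesFrom] at h
  | succ k ih =>
    rw [primesFrom, List.mem_cons] at h
    rcases h with rfl | h
    · rw [filter_eq_empty_iff.2, card_empty]
      · omega
      · rintro p hp ⟨hp', hn⟩
        have := nextPrime_le_of_prime hn hp'
        rw [mem_range] at hp
        omega
    · have hsub : {p ∈ range q | p.Prime ∧ n ≤ p} ⊆
          insert (nextPrime n) {p ∈ range q | p.Prime ∧ nextPrime n + 1 ≤ p} := by
        intro p hp
        rw [mem_filter] at hp
        rw [mem_insert, mem_filter]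
        have := nextPrime_le_of_prime hp.2.2 hp.2.1
        by_cases h' : p = nextPrime n
        · exact Or.inl h'
        · exact Or.inr ⟨hp.1, hp.2.1, by omega⟩
      have := (card_le_card hsub).trans (card_insert_le _ _)
      have := ih h
      omega

/-- The primes up to q are q itself, fewer than k in [n, q), and at most n below n. -/
theorem primeCounting_le_of_mem_primesFrom {n k q : ℕ} (h : q ∈ primesFrom n k) :
    Nat.primeCounting q ≤ n + k := by
  have h1 : Nat.primeCounting q ≤ #{p ∈ range q | p.Prime ∧ n ≤ p} + 1 + n := by
    rw [Nat.primeCounting, Nat.primeCounting', Nat.count_eq_card_filter_range]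
    have hsub : {p ∈ range (q + 1) | p.Prime} ⊆
        insert q ({p ∈ range q | p.Prime ∧ n ≤ p} ∪ range n) := by
      intro p hp
      simp only [mem_insert, mem_union, mem_filter, mem_range] at *
      rcases lt_or_ge p n with h' | h'
      · exact Or.inr (Or.inr h')
      · rcases eq_or_ne p q with h'' | h''
        · exact Or.inl h''
        · exact Or.inr (Or.inl ⟨by omega, hp.2, h'⟩)
    refine (card_le_card hsub).trans ((card_insert_le _ _).trans ?_)
    have := card_union_le {p ∈ range q | p.Prime ∧ n ≤ p} (range n)
    rw [card_range] at this
    omega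
  have := card_primes_lt_of_mem_primesFrom h
  omega

theorem mul_le_primeCounting_mul_log {q : ℕ} (hq : 2 ≤ q) :
    (1 / 10 : ℝ) * q ≤ Nat.primeCounting q * Real.log q := by
  have hq' : (2 : ℝ) ≤ q := by exact_mod_cast hq
  have h := Chebyshev.pi_ge q
  rw [div_le_iff₀ (Real.log_pos (by linarith))] at h
  refine le_trans ?_ h
  -- The tangent line of the logarithm at 4 is sharp enough to give the constant 1/10 already from q
  -- = 2.
  have h1 : Real.log ((q : ℝ) + 1) ≤ ((q : ℝ) + 1) / 4 - 1 + 2 * Real.log 2 := by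
    have h2 := Real.log_le_sub_one_of_pos (by positivity : (0 : ℝ) < ((q : ℝ) + 1) / 4)
    rw [Real.log_div (by positivity) (by norm_num), show (4 : ℝ) = 2 ^ 2 by norm_num,
      Real.log_pow] at h2
    push_cast at h2
    linarith
  have h2 := Real.log_two_gt_d9
  have h3 := Real.log_two_lt_d9
  nlinarith

/-- There are at most 3p/log p primes, and each is at most 420 p log p by Chebyshev's bound, so the
logarithms cancel in the product. -/
theorem sum_primesFrom_le {p k : ℕ} (hp : 2 ≤ p)
    (hk : (k : ℝ) ≤ 2 + 0.32 * p / Real.log p) :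
    ((primesFrom p k).sum : ℝ) ≤ 1260 * (p : ℝ) ^ 2 := by
  have hp' : (2 : ℝ) ≤ p := by exact_mod_cast hp
  have hl2 := Real.log_two_gt_d9
  have hlp : Real.log 2 ≤ Real.log p := Real.log_le_log two_pos hp'
  have hl0 : 0 < Real.log p := by linarith
  have hlple : Real.log p ≤ p := (Real.log_le_sub_one_of_pos (by linarith)).trans (by linarith)
  have hk1 : (k : ℝ) ≤ 2 * p := by
    have : 0.32 * (p : ℝ) / Real.log p ≤ p := by
      rw [div_le_iff₀ hl0]
      nlinarith
    linarith
  have hk2 : (k : ℝ) ≤ 3 * p / Real.log p := by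
    rw [le_div_iff₀ hl0]
    have := mul_le_mul_of_nonneg_right hk hl0.le
    rw [add_mul, div_mul_cancel₀ _ hl0.ne'] at this
    linarith
  have hmem : ∀ q ∈ primesFrom p k, q ≤ ⌊420 * (p : ℝ) * Real.log p⌋₊ := by
    intro q hq
    have hq2 : 2 ≤ q := hp.trans (prime_of_mem_primesFrom hq).2
    have hq2' : (2 : ℝ) ≤ q := by exact_mod_cast hq2
    have h1 := mul_le_primeCounting_mul_log hq2
    have h2 : (Nat.primeCounting q : ℝ) ≤ p + k := by
      exact_mod_cast primeCounting_le_of_mem_primesFrom hq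
    have hlq : 0 < Real.log q := Real.log_pos (by linarith)
    have h3 : (q : ℝ) ≤ 30 * p * Real.log q := by nlinarith
    -- The bound q ≤ 30 p log q is implicit. Passing to the square root gives the crude r ≤ 60p ≤
    -- p^7, hence log q ≤ 14 log p, and reinserting this gives 420 = 30 · 14.
    set r := √(q : ℝ) with hr
    have hr0 : 0 < r := Real.sqrt_pos.2 (by linarith)
    have hrq : (q : ℝ) = r ^ 2 := (Real.sq_sqrt (by linarith)).symm
    have hlr : Real.log q = 2 * Real.log r := by
      rw [hrq, Real.log_pow]
      norm_num
    have hlr' : Real.log r ≤ r := (Real.log_le_sub_one_of_pos hr0).trans (by linarith)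
    have h4 : r ≤ 60 * p := by
      have : r * r ≤ 60 * p * r := by
        rw [← pow_two, ← hrq]
        rw [hlr] at h3
        nlinarith
      exact le_of_mul_le_mul_right this hr0
    have h5 : Real.log r ≤ 7 * Real.log p := by
      have h6 : r ≤ (p : ℝ) ^ 7 := by
        have : (60 : ℝ) ≤ (p : ℝ) ^ 6 :=
          le_trans (by norm_num) (pow_le_pow_left₀ zero_le_two hp' 6)
        calc r ≤ 60 * p := h4
          _ ≤ (p : ℝ) ^ 6 * p := by gcongr
          _ = (p : ℝ) ^ 7 := by ring
      have := Real.log_le_log hr0 h6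
      rwa [Real.log_pow] at this
    refine Nat.le_floor (h3.trans ?_)
    rw [hlr]
    nlinarith
  have hsum := List.sum_le_card_nsmul _ _ hmem
  rw [length_primesFrom, smul_eq_mul] at hsum
  calc ((primesFrom p k).sum : ℝ) ≤ k * (⌊420 * (p : ℝ) * Real.log p⌋₊ : ℝ) := by exact_mod_cast hsum
    _ ≤ 3 * p / Real.log p * (420 * (p : ℝ) * Real.log p) := by
      gcongr
      exact Nat.floor_le (by positivity)
    _ = 1260 * (p : ℝ) ^ 2 := by
      field_simp
      norm_num

/-- The number of large primes that divide an integer. -/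
theorem length_filter_dvd_mul_log_le {L : List ℕ} (hnd : L.Nodup) {p X : ℕ} (hp : 1 ≤ p)
    (hL : ∀ q ∈ L, q.Prime ∧ p ≤ q) (hX : 0 < X) :
    ((L.filter fun q => q ∣ X).length : ℝ) * Real.log p ≤ Real.log X := by
  have hnd' : (L.filter fun q => q ∣ X).Nodup := hnd.filter _
  rw [← List.toFinset_card_of_nodup hnd']
  set F := (L.filter fun q => q ∣ X).toFinset with hF
  have hmem : ∀ q ∈ F, q ∈ L ∧ q ∣ X := by
    intro q hq
    simpa [hF] using hq
  -- The distinct prime divisors of X that are ≥ p have a product which is at least p^m and divides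
  -- X.
  have h1 : p ^ F.card ≤ ∏ q ∈ F, q := by
    rw [← prod_const]
    exact prod_le_prod' fun q hq => (hL q (hmem q hq).1).2
  have h2 : ∏ q ∈ F, q ≤ X := by
    refine Nat.le_of_dvd hX (dvd_trans (prod_dvd_prod_of_subset _ _ _ fun q hq => ?_)
      (Nat.prod_primeFactors_dvd X))
    exact Nat.mem_primeFactors.2 ⟨(hL q (hmem q hq).1).1, (hmem q hq).2, hX.ne'⟩
  rw [← Real.log_pow]
  exact Real.log_le_log (by positivity) (by exact_mod_cast h1.trans h2)

/-! ### The theoretical prime sequence. -/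

section Theoretical

variable {d : ℕ} (H : Finset (Fin d → ℤ)) (z : Fin d → ℤ) (R : ℕ) (t : ℝ)

theorem exists_theoreticalPrimes_eq {V : ℝ} (hV : V = ((H.sup (projInt z) : ℕ) : ℝ)) :
    ∃ p k : ℕ, p.Prime ∧ theoreticalPrimes H z R t = primesFrom p k ∧
      p = nextPrime ⌈2 * ((R : ℝ) - 1) * Real.log V / (0.32 * t)⌉₊ ∧
      k = max 1 ⌈2 * ((R : ℝ) - 1) * Real.log V / (t * Real.log p)⌉₊ := by
  subst hV
  exact ⟨_, _, prime_nextPrime _, rfl, rfl, rfl⟩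

variable {H z R t}

theorem theoreticalPrimes_prime {q : ℕ} (hq : q ∈ theoreticalPrimes H z R t) : q.Prime := by
  obtain ⟨p, k, -, h, -⟩ := exists_theoreticalPrimes_eq H z R t rfl
  rw [h] at hq
  exact (prime_of_mem_primesFrom hq).1

theorem theoreticalPrimes_length_pos : 0 < (theoreticalPrimes H z R t).length := by
  obtain ⟨p, k, -, h, -, hk⟩ := exists_theoreticalPrimes_eq H z R t rfl
  rw [h, length_primesFrom, hk]
  exact lt_max_of_lt_left one_pos

/-- Few primes of the theoretical sequence divide the projection integer of a difference. -/
theorem length_filter_theoreticalPrimes_le (ht0 : 0 < t) (hR : 2 ≤ R) {h : Fin d → ℤ}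
    (hH : h ∈ H) (hpos : 0 < projInt z h) :
    (((theoreticalPrimes H z R t).filter fun q => q ∣ projInt z h).length : ℝ) ≤
      t / ((R : ℝ) - 1) * (theoreticalPrimes H z R t).length := by
  obtain ⟨p, k, hp, hps, -, hk⟩ := exists_theoreticalPrimes_eq H z R t rfl
  rw [hps, length_primesFrom]
  have h1 := length_filter_dvd_mul_log_le (nodup_primesFrom p k) hp.one_le
    (fun q hq => prime_of_mem_primesFrom hq) hpos
  set m : ℝ := (((primesFrom p k).filter fun q => q ∣ projInt z h).length : ℝ) with hm
  have hR' : (0 : ℝ) < (R : ℝ) - 1 := by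
    have : (2 : ℝ) ≤ R := by exact_mod_cast hR
    linarith
  have hlp : 0 < Real.log p := Real.log_pos (by exact_mod_cast hp.one_lt)
  have hV : Real.log (projInt z h) ≤ Real.log ((H.sup (projInt z) : ℕ) : ℝ) :=
    Real.log_le_log (by exact_mod_cast hpos) (by exact_mod_cast Finset.le_sup (f := projInt z) hH)
  have hkx : 2 * ((R : ℝ) - 1) * Real.log ((H.sup (projInt z) : ℕ) : ℝ) / (t * Real.log p) ≤ k := by
    refine (Nat.le_ceil _).trans ?_
    rw [hk]
    exact_mod_cast le_max_right _ _
  rw [div_le_iff₀ (by positivity)] at hkx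
  rw [div_mul_eq_mul_div, le_div_iff₀ hR']
  -- At most log V/log p primes divide X_h, while k ≥ 2(R-1) log V/(t log p). The factor 2 in k is
  -- not needed here and is dropped using nonnegativity.
  have h2 : m * ((R : ℝ) - 1) * Real.log p ≤ t * k * Real.log p := by
    have h3 : m * Real.log p * ((R : ℝ) - 1) ≤
        Real.log ((H.sup (projInt z) : ℕ) : ℝ) * ((R : ℝ) - 1) :=
      mul_le_mul_of_nonneg_right (h1.trans hV) hR'.le
    have h4 : 0 ≤ m * Real.log p * ((R : ℝ) - 1) := by positivity
    nlinarith
  exact le_of_mul_le_mul_right h2 hlp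

/-- Bertrand's postulate bounds p_1 by twice its threshold. Since p_1 is above the threshold, the
length k is at most 2 + 0.32 p_1/log p_1, so the sum is quadratic in p_1. -/
theorem sum_theoreticalPrimes_le (ht0 : 0 < t) (hR : 2 ≤ R) :
    ((theoreticalPrimes H z R t).sum : ℝ) ≤
      1260 * (2 * (2 * ((R : ℝ) - 1) * Real.log ((H.sup (projInt z) : ℕ) : ℝ) /
        (0.32 * t) + 2)) ^ 2 := by
  obtain ⟨p, k, hp, hps, hpx, hk⟩ := exists_theoreticalPrimes_eq H z R t rfl
  rw [hps]
  have hR' : (0 : ℝ) < (R : ℝ) - 1 := by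
    have : (2 : ℝ) ≤ R := by exact_mod_cast hR
    linarith
  have hlV : 0 ≤ Real.log ((H.sup (projInt z) : ℕ) : ℝ) := Real.log_natCast_nonneg _
  have hlp : 0 < Real.log p := Real.log_pos (by exact_mod_cast hp.one_lt)
  set x := 2 * ((R : ℝ) - 1) * Real.log ((H.sup (projInt z) : ℕ) : ℝ) with hx
  have hx0 : 0 ≤ x := by positivity
  have hxp : x / (0.32 * t) ≤ p := by
    refine (Nat.le_ceil _).trans ?_
    rw [hpx]
    exact_mod_cast le_nextPrime _
  have hp2 : (p : ℝ) ≤ 2 * (x / (0.32 * t) + 2) := by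
    have h1 : (p : ℝ) ≤ 2 * ((⌈x / (0.32 * t)⌉₊ : ℝ) + 1) := by
      rw [hpx]
      exact_mod_cast nextPrime_le _
    have h2 := Nat.ceil_lt_add_one (by positivity : 0 ≤ x / (0.32 * t))
    linarith
  refine (sum_primesFrom_le hp.two_le ?_).trans (by gcongr)
  have h3 : x / (t * Real.log p) ≤ 0.32 * p / Real.log p := by
    rw [div_le_iff₀ (by positivity)] at hxp
    rw [div_le_div_iff₀ (by positivity) hlp]
    nlinarith
  have h4 := Nat.ceil_lt_add_one (by positivity : 0 ≤ x / (t * Real.log p))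
  have h5 : (0 : ℝ) ≤ 0.32 * p / Real.log p := by positivity
  rw [hk]
  push_cast
  exact max_le (by linarith) (by linarith)

end Theoretical

/-! ### Gram matrices and exponential sums over the shift sets. -/

section Gram

variable {d : ℕ}

/-- A shift set is stable on a set of frequencies if the smallest eigenvalue of `Bᴴ B` is at
least `1 - t`. -/
def StableOn (t : ℝ) (Γ : Finset (Fin d → ℤ)) (Y : List (UnitAddTorus (Fin d))) : Prop :=
  ∀ v : (Fin d → ℤ) → ℂ, (1 - t) * ∑ k ∈ Γ, ‖v k‖ ^ 2 ≤
    (Y.map fun y => ‖∑ k ∈ Γ, v k * UnitAddTorus.mFourier k y‖ ^ 2).sum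

theorem norm_sq_trigPoly (Γ : Finset (Fin d → ℤ)) (v : (Fin d → ℤ) → ℂ)
    (y : UnitAddTorus (Fin d)) :
    ((‖∑ k ∈ Γ, v k * UnitAddTorus.mFourier k y‖ ^ 2 : ℝ) : ℂ) =
      ∑ k ∈ Γ, ∑ k' ∈ Γ, (v k * starRingEnd ℂ (v k')) * UnitAddTorus.mFourier (k - k') y := by
  rw [Complex.ofReal_pow, ← Complex.mul_conj', map_sum, sum_mul_sum]
  refine sum_congr rfl fun k _ => sum_congr rfl fun k' _ => ?_
  rw [map_mul, sub_eq_add_neg, UnitAddTorus.mFourier_add, UnitAddTorus.mFourier_neg]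
  ring

/-- Gershgorin's argument for a functional that is almost orthogonal on the exponentials. -/
theorem le_re_functional (Φ : (UnitAddTorus (Fin d) → ℂ) →ₗ[ℂ] ℂ) (Γ : Finset (Fin d → ℤ))
    {w ε t : ℝ} (hw : 0 ≤ w) (hε : ε * ((Γ.card : ℝ) - 1) ≤ t)
    (hdiag : Φ (fun y => UnitAddTorus.mFourier (0 : Fin d → ℤ) y) = w)
    (hoff : ∀ k ∈ Γ, ∀ k' ∈ Γ, k ≠ k' →
      ‖Φ (fun y => UnitAddTorus.mFourier (k - k') y)‖ ≤ ε * w)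
    (v : (Fin d → ℤ) → ℂ) :
    w * (1 - t) * ∑ k ∈ Γ, ‖v k‖ ^ 2 ≤
      (Φ fun y => ((‖∑ k ∈ Γ, v k * UnitAddTorus.mFourier k y‖ ^ 2 : ℝ) : ℂ)).re := by
  classical
  have hΦ : (Φ fun y => ((‖∑ k ∈ Γ, v k * UnitAddTorus.mFourier k y‖ ^ 2 : ℝ) : ℂ)) =
      ∑ k ∈ Γ, ∑ k' ∈ Γ, (v k * starRingEnd ℂ (v k')) *
        Φ (fun y => UnitAddTorus.mFourier (k - k') y) := by
    have : (fun y => ((‖∑ k ∈ Γ, v k * UnitAddTorus.mFourier k y‖ ^ 2 : ℝ) : ℂ)) =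
        ∑ k ∈ Γ, ∑ k' ∈ Γ, (v k * starRingEnd ℂ (v k')) •
          (fun y => UnitAddTorus.mFourier (k - k') y) := by
      funext y
      rw [norm_sq_trigPoly]
      simp [Finset.sum_apply]
    rw [this, map_sum]
    refine sum_congr rfl fun k _ => ?_
    rw [map_sum]
    exact sum_congr rfl fun k' _ => by rw [map_smul, smul_eq_mul]
  rw [hΦ, Complex.re_sum]
  -- Off the diagonal this is |v_k v_k'| ≤ (|v_k|² + |v_k'|²)/2. The same negative terms are
  -- included for k = k', and the coefficient 1 + ε makes up for them.
  have hterm : ∀ k ∈ Γ, ∀ k' ∈ Γ,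
      -(ε * w / 2 * ‖v k‖ ^ 2) - ε * w / 2 * ‖v k'‖ ^ 2 +
        (if k = k' then (1 + ε) * w * ‖v k‖ ^ 2 else 0) ≤
      ((v k * starRingEnd ℂ (v k')) * Φ (fun y => UnitAddTorus.mFourier (k - k') y)).re := by
    intro k hk k' hk'
    split_ifs with h
    · subst h
      rw [sub_self, hdiag, Complex.mul_conj', ← Complex.ofReal_pow, ← Complex.ofReal_mul,
        Complex.ofReal_re]
      linarith
    · have h1 := (abs_le.1 (Complex.abs_re_le_norm ((v k * starRingEnd ℂ (v k')) *
        Φ (fun y => UnitAddTorus.mFourier (k - k') y)))).1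
      rw [norm_mul, norm_mul, RCLike.norm_conj] at h1
      have h2 := mul_le_mul_of_nonneg_left (hoff k hk k' hk' h)
        (by positivity : 0 ≤ ‖v k‖ * ‖v k'‖)
      have h3 : 0 ≤ ε * w := (norm_nonneg _).trans (hoff k hk k' hk' h)
      nlinarith [mul_nonneg h3 (sq_nonneg (‖v k‖ - ‖v k'‖))]
  have hsum : ∑ k ∈ Γ, ∑ k' ∈ Γ, (-(ε * w / 2 * ‖v k‖ ^ 2) - ε * w / 2 * ‖v k'‖ ^ 2 +
        (if k = k' then (1 + ε) * w * ‖v k‖ ^ 2 else 0)) =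
      w * (1 - ε * ((Γ.card : ℝ) - 1)) * ∑ k ∈ Γ, ‖v k‖ ^ 2 := by
    have : ∀ k ∈ Γ, ∑ k' ∈ Γ, (-(ε * w / 2 * ‖v k‖ ^ 2) - ε * w / 2 * ‖v k'‖ ^ 2 +
        (if k = k' then (1 + ε) * w * ‖v k‖ ^ 2 else 0)) =
        (-(Γ.card * (ε * w / 2)) + (1 + ε) * w) * ‖v k‖ ^ 2 -
          ε * w / 2 * ∑ k' ∈ Γ, ‖v k'‖ ^ 2 := by
      intro k hk
      rw [sum_add_distrib, sum_sub_distrib, sum_ite_eq, if_pos hk, sum_const, ← mul_sum,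
        nsmul_eq_mul]
      ring
    rw [sum_congr rfl this, sum_sub_distrib, ← mul_sum, sum_const, nsmul_eq_mul]
    ring
  refine le_trans ?_ (hsum.symm.le.trans (sum_le_sum fun k hk => ?_))
  · gcongr
  · rw [Complex.re_sum]
    exact sum_le_sum fun k' hk' => hterm k hk k' hk'

/-- Summation over a list of points as a linear functional. -/
def sumFunctional (Y : List (UnitAddTorus (Fin d))) : (UnitAddTorus (Fin d) → ℂ) →ₗ[ℂ] ℂ where
  toFun F := (Y.map F).sum
  map_add' _ _ := List.sum_map_add
  map_smul' c F := List.sum_map_mul_left Y F c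

theorem sumFunctional_apply (Y : List (UnitAddTorus (Fin d))) (F : UnitAddTorus (Fin d) → ℂ) :
    sumFunctional Y F = (Y.map F).sum := rfl

theorem re_sumFunctional (Y : List (UnitAddTorus (Fin d))) (F : UnitAddTorus (Fin d) → ℝ) :
    (sumFunctional Y fun y => (F y : ℂ)).re = (Y.map F).sum := by
  rw [sumFunctional_apply]
  induction Y with
  | nil => simp
  | cons y Y ih => simp [ih]

theorem sumFunctional_one (Y : List (UnitAddTorus (Fin d))) :
    sumFunctional Y (fun y => UnitAddTorus.mFourier (0 : Fin d → ℤ) y) = (Y.length : ℝ) := by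
  rw [sumFunctional_apply, UnitAddTorus.mFourier_zero]
  simp

/-- Gershgorin gives even the lower bound |Y|(1 - t), but the factor |Y| is discarded: stability
with 1 - t is what all strategies share, and the loss is a power of the logarithm. -/
theorem stableOn_of_norm_sum_le (Γ : Finset (Fin d → ℤ)) {Y : List (UnitAddTorus (Fin d))}
    {ε t : ℝ} (ht : t ≤ 1) (hY : 1 ≤ Y.length) (hε : ε * ((Γ.card : ℝ) - 1) ≤ t)
    (hoff : ∀ k ∈ Γ, ∀ k' ∈ Γ, k ≠ k' →
      ‖(Y.map fun y => UnitAddTorus.mFourier (k - k') y).sum‖ ≤ ε * Y.length) :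
    StableOn t Γ Y := by
  intro v
  have h := le_re_functional (sumFunctional Y) Γ (Nat.cast_nonneg _) hε (sumFunctional_one Y) hoff v
  rw [re_sumFunctional Y fun y => ‖∑ k ∈ Γ, v k * UnitAddTorus.mFourier k y‖ ^ 2] at h
  refine le_trans ?_ h
  have h1 : (1 : ℝ) ≤ Y.length := by exact_mod_cast hY
  rw [mul_assoc]
  exact le_mul_of_one_le_left (mul_nonneg (by linarith) (sum_nonneg fun _ _ => by positivity)) h1

/-- The lattice `{s z / p mod 1 : 0 ≤ s < p}`. -/
def singleLattice (z : Fin d → ℤ) (p : ℕ) : List (UnitAddTorus (Fin d)) :=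
  (List.range p).map fun s : ℕ => toTorus fun j => (s : ℝ) * (z j : ℝ) / p

theorem latticeShifts_eq (z : Fin d → ℤ) (ps : List ℕ) :
    latticeShifts z ps = ps.flatMap (singleLattice z) := by
  unfold latticeShifts
  congr 1
  funext p
  simp only [singleLattice, List.map_eq_flatMap, List.pure_def, List.bind_eq_flatMap,
    List.flatMap_assoc, List.flatMap_cons, List.flatMap_nil, List.append_nil]

theorem mFourier_toTorus (h : Fin d → ℤ) (x : Fin d → ℝ) :
    UnitAddTorus.mFourier h (toTorus x) =
      Complex.exp (2 * π * Complex.I * ((∑ j, (h j : ℝ) * x j : ℝ) : ℂ)) := by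
  simp only [UnitAddTorus.mFourier, ContinuousMap.coe_mk, toTorus, fourier_coe_apply]
  rw [← Complex.exp_sum]
  congr 1
  push_cast
  rw [mul_sum]
  refine sum_congr rfl fun j _ => ?_
  ring

/-- A geometric sum over p-th roots of unity; its ratio is 1 exactly when p divides h · z. -/
theorem sum_mFourier_singleLattice (z h : Fin d → ℤ) {p : ℕ} (hp : 1 ≤ p) :
    ((singleLattice z p).map fun y => UnitAddTorus.mFourier h y).sum =
      if p ∣ projInt z h then (p : ℂ) else 0 := by
  set a : ℤ := ∑ j, h j * z j with ha
  have hp0 : (p : ℂ) ≠ 0 := by exact_mod_cast (by omega : p ≠ 0)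
  set ω : ℂ := Complex.exp (2 * π * Complex.I * (a / p)) with hω
  have hterm : ∀ s : ℕ, UnitAddTorus.mFourier h (toTorus fun j => (s : ℝ) * (z j : ℝ) / p) =
      ω ^ s := by
    intro s
    rw [mFourier_toTorus, hω, ← Complex.exp_nat_mul]
    congr 1
    have : ((∑ j, (h j : ℝ) * ((s : ℝ) * (z j : ℝ) / p) : ℝ) : ℂ) = s * (a / p) := by
      rw [ha]
      push_cast
      rw [sum_div, mul_sum]
      exact sum_congr rfl fun j _ => by ring
    rw [this]
    ring
  have hsum : ((singleLattice z p).map fun y => UnitAddTorus.mFourier h y).sum =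
      ∑ s ∈ range p, ω ^ s := by
    rw [singleLattice, List.map_map]
    simp only [Function.comp_def, hterm]
    rfl
  have hdvd : p ∣ projInt z h ↔ (p : ℤ) ∣ a := by
    rw [projInt, Int.natCast_dvd]
  rw [hsum]
  have hωp : ω ^ p = 1 := by
    rw [hω, ← Complex.exp_nat_mul, Complex.exp_eq_one_iff]
    exact ⟨a, by field_simp⟩
  have hω1 : ω = 1 ↔ (p : ℤ) ∣ a := by
    rw [hω, Complex.exp_eq_one_iff]
    constructor
    · rintro ⟨n, hn⟩
      refine ⟨n, ?_⟩
      have h2 : (2 * π * Complex.I : ℂ) ≠ 0 := Complex.two_pi_I_ne_zero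
      rw [mul_comm] at hn
      have hn := mul_right_cancel₀ h2 hn
      rw [div_eq_iff hp0] at hn
      rw [mul_comm]
      exact_mod_cast hn
    · rintro ⟨n, hn⟩
      refine ⟨n, ?_⟩
      rw [hn]
      push_cast
      field_simp
  split_ifs with h1
  · rw [hω1.2 (hdvd.1 h1)]
    simp
  · have hne : ω ≠ 1 := fun h2 => h1 (hdvd.2 (hω1.1 h2))
    rw [geom_sum_eq hne, hωp, sub_self, zero_div]

theorem sum_map_latticeShifts {M : Type*} [AddCommMonoid M] (z : Fin d → ℤ) (ps : List ℕ)
    (F : UnitAddTorus (Fin d) → M) :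
    ((latticeShifts z ps).map F).sum = (ps.map fun p => ((singleLattice z p).map F).sum).sum := by
  rw [latticeShifts_eq, List.map_flatMap]
  induction ps with
  | nil => rfl
  | cons p ps ih => simp [List.flatMap_cons, ih]

theorem sum_mFourier_latticeShifts (z h : Fin d → ℤ) {ps : List ℕ} (hps : ∀ p ∈ ps, 1 ≤ p) :
    ((latticeShifts z ps).map fun y => UnitAddTorus.mFourier h y).sum =
      (((ps.filter fun p => p ∣ projInt z h).sum : ℕ) : ℂ) := by
  rw [sum_map_latticeShifts]
  induction ps with
  | nil => simp
  | cons p ps ih =>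
    rw [List.map_cons, List.sum_cons, ih fun q hq => hps q (List.mem_cons_of_mem _ hq),
      sum_mFourier_singleLattice z h (hps p List.mem_cons_self), List.filter_cons]
    split_ifs <;> simp_all

/-- The functional in which each of the lattices has total mass `1`. -/
def meanFunctional (z : Fin d → ℤ) (ps : List ℕ) : (UnitAddTorus (Fin d) → ℂ) →ₗ[ℂ] ℂ :=
  (ps.map fun p : ℕ => ((p : ℂ)⁻¹) • sumFunctional (singleLattice z p)).sum

theorem meanFunctional_mFourier (z h : Fin d → ℤ) {ps : List ℕ} (hps : ∀ p ∈ ps, 1 ≤ p) :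
    meanFunctional z ps (fun y => UnitAddTorus.mFourier h y) =
      (((ps.filter fun p => p ∣ projInt z h).length : ℝ) : ℂ) := by
  unfold meanFunctional
  induction ps with
  | nil => simp
  | cons p ps ih =>
    have hp := hps p List.mem_cons_self
    have hp0 : (p : ℂ) ≠ 0 := by exact_mod_cast (by omega : p ≠ 0)
    rw [List.map_cons, List.sum_cons, LinearMap.add_apply,
      ih fun q hq => hps q (List.mem_cons_of_mem _ hq), LinearMap.smul_apply, sumFunctional_apply,
      sum_mFourier_singleLattice z h hp, List.filter_cons]
    split_ifs with h1 h2 h2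
    · simp [hp0, add_comm]
    · simp_all
    · simp_all
    · simp

/-- The weights 1/p are at most 1 and the function is nonnegative, so a lower bound for the weighted
mean is a lower bound for the plain sum. -/
theorem re_meanFunctional_le (z : Fin d → ℤ) {ps : List ℕ} (hps : ∀ p ∈ ps, 1 ≤ p)
    {F : UnitAddTorus (Fin d) → ℝ} (hF : ∀ y, 0 ≤ F y) :
    (meanFunctional z ps fun y => (F y : ℂ)).re ≤ ((latticeShifts z ps).map F).sum := by
  rw [sum_map_latticeShifts, meanFunctional]
  induction ps with
  | nil => simp
  | cons p ps ih =>
    have hp : (1 : ℝ) ≤ p := by exact_mod_cast hps p List.mem_cons_self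
    rw [List.map_cons, List.sum_cons, List.map_cons, List.sum_cons, LinearMap.add_apply,
      LinearMap.smul_apply, Complex.add_re]
    refine add_le_add ?_ (ih fun q hq => hps q (List.mem_cons_of_mem _ hq))
    rw [smul_eq_mul, ← Complex.ofReal_natCast, ← Complex.ofReal_inv, Complex.re_ofReal_mul,
      re_sumFunctional]
    refine mul_le_of_le_one_left (List.sum_nonneg ?_) (inv_le_one_of_one_le₀ hp)
    intro x hx
    obtain ⟨y, -, rfl⟩ := List.mem_map.1 hx
    exact hF y

/-- With mass 1 on each lattice, what matters is the number of primes dividing X_h and not their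
sum. This suits the theoretical sequence, where only that number is controlled and the primes may
differ in size. -/
theorem stableOn_latticeShifts_of_length_le (Γ : Finset (Fin d → ℤ)) {z : Fin d → ℤ} {ps : List ℕ}
    {ε t : ℝ} (ht : t ≤ 1) (hps : ∀ p ∈ ps, 1 ≤ p) (hne : 1 ≤ ps.length)
    (hε : ε * ((Γ.card : ℝ) - 1) ≤ t)
    (hoff : ∀ k ∈ Γ, ∀ k' ∈ Γ, k ≠ k' →
      ((ps.filter fun p => p ∣ projInt z (k - k')).length : ℝ) ≤ ε * ps.length) :
    StableOn t Γ (latticeShifts z ps) := by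
  intro v
  have h := le_re_functional (meanFunctional z ps) Γ (Nat.cast_nonneg ps.length) hε
    (by rw [meanFunctional_mFourier z 0 hps]; simp [projInt])
    (fun k hk k' hk' hkk => by
      rw [meanFunctional_mFourier z _ hps, Complex.norm_real, Real.norm_of_nonneg (by positivity)]
      exact hoff k hk k' hk' hkk) v
  have h2 := re_meanFunctional_le z hps
    (F := fun y => ‖∑ k ∈ Γ, v k * UnitAddTorus.mFourier k y‖ ^ 2) fun y => by positivity
  refine le_trans ?_ (h.trans h2)
  have h1 : (1 : ℝ) ≤ ps.length := by exact_mod_cast hne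
  rw [mul_assoc]
  exact le_mul_of_one_le_left (mul_nonneg (by linarith) (sum_nonneg fun _ _ => by positivity)) h1

end Gram

/-! ### The adaptive search. -/

section Loop

variable {d : ℕ} {H : Finset (Fin d → ℤ)} {z : Fin d → ℤ} {R : ℕ} {t pmin : ℝ}

/-- A property shared by all shift sets that pass one of the tests is inherited by the output of
the search loop, which is not longer than its input. -/
theorem adaptiveLoop_induction (P : List (UnitAddTorus (Fin d)) → Prop)
    (hpoly : ∀ p, 1 ≤ p → PolyTest H R t p → P (polyShifts d p))
    (hsingle : ∀ p, 1 ≤ p → SingleTest H z pmin p → P (latticeShifts z [p]))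
    (hgreedy : ∀ ps, ps ≠ [] → (∀ p ∈ ps, 1 ≤ p) → GreedyTest H z R t ps → P (latticeShifts z ps))
    (p : ℕ) (Y : List (UnitAddTorus (Fin d))) (ps : List ℕ) (found : Bool) (hp : 1 ≤ p)
    (hps : ∀ q ∈ ps, 1 ≤ q) (hY : P Y) :
    P (adaptiveLoop H z R t pmin p Y ps found) ∧
      (adaptiveLoop H z R t pmin p Y ps found).length ≤ Y.length := by
  -- The current prime grows and the current shift set never does, so the gap decreases.
  induction hm : Y.length - p using Nat.strong_induction_on generalizing p Y ps found with
  | _ m ih =>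
    subst hm
    have hnext := le_nextPrime (p + 1)
    have hps' : ∀ q ∈ ps ++ [p], 1 ≤ q := by
      intro q hq
      rw [List.mem_append, List.mem_singleton] at hq
      rcases hq with hq | rfl
      exacts [hps q hq, hp]
    rw [adaptiveLoop]
    by_cases h1 : p < Y.length
    swap
    · rw [if_neg h1]
      exact ⟨hY, le_rfl⟩
    rw [if_pos h1]
    by_cases h2 : PolyTest H R t p
    · rw [if_pos h2]
      exact ⟨hpoly p hp h2, by rw [length_polyShifts]; exact h1.le⟩
    rw [if_neg h2]
    by_cases h3 : SingleTest H z pmin p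
    · rw [if_pos h3]
      exact ⟨hsingle p hp h3, by rw [length_latticeShifts]; simpa using h1.le⟩
    rw [if_neg h3]
    by_cases h4 : found = true
    · rw [if_pos h4]
      exact ih _ (by omega) _ Y ps true (by omega) hps hY rfl
    rw [if_neg h4]
    by_cases h5 : GreedyTest H z R t (ps ++ [p])
    · rw [if_pos h5]
      by_cases h6 : (latticeShifts z (ps ++ [p])).length < Y.length
      · simp only [if_pos h6]
        obtain ⟨h7, h8⟩ := ih _ (by omega) (nextPrime (p + 1)) (latticeShifts z (ps ++ [p]))
          (ps ++ [p]) true (by omega) hps' (hgreedy _ (by simp) hps' h5) rfl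
        exact ⟨h7, h8.trans h6.le⟩
      · simp only [if_neg h6]
        exact ih _ (by omega) _ Y _ true (by omega) hps' hY rfl
    · rw [if_neg h5]
      exact ih _ (by omega) _ Y _ false (by omega) hps' hY rfl

end Loop

theorem card_fiber_le_maxFiber {d : ℕ} {A : Finset (Fin d → ℤ)} {N : ℕ} {g : Fin d → ℕ}
    {l : Fin d → ℤ} (hl : l ∈ A) : (fiber A N g l).card ≤ maxFiber A N g :=
  Finset.le_sup (f := fun l => (fiber A N g l).card) hl

/-- All shift sets of the adaptive construction are stable, and they are not longer than the
theoretical ones. -/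
theorem adaptiveShifts_spec (d : ℕ) (α : ℝ) (γ : ℕ → ℝ) (N : ℕ) (g : Fin d → ℕ) (M : ℝ) {t : ℝ}
    (ht0 : 0 < t) (ht1 : t < 1) :
    1 ≤ (adaptiveShifts d α γ N g M t).length ∧
    (∀ l ∈ cross d α γ M,
      StableOn t (fiber (cross d α γ M) N g l) (adaptiveShifts d α γ N g M t)) ∧
    ((adaptiveShifts d α γ N g M t).length ≤ 1 ∨ 2 ≤ maxFiber (cross d α γ M) N g ∧
      (adaptiveShifts d α γ N g M t).length ≤
        (theoreticalPrimes (differences (cross d α γ M) N g)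
          (projection (differences (cross d α γ M) N g)) (maxFiber (cross d α γ M) N g) t).sum) := by
  set A := cross d α γ M with hA
  set H := differences A N g with hH
  set R := maxFiber A N g with hR
  set z := projection H with hz
  have hdef : adaptiveShifts d α γ N g M t = if R = 1 ∨ H = ∅ then [0]
    else adaptiveLoop H z R t ((⌊(γ 0 * M) ^ (1 / α)⌋ : ℝ) * (⌊(γ 1 * M) ^ (1 / α)⌋ : ℝ) / N)
      (nextPrime R) (latticeShifts z (theoreticalPrimes H z R t)) [] false := rfl
  rw [hdef]
  split_ifs with hcase
  · refine ⟨by simp, fun l hl => ?_, Or.inl (by simp)⟩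
    have hself := mem_fiber_self N g hl
    rcases hcase with h1 | h1
    · have hcard : (fiber A N g l).card ≤ 1 := h1 ▸ card_fiber_le_maxFiber hl
      refine stableOn_of_norm_sum_le (ε := 0) _ ht1.le (by simp) (by simpa using ht0.le) ?_
      intro k hk k' hk' hne
      exact absurd (card_le_one.1 hcard k hk k' hk') hne
    -- An element l of A would put 0 = l - l into the empty set of differences.
    · have := sub_mem_differences hself hself
      rw [← hH, h1] at this
      simp at this
  · rw [not_or] at hcase
    have hR2 : 2 ≤ R := by
      obtain ⟨h, hh⟩ := nonempty_iff_ne_empty.2 hcase.2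
      obtain ⟨l, hl, -⟩ := mem_differences.1 hh
      have h1 : 1 ≤ R := (card_pos.2 ⟨l, mem_fiber_self N g hl⟩).trans_le (card_fiber_le_maxFiber hl)
      omega
    have hR1 : (0 : ℝ) < (R : ℝ) - 1 := by
      have : (2 : ℝ) ≤ R := by exact_mod_cast hR2
      linarith
    have hε : ∀ l ∈ A, t / ((R : ℝ) - 1) * (((fiber A N g l).card : ℝ) - 1) ≤ t := by
      intro l hl
      have h1 : ((fiber A N g l).card : ℝ) ≤ R := by exact_mod_cast card_fiber_le_maxFiber hl
      rw [div_mul_eq_mul_div, div_le_iff₀ hR1]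
      gcongr
    have hdiff : ∀ l, ∀ k ∈ fiber A N g l, ∀ k' ∈ fiber A N g l, k ≠ k' → k - k' ∈ H ∧ k - k' ≠ 0 :=
      fun l k hk k' hk' hne => ⟨sub_mem_differences hk hk', sub_ne_zero.2 hne⟩
    have htheo : ∀ q ∈ theoreticalPrimes H z R t, 1 ≤ q := fun q hq =>
      (theoreticalPrimes_prime hq).one_le
    have hlen := theoreticalPrimes_length_pos (H := H) (z := z) (R := R) (t := t)
    obtain ⟨⟨h1, h2⟩, h3⟩ := adaptiveLoop_induction (H := H) (z := z) (R := R) (t := t)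
      (pmin := (⌊(γ 0 * M) ^ (1 / α)⌋ : ℝ) * (⌊(γ 1 * M) ^ (1 / α)⌋ : ℝ) / N)
      (fun Y => 1 ≤ Y.length ∧ ∀ l ∈ A, StableOn t (fiber A N g l) Y)
      (fun p hp htest => by
        have hl := length_polyShifts d p
        refine ⟨hl.symm ▸ hp, fun l hl' => ?_⟩
        refine stableOn_of_norm_sum_le _ ht1.le (hl.symm ▸ hp) (hε l hl') ?_
        intro k hk k' hk' hne
        obtain ⟨h4, h5⟩ := hdiff l k hk k' hk' hne
        rw [hl, div_mul_eq_mul_div]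
        exact htest _ h4 h5)
      (fun p hp htest => by
        have hl : (latticeShifts z [p]).length = p := by simp [length_latticeShifts]
        refine ⟨hl.symm ▸ hp, fun l hl' => ?_⟩
        refine stableOn_latticeShifts_of_length_le _ ht1.le (by simpa using hp) (by simp)
          (hε l hl') ?_
        intro k hk k' hk' hne
        obtain ⟨h4, h5⟩ := hdiff l k hk k' hk' hne
        have : ([p].filter fun q => q ∣ projInt z (k - k')) = [] := by
          simpa using htest.2 _ h4 h5
        rw [this, List.length_nil, Nat.cast_zero]
        positivity)
      (fun ps hne' hps htest => by
        have hsum : 1 ≤ ps.sum := by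
          obtain ⟨q, qs, rfl⟩ := List.exists_cons_of_ne_nil hne'
          have := hps q List.mem_cons_self
          rw [List.sum_cons]
          omega
        have hl := length_latticeShifts z ps
        refine ⟨hl.symm ▸ hsum, fun l hl' => ?_⟩
        refine stableOn_of_norm_sum_le _ ht1.le (hl.symm ▸ hsum) (hε l hl') ?_
        intro k hk k' hk' hne
        obtain ⟨h4, h5⟩ := hdiff l k hk k' hk' hne
        have h6 := htest _ h4 h5
        -- The tested quantity N_h is exactly the exponential sum over the union of lattices.
        rw [div_le_iff₀ (by exact_mod_cast hsum)] at h6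
        rw [hl, sum_mFourier_latticeShifts z _ hps, Complex.norm_natCast]
        convert h6)
      (nextPrime R) (latticeShifts z (theoreticalPrimes H z R t)) [] false
      (prime_nextPrime R).one_le (by simp)
      (by
        refine ⟨?_, fun l hl' => ?_⟩
        · rw [length_latticeShifts]
          obtain ⟨q, hq⟩ := List.exists_mem_of_length_pos hlen
          exact (htheo q hq).trans (List.le_sum_of_mem hq)
        · refine stableOn_latticeShifts_of_length_le _ ht1.le htheo hlen (hε l hl') ?_
          intro k hk k' hk' hne
          obtain ⟨h4, h5⟩ := hdiff l k hk k' hk' hne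
          exact length_filter_theoreticalPrimes_le ht0 hR2 h4 (projInt_projection_pos H h4 h5))
    rw [length_latticeShifts] at h3
    exact ⟨h1, h2, Or.inr ⟨hR2, h3⟩⟩

/-! ### Stability of least squares. -/

section LeastSquares

variable {m n : Type*} [Fintype m] [Fintype n]

theorem linearIndependent_col_of_le (B : Matrix m n ℂ) {κ : ℝ} (hκ : 0 < κ)
    (hB : ∀ v : n → ℂ, κ * ∑ i, ‖v i‖ ^ 2 ≤ ∑ s, ‖(B *ᵥ v) s‖ ^ 2) : LinearIndependent ℂ B.col := by
  rw [← Matrix.mulVec_injective_iff]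
  refine (injective_iff_map_eq_zero B.mulVecLin).2 fun v hv => ?_
  have h1 := hB v
  rw [Matrix.mulVecLin_apply] at hv
  simp only [hv, Pi.zero_apply, norm_zero, ne_eq, OfNat.ofNat_ne_zero, not_false_eq_true, zero_pow,
    sum_const_zero] at h1
  have h2 : ∑ i, ‖v i‖ ^ 2 = 0 := le_antisymm (nonpos_of_mul_nonpos_right h1 hκ)
    (sum_nonneg fun i _ => by positivity)
  funext i
  have h3 := (sum_eq_zero_iff_of_nonneg fun i _ => by positivity).1 h2 i (mem_univ i)
  simpa using h3

open scoped ComplexOrder in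
theorem isUnit_conjTranspose_mul_self [DecidableEq n] (B : Matrix m n ℂ) (hB : LinearIndependent ℂ B.col) :
    IsUnit (Bᴴ * B) := by
  rw [← Matrix.mulVec_injective_iff_isUnit]
  refine (injective_iff_map_eq_zero (Bᴴ * B).mulVecLin).2 fun v hv => ?_
  rw [Matrix.mulVecLin_apply, Matrix.conjTranspose_mul_self_mulVec_eq_zero] at hv
  refine Matrix.mulVec_injective_iff.2 hB ?_
  rw [hv, Matrix.mulVec_zero]

/-- The normal equations make Bδ the orthogonal projection of e onto the column space. -/
theorem sum_norm_sq_mulVec_le (B : Matrix m n ℂ) {δ : n → ℂ} {e : m → ℂ}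
    (h : (Bᴴ * B) *ᵥ δ = Bᴴ *ᵥ e) : ∑ s, ‖(B *ᵥ δ) s‖ ^ 2 ≤ ∑ s, ‖e s‖ ^ 2 := by
  have h1 : star (B *ᵥ δ) ⬝ᵥ (B *ᵥ δ) = star (B *ᵥ δ) ⬝ᵥ e := by
    rw [Matrix.star_mulVec, ← Matrix.dotProduct_mulVec, ← Matrix.dotProduct_mulVec,
      Matrix.mulVec_mulVec, h]
  have h2 := congrArg Complex.re h1
  simp only [dotProduct, Complex.re_sum] at h2
  have h3 : ∀ s, (star (B *ᵥ δ) s * (B *ᵥ δ) s).re = ‖(B *ᵥ δ) s‖ ^ 2 := by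
    intro s
    rw [Pi.star_apply, RCLike.star_def, Complex.conj_mul', ← Complex.ofReal_pow, Complex.ofReal_re]
  have h4 : ∀ s, (star (B *ᵥ δ) s * e s).re ≤ (‖(B *ᵥ δ) s‖ ^ 2 + ‖e s‖ ^ 2) / 2 := by
    intro s
    refine (Complex.re_le_norm _).trans ?_
    rw [norm_mul, Pi.star_apply, norm_star]
    nlinarith [sq_nonneg (‖(B *ᵥ δ) s‖ - ‖e s‖)]
  simp only [h3] at h2
  have h5 := h2.trans_le (sum_le_sum fun s _ => h4 s)
  rw [← sum_div, sum_add_distrib] at h5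
  linarith

/-- Stability of the least squares solution. -/
theorem norm_leastSquares_sub_le [DecidableEq n] (B : Matrix m n ℂ) {κ : ℝ} (hκ : 0 < κ)
    (hB : ∀ v : n → ℂ, κ * ∑ i, ‖v i‖ ^ 2 ≤ ∑ s, ‖(B *ᵥ v) s‖ ^ 2) {c : n → ℂ} {b : m → ℂ} {E : ℝ}
    (hE : ∀ s, ‖b s - (B *ᵥ c) s‖ ≤ E) (i : n) :
    ‖c i - ((Bᴴ * B)⁻¹ *ᵥ (Bᴴ *ᵥ b)) i‖ ≤ √(Fintype.card m / κ) * E := by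
  have hunit := (Matrix.isUnit_iff_isUnit_det _).1
    (isUnit_conjTranspose_mul_self B (linearIndependent_col_of_le B hκ hB))
  set δ := (Bᴴ * B)⁻¹ *ᵥ (Bᴴ *ᵥ b) - c with hδ
  set e := b - B *ᵥ c with he
  have heq : (Bᴴ * B) *ᵥ δ = Bᴴ *ᵥ e := by
    rw [hδ, he, Matrix.mulVec_sub, Matrix.mulVec_sub, Matrix.mulVec_mulVec,
      Matrix.mul_nonsing_inv _ hunit, Matrix.one_mulVec, Matrix.mulVec_mulVec]
  have h1 := (hB δ).trans (sum_norm_sq_mulVec_le B heq)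
  -- Without rows nothing forces E ≥ 0, but then the stability bound itself forces δ = 0.
  rcases isEmpty_or_nonempty m with hm | hm
  · simp only [univ_eq_empty, sum_empty] at h1
    have h2 : ∑ i, ‖δ i‖ ^ 2 ≤ 0 := nonpos_of_mul_nonpos_right h1 hκ
    have h3 := (single_le_sum (f := fun i => ‖δ i‖ ^ 2) (fun i _ => by positivity) (mem_univ i)).trans h2
    have h4 : ‖δ i‖ = 0 := by nlinarith [norm_nonneg (δ i)]
    rw [norm_sub_rev]
    simpa [hδ] using h4.le
  have hE0 : 0 ≤ E := (norm_nonneg _).trans (hE (Classical.arbitrary m))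
  have h2 : ∑ s, ‖e s‖ ^ 2 ≤ Fintype.card m * E ^ 2 := by
    calc ∑ s, ‖e s‖ ^ 2 ≤ ∑ _s : m, E ^ 2 :=
          sum_le_sum fun s _ => pow_le_pow_left₀ (norm_nonneg _) (hE s) 2
      _ = _ := by simp
  have h3 : ‖δ i‖ ^ 2 ≤ ∑ i, ‖δ i‖ ^ 2 :=
    single_le_sum (f := fun i => ‖δ i‖ ^ 2) (fun i _ => by positivity) (mem_univ i)
  have h4 : ‖δ i‖ ^ 2 ≤ Fintype.card m / κ * E ^ 2 := by
    rw [div_mul_eq_mul_div, le_div_iff₀' hκ]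
    exact (mul_le_mul_of_nonneg_left h3 hκ.le).trans (h1.trans h2)
  have h5 : ‖δ i‖ ≤ √(Fintype.card m / κ * E ^ 2) := Real.le_sqrt_of_sq_le h4
  rw [Real.sqrt_mul (by positivity), Real.sqrt_sq hE0] at h5
  rw [norm_sub_rev]
  exact h5

end LeastSquares

/-! ### Fourier series, aliasing and truncation. -/

section Aliasing

variable {d : ℕ}

theorem systemMatrix_mulVec (Γ : Finset (Fin d → ℤ)) (Y : List (UnitAddTorus (Fin d)))
    (v : (Fin d → ℤ) → ℂ) (s : Fin Y.length) :
    (systemMatrix Γ Y *ᵥ fun m => v m.1) s =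
      ∑ k ∈ Γ, v k * UnitAddTorus.mFourier k (Y.get s) := by
  rw [← sum_coe_sort Γ]
  exact sum_congr rfl fun k _ => mul_comm _ _

theorem StableOn.le_systemMatrix {t : ℝ} {Γ : Finset (Fin d → ℤ)}
    {Y : List (UnitAddTorus (Fin d))} (h : StableOn t Γ Y) (v : ↥Γ → ℂ) :
    (1 - t) * ∑ i, ‖v i‖ ^ 2 ≤ ∑ s, ‖(systemMatrix Γ Y *ᵥ v) s‖ ^ 2 := by
  classical
  set v' : (Fin d → ℤ) → ℂ := fun k => if hk : k ∈ Γ then v ⟨k, hk⟩ else 0 with hv'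
  have hv : v = fun m => v' m.1 := by
    funext m
    simp [hv']
  have h1 := h v'
  rw [← sum_coe_sort Γ, ← Fin.sum_univ_fun_getElem] at h1
  rw [hv]
  refine h1.trans (le_of_eq (sum_congr rfl fun s _ => ?_))
  rw [systemMatrix_mulVec]
  rfl

theorem mFourier_add_apply (k : Fin d → ℤ) (x y : UnitAddTorus (Fin d)) :
    UnitAddTorus.mFourier k (x + y) = UnitAddTorus.mFourier k x * UnitAddTorus.mFourier k y := by
  simp only [UnitAddTorus.mFourier, ContinuousMap.coe_mk, ← prod_mul_distrib]
  refine prod_congr rfl fun j _ => ?_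
  rw [Pi.add_apply, fourier_apply, fourier_apply, fourier_apply, smul_add, AddCircle.toCircle_add,
    Circle.coe_mul]

theorem norm_mFourier_apply (k : Fin d → ℤ) (x : UnitAddTorus (Fin d)) :
    ‖UnitAddTorus.mFourier k x‖ = 1 := by
  simp only [UnitAddTorus.mFourier, ContinuousMap.coe_mk, norm_prod, fourier_apply,
    Circle.norm_coe, prod_const_one]

open Classical in
theorem sum_mFourier_latticePoint {N : ℕ} (hN : 1 ≤ N) (g : Fin d → ℕ) (h : Fin d → ℤ) :
    ∑ n ∈ range N, UnitAddTorus.mFourier h (latticePoint N g n) =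
      if h ∈ dualLattice N g then (N : ℂ) else 0 := by
  have h1 := sum_mFourier_singleLattice (fun j => (g j : ℤ)) h hN
  have h2 : N ∣ projInt (fun j => (g j : ℤ)) h ↔ h ∈ dualLattice N g := by
    rw [projInt, ← Int.natCast_dvd]
    rfl
  simp only [h2] at h1
  rw [← h1, singleLattice, List.map_map]
  simp only [Int.cast_natCast]
  rfl

variable {α : ℝ} {γ : ℕ → ℝ}

/-- With a = |f̂(k)|, a = (ar)(1/r) is at most (ar)² + r^{-2}, and both terms are summable as 2α >
1. -/
theorem InUnitBall.summable (hα : 1 / 2 < α) (hγ : ∀ j, 0 < γ j)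
    {f : C(UnitAddTorus (Fin d), ℂ)} (hf : InUnitBall α γ f) :
    Summable fun k => ‖UnitAddTorus.mFourierCoeff f k‖ := by
  refine Summable.of_nonneg_of_le (fun k => norm_nonneg _) (fun k => ?_)
    (hf.1.add (summable_weight_rpow d hγ zero_le_two (by linarith : 1 < α * 2)))
  rw [← one_div_weight_sq]
  have hw := weight_pos α γ k
  have h1 : ‖UnitAddTorus.mFourierCoeff f k‖ =
      (‖UnitAddTorus.mFourierCoeff f k‖ * weight α γ k) * (1 / weight α γ k) := by
    field_simp
  have h2 : 1 / weight α γ k ^ 2 = (1 / weight α γ k) ^ 2 := by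
    rw [one_div_pow]
  rw [h2, ← mul_pow]
  nlinarith [sq_nonneg (‖UnitAddTorus.mFourierCoeff f k‖ * weight α γ k - 1 / weight α γ k),
    norm_nonneg (UnitAddTorus.mFourierCoeff f k), h1,
    sq_nonneg (‖UnitAddTorus.mFourierCoeff f k‖ * weight α γ k),
    sq_nonneg (1 / weight α γ k)]

theorem hasSum_fourier (f : C(UnitAddTorus (Fin d), ℂ))
    (hf : Summable fun k => ‖UnitAddTorus.mFourierCoeff f k‖) (x : UnitAddTorus (Fin d)) :
    HasSum (fun k => UnitAddTorus.mFourierCoeff f k * UnitAddTorus.mFourier k x) (f x) :=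
  UnitAddTorus.hasSum_mFourier_series_apply_of_summable hf.of_norm x

-- Averaging over the lattice points annihilates every frequency not congruent to l.
open Classical in
theorem hasSum_observation {N : ℕ} (hN : 1 ≤ N) (g : Fin d → ℕ) (f : C(UnitAddTorus (Fin d), ℂ))
    (hf : Summable fun k => ‖UnitAddTorus.mFourierCoeff f k‖) (l : Fin d → ℤ)
    (y : UnitAddTorus (Fin d)) :
    HasSum (fun k => if k - l ∈ dualLattice N g then
      UnitAddTorus.mFourierCoeff f k * UnitAddTorus.mFourier k y else 0)
      (observation N g f l y) := by
  have h1 := (hasSum_sum (s := range N) fun n _ =>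
    (hasSum_fourier f hf (latticePoint N g n + y)).mul_right
      (UnitAddTorus.mFourier (-l) (latticePoint N g n))).mul_left (1 / (N : ℂ))
  convert! h1 using 2 with k
  have hterm : ∀ n, UnitAddTorus.mFourierCoeff f k *
      UnitAddTorus.mFourier k (latticePoint N g n + y) *
      UnitAddTorus.mFourier (-l) (latticePoint N g n) =
      UnitAddTorus.mFourierCoeff f k * UnitAddTorus.mFourier k y *
        UnitAddTorus.mFourier (k - l) (latticePoint N g n) := by
    intro n
    rw [mFourier_add_apply, sub_eq_add_neg, UnitAddTorus.mFourier_add]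
    ring
  have hN0 : (N : ℂ) ≠ 0 := by exact_mod_cast (by omega : N ≠ 0)
  simp_rw [hterm]
  rw [← mul_sum, sum_mFourier_latticePoint hN]
  split_ifs
  · field_simp
  · simp

open Classical in
/-- The part of the Fourier series outside of `A` that is aliased to `l`. -/
def aliasSum (A : Finset (Fin d → ℤ)) (N : ℕ) (g : Fin d → ℕ) (a : (Fin d → ℤ) → ℝ)
    (l : Fin d → ℤ) : ℝ :=
  ∑' k, if k - l ∈ dualLattice N g ∧ k ∉ A then a k else 0

open Classical in
/-- The part of a series outside of `A`. -/
def outerSum (A : Finset (Fin d → ℤ)) (a : (Fin d → ℤ) → ℝ) : ℝ :=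
  ∑' k, if k ∉ A then a k else 0

theorem norm_observation_sub_le {N : ℕ} (hN : 1 ≤ N) (A : Finset (Fin d → ℤ)) (g : Fin d → ℕ)
    (f : C(UnitAddTorus (Fin d), ℂ)) (hf : Summable fun k => ‖UnitAddTorus.mFourierCoeff f k‖)
    (l : Fin d → ℤ) (y : UnitAddTorus (Fin d)) :
    ‖observation N g f l y -
      ∑ k ∈ fiber A N g l, UnitAddTorus.mFourierCoeff f k * UnitAddTorus.mFourier k y‖ ≤
    aliasSum A N g (fun k => ‖UnitAddTorus.mFourierCoeff f k‖) l := by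
  classical
  have h1 := hasSum_observation hN g f hf l y
  have h2 : HasSum (fun k => if k ∈ fiber A N g l then
      UnitAddTorus.mFourierCoeff f k * UnitAddTorus.mFourier k y else 0)
      (∑ k ∈ fiber A N g l, UnitAddTorus.mFourierCoeff f k * UnitAddTorus.mFourier k y) := by
    rw [← sum_congr rfl fun k hk => if_pos hk]
    exact hasSum_sum_of_ne_finset_zero fun k hk => if_neg hk
  have h3 := h1.sub h2
  rw [← h3.tsum_eq]
  refine tsum_of_norm_bounded (Summable.hasSum ?_) fun k => ?_
  · refine Summable.of_nonneg_of_le (fun k => ?_) (fun k => ?_) hf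
    · split_ifs <;> positivity
    · split_ifs
      exacts [le_rfl, norm_nonneg _]
  · by_cases h4 : k - l ∈ dualLattice N g <;> by_cases h5 : k ∈ A <;>
      simp [mem_fiber, h4, h5, norm_mFourier_apply]

theorem card_filter_sub_mem_le (A : Finset (Fin d → ℤ)) (N : ℕ) (g : Fin d → ℕ) (k : Fin d → ℤ)
    [DecidablePred fun l => k - l ∈ dualLattice N g] :
    #{l ∈ A | k - l ∈ dualLattice N g} ≤ maxFiber A N g := by
  rcases ({l ∈ A | k - l ∈ dualLattice N g}).eq_empty_or_nonempty with h | ⟨l₀, hl₀⟩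
  · simp [h]
  · rw [mem_filter] at hl₀
    refine (card_le_card fun l hl => ?_).trans (card_fiber_le_maxFiber hl₀.1)
    rw [mem_filter] at hl
    refine mem_fiber.2 ⟨hl.1, ?_⟩
    have := sub_mem_dualLattice hl₀.2 hl.2
    rwa [sub_sub_sub_cancel_left] at this

/-- After exchanging the sums, each k outside A is counted once for every element of A congruent to
it, and those elements lie in a single fiber. -/
theorem sum_aliasSum_le (A : Finset (Fin d → ℤ)) (N : ℕ) (g : Fin d → ℕ) {a : (Fin d → ℤ) → ℝ}
    (ha : ∀ k, 0 ≤ a k) (hs : Summable a) :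
    ∑ l ∈ A, aliasSum A N g a l ≤ maxFiber A N g * outerSum A a := by
  classical
  have hs1 : ∀ F : (Fin d → ℤ) → ℝ, (∀ k, F k = 0 ∨ F k = a k) → Summable F := by
    intro F hF
    refine Summable.of_nonneg_of_le (fun k => ?_) (fun k => ?_) hs
    · rcases hF k with h | h <;> rw [h]
      exact ha k
    · rcases hF k with h | h <;> rw [h]
      exact ha k
  have h1 : ∀ l, HasSum (fun k => if k - l ∈ dualLattice N g ∧ k ∉ A then a k else 0)
      (aliasSum A N g a l) := fun l => (hs1 _ fun k => (ite_eq_or_eq _ _ _).symm).hasSum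
  have h2 : HasSum (fun k => if k ∉ A then a k else 0) (outerSum A a) :=
    (hs1 _ fun k => (ite_eq_or_eq _ _ _).symm).hasSum
  refine hasSum_le (fun k => ?_) (hasSum_sum fun l _ => h1 l) (h2.mul_left (maxFiber A N g : ℝ))
  by_cases hk : k ∈ A
  · simp [hk]
  · simp only [hk, not_false_eq_true, and_true, if_true]
    rw [← sum_filter, sum_const, nsmul_eq_mul]
    exact mul_le_mul_of_nonneg_right (by exact_mod_cast card_filter_sub_mem_le A N g k) (ha k)

/-- Error bound in terms of the Fourier coefficients outside of `A`. -/
theorem norm_sub_approx_le {N : ℕ} (hN : 1 ≤ N) (A : Finset (Fin d → ℤ)) (g : Fin d → ℕ)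
    (Y : List (UnitAddTorus (Fin d))) {t : ℝ} (ht : t < 1)
    (hstable : ∀ l ∈ A, StableOn t (fiber A N g l) Y) (f : C(UnitAddTorus (Fin d), ℂ))
    (hf : Summable fun k => ‖UnitAddTorus.mFourierCoeff f k‖) (x : UnitAddTorus (Fin d)) :
    ‖f x - approx A N g Y f x‖ ≤ (1 + √(Y.length / (1 - t)) * maxFiber A N g) *
      outerSum A (fun k => ‖UnitAddTorus.mFourierCoeff f k‖) := by
  classical
  have hcoeff : ∀ k : ↥A, ‖UnitAddTorus.mFourierCoeff f k.1 -
      fiberCoeff A N g Y f k.1 ⟨k.1, mem_fiber_self N g k.2⟩‖ ≤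
      √(Y.length / (1 - t)) * aliasSum A N g (fun k => ‖UnitAddTorus.mFourierCoeff f k‖) k.1 := by
    intro k
    have h := norm_leastSquares_sub_le (systemMatrix (fiber A N g k.1) Y) (sub_pos.2 ht)
      (hstable k.1 k.2).le_systemMatrix (c := fun m => UnitAddTorus.mFourierCoeff f m.1)
      (b := fun s => observation N g f k.1 (Y.get s))
      (fun s => by
        rw [systemMatrix_mulVec]
        exact norm_observation_sub_le hN A g f hf k.1 (Y.get s))
      ⟨k.1, mem_fiber_self N g k.2⟩
    rw [Fintype.card_fin] at h
    exact h
  have hout : ‖f x - ∑ k ∈ A, UnitAddTorus.mFourierCoeff f k * UnitAddTorus.mFourier k x‖ ≤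
      outerSum A (fun k => ‖UnitAddTorus.mFourierCoeff f k‖) := by
    have h2 : HasSum (fun k => if k ∈ A then
        UnitAddTorus.mFourierCoeff f k * UnitAddTorus.mFourier k x else 0)
        (∑ k ∈ A, UnitAddTorus.mFourierCoeff f k * UnitAddTorus.mFourier k x) := by
      rw [← sum_congr rfl fun k hk => if_pos hk]
      exact hasSum_sum_of_ne_finset_zero fun k hk => if_neg hk
    rw [← ((hasSum_fourier f hf x).sub h2).tsum_eq]
    refine tsum_of_norm_bounded (Summable.hasSum ?_) fun k => ?_
    · refine Summable.of_nonneg_of_le (fun k => ?_) (fun k => ?_) hf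
      · split_ifs <;> positivity
      · split_ifs
        exacts [norm_nonneg _, le_rfl]
    · by_cases h5 : k ∈ A <;> simp [h5, norm_mFourier_apply]
  have hin : ‖∑ k ∈ A, UnitAddTorus.mFourierCoeff f k * UnitAddTorus.mFourier k x -
      approx A N g Y f x‖ ≤ √(Y.length / (1 - t)) * (maxFiber A N g *
        outerSum A (fun k => ‖UnitAddTorus.mFourierCoeff f k‖)) := by
    refine le_trans ?_ (mul_le_mul_of_nonneg_left (sum_aliasSum_le A N g
      (a := fun k => ‖UnitAddTorus.mFourierCoeff f k‖) (fun k => norm_nonneg _) hf)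
      (Real.sqrt_nonneg _))
    rw [approx, ← sum_coe_sort A, ← sum_sub_distrib, mul_sum, ← sum_coe_sort A]
    refine norm_sum_le_of_le _ fun k _ => ?_
    rw [← sub_mul, norm_mul, norm_mFourier_apply, mul_one]
    exact hcoeff k
  have := norm_sub_le_norm_sub_add_norm_sub (f x)
    (∑ k ∈ A, UnitAddTorus.mFourierCoeff f k * UnitAddTorus.mFourier k x) (approx A N g Y f x)
  linarith

/-- Decay of the Fourier coefficients outside of a hyperbolic cross. -/
theorem outerSum_le (hα : 1 / 2 < α) (hγ : ∀ j, 0 < γ j) {q M : ℝ}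
    (hq : q ∈ Set.Ioc (1 / α) 2) (hM : 0 < M) {f : C(UnitAddTorus (Fin d), ℂ)}
    (hf : InUnitBall α γ f) :
    outerSum (cross d α γ M) (fun k => ‖UnitAddTorus.mFourierCoeff f k‖) ≤
      √(M ^ (q - 2) * zetaProd d α γ q) := by
  classical
  have hα0 : 0 < α := by linarith
  have hq1 := one_lt_mul_of_mem_Ioc hα0 hq
  have hq0 := pos_of_mem_Ioc hα0 hq
  have hZ := one_le_zetaProd d hγ hq1
  set D := M ^ (q - 2) * zetaProd d α γ q with hD
  have hD0 : 0 < D := mul_pos (Real.rpow_pos_of_pos hM _) (by linarith)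
  -- Cauchy-Schwarz in additive form: a ≤ (√D/2) a²r² + r^{-2}/(2√D), where r^{-2} ≤ M^{q-2} r^{-q}
  -- because r ≥ M outside the cross. The choice of D balances the two halves.
  set b : (Fin d → ℤ) → ℝ := fun k => √D / 2 *
    (‖UnitAddTorus.mFourierCoeff f k‖ ^ 2 * weight α γ k ^ 2) +
    1 / (2 * √D) * (M ^ (q - 2) * weight α γ k ^ (-q)) with hb
  have hsq : 0 < √D := Real.sqrt_pos.2 hD0
  have hs2 : Summable fun k : Fin d → ℤ => weight α γ k ^ (-q) := summable_weight_rpow d hγ hq0.le hq1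
  have hbs : Summable b := (hf.1.mul_left _).add ((hs2.mul_left _).mul_left _)
  have hbsum : ∑' k, b k ≤ √D := by
    rw [hb, (hf.1.mul_left _).tsum_add ((hs2.mul_left _).mul_left _), tsum_mul_left, tsum_mul_left,
      tsum_mul_left]
    have h1 := tsum_real_weight_rpow_le d hγ hq0.le hq1
    have h2 : M ^ (q - 2) * ∑' k : Fin d → ℤ, weight α γ k ^ (-q) ≤ D :=
      mul_le_mul_of_nonneg_left h1 (Real.rpow_pos_of_pos hM _).le
    calc _ ≤ √D / 2 * 1 + 1 / (2 * √D) * D := by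
          gcongr
          exact hf.2
      _ = √D := by
          nth_rewrite 3 [← Real.mul_self_sqrt hD0.le]
          field_simp
          ring
  refine le_trans ?_ hbsum
  have hle : ∀ k, (if k ∉ cross d α γ M then ‖UnitAddTorus.mFourierCoeff f k‖ else 0) ≤ b k := by
    intro k
    have hw := weight_pos α γ k
    by_cases hk : k ∈ cross d α γ M
    · rw [if_neg (not_not.2 hk)]
      have := Real.rpow_pos_of_pos hM (q - 2)
      have := Real.rpow_pos_of_pos hw (-q)
      simp only [hb]
      positivity
    · rw [if_pos hk]
      rw [mem_cross hα0 hγ, not_lt] at hk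
      have h1 : weight α γ k ^ (-2 : ℝ) ≤ M ^ (q - 2) * weight α γ k ^ (-q) := by
        have h2 : weight α γ k ^ (-2 : ℝ) = weight α γ k ^ (q - 2) * weight α γ k ^ (-q) := by
          rw [← Real.rpow_add hw]
          congr 1
          ring
        rw [h2]
        exact mul_le_mul_of_nonneg_right
          (Real.rpow_le_rpow_of_nonpos hM hk (by linarith [hq.2])) (Real.rpow_nonneg hw.le _)
      rw [← one_div_weight_sq] at h1
      have h3 : ‖UnitAddTorus.mFourierCoeff f k‖ ≤ √D / 2 *
          (‖UnitAddTorus.mFourierCoeff f k‖ ^ 2 * weight α γ k ^ 2) +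
          1 / (2 * √D) * (1 / weight α γ k ^ 2) := by
        have h4 : √D / 2 * (‖UnitAddTorus.mFourierCoeff f k‖ ^ 2 * weight α γ k ^ 2) +
            1 / (2 * √D) * (1 / weight α γ k ^ 2) - ‖UnitAddTorus.mFourierCoeff f k‖ =
            (√D * ‖UnitAddTorus.mFourierCoeff f k‖ * weight α γ k ^ 2 - 1) ^ 2 /
              (2 * √D * weight α γ k ^ 2) := by
          field_simp
          ring
        have h5 : 0 ≤ (√D * ‖UnitAddTorus.mFourierCoeff f k‖ * weight α γ k ^ 2 - 1) ^ 2 /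
              (2 * √D * weight α γ k ^ 2) := by positivity
        linarith
      exact h3.trans (by simp only [hb]; gcongr)
  refine Summable.tsum_le_tsum hle (Summable.of_nonneg_of_le (fun k => ?_) hle hbs) hbs
  split_ifs <;> positivity

end Aliasing

/-! ### Polylogarithmic bounds and the error rate. -/

/-- The number of shifts and the fiber lengths are at most polylogarithmic. -/
theorem exists_length_adaptiveShifts_le (d : ℕ) (hd : 1 ≤ d) {α : ℝ} (hα : 1 / 2 < α) {γ : ℕ → ℝ}
    (hγ : ∀ j, 0 < γ j) {t : ℝ} (ht0 : 0 < t) (ht1 : t < 1) :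
    ∃ C : ℝ, 0 < C ∧ ∀ N : ℕ, N.Prime → ∀ β : ℝ, (β = α ∨ (1 ≤ α ∧ β = ⌊α⌋)) →
      ∀ g : Fin d → ℕ, IsCBC β (fun j => γ j ^ (β / α)) N g →
      (maxFiber (cross d α γ (truncation d α γ N)) N g : ℝ) ≤ C * Real.log N ^ (d - 1) ∧
      ((adaptiveShifts d α γ N g (truncation d α γ N) t).length : ℝ) ≤
        C * Real.log N ^ (2 * d) := by
  have hα0 : 0 < α := by linarith
  obtain ⟨c, hc, hdual⟩ := exists_mul_truncation_le_weight d hα hγ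
  obtain ⟨C₁, hC₁, hR⟩ := exists_maxFiber_le d hd hα0 hγ hc
  obtain ⟨C₂, hC₂, hV⟩ := exists_log_sup_projInt_le d hα0 hγ
  have hl2 : 0 < Real.log 2 := Real.log_pos one_lt_two
  set K : ℝ := 1260 * (2 * (2 * C₁ * C₂ / (0.32 * t) + 2 / Real.log 2 ^ d)) ^ 2 with hK
  refine ⟨C₁ + K + 1 / Real.log 2 ^ (2 * d), by positivity, fun N hN β hβ g hg => ?_⟩
  set M := truncation d α γ N with hM
  have hMN : M ≤ (N : ℝ) ^ α := truncation_le_rpow hα hγ hN.two_le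
  have hlN : Real.log 2 ≤ Real.log N :=
    Real.log_le_log two_pos (by exact_mod_cast hN.two_le)
  have hlN0 : 0 < Real.log N := hl2.trans_le hlN
  have hR' := hR N hN.two_le g M hMN (hdual N hN β hβ g hg)
  have hV' := hV N hN.two_le g M hMN
  have hK0 : 0 ≤ K := by positivity
  refine ⟨hR'.trans ?_, ?_⟩
  · gcongr
    have : 0 < 1 / Real.log 2 ^ (2 * d) := by positivity
    linarith
  · obtain ⟨-, -, h | ⟨hR2, h⟩⟩ := adaptiveShifts_spec d α γ N g M ht0 ht1
    · have h1 : ((adaptiveShifts d α γ N g M t).length : ℝ) ≤ 1 := by exact_mod_cast h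
      have h2 : 1 ≤ 1 / Real.log 2 ^ (2 * d) * Real.log N ^ (2 * d) := by
        rw [one_div_mul_eq_div, one_le_div (by positivity)]
        gcongr
      refine h1.trans (h2.trans ?_)
      gcongr
      linarith
    · have h1 : ((adaptiveShifts d α γ N g M t).length : ℝ) ≤
          ((theoreticalPrimes (differences (cross d α γ M) N g)
          (projection (differences (cross d α γ M) N g)) (maxFiber (cross d α γ M) N g) t).sum : ℝ) := by
        exact_mod_cast h
      refine (h1.trans (sum_theoreticalPrimes_le ht0 hR2)).trans ?_
      set R := maxFiber (cross d α γ M) N g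
      set V := (((differences (cross d α γ M) N g).sup
        (projInt (projection (differences (cross d α γ M) N g))) : ℕ) : ℝ)
      have hlV : 0 ≤ Real.log V := Real.log_natCast_nonneg _
      have hR1 : (0 : ℝ) ≤ (R : ℝ) - 1 := by
        have : (2 : ℝ) ≤ R := by exact_mod_cast hR2
        linarith
      -- R contributes (log N)^{d-1} and log V one more logarithm; squaring yields the exponent 2d
      -- of S.
      have h2 : 2 * ((R : ℝ) - 1) * Real.log V ≤ 2 * C₁ * C₂ * Real.log N ^ d := by
        calc 2 * ((R : ℝ) - 1) * Real.log V
            ≤ 2 * (C₁ * Real.log N ^ (d - 1)) * (C₂ * Real.log N) := by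
              gcongr
              linarith
          _ = 2 * C₁ * C₂ * (Real.log N ^ (d - 1) * Real.log N) := by ring
          _ = _ := by rw [← pow_succ, Nat.sub_add_cancel hd]
      have h3 : 2 ≤ 2 / Real.log 2 ^ d * Real.log N ^ d := by
        rw [div_mul_eq_mul_div, le_div_iff₀ (by positivity)]
        gcongr
      calc 1260 * (2 * (2 * ((R : ℝ) - 1) * Real.log V / (0.32 * t) + 2)) ^ 2
          ≤ 1260 * (2 * (2 * C₁ * C₂ * Real.log N ^ d / (0.32 * t) +
            2 / Real.log 2 ^ d * Real.log N ^ d)) ^ 2 := by gcongr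
        _ = K * Real.log N ^ (2 * d) := by
          rw [hK, pow_mul' (Real.log N) 2 d]
          ring
        _ ≤ _ := by
          gcongr
          have : 0 < 1 / Real.log 2 ^ (2 * d) := by positivity
          linarith

theorem exists_log_pow_le (m : ℕ) {ε : ℝ} (hε : 0 < ε) :
    ∃ C : ℝ, 0 < C ∧ ∀ N : ℕ, 2 ≤ N → Real.log N ^ m ≤ C * (N : ℝ) ^ ε := by
  -- Dividing by m + 1 instead of m allows m = 0.
  have hδ : 0 < ε / (m + 1) := by positivity
  refine ⟨(1 / (ε / (m + 1))) ^ m, by positivity, fun N hN => ?_⟩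
  have hN1 : (1 : ℝ) ≤ N := by exact_mod_cast (by omega : 1 ≤ N)
  have h1 := Real.log_le_rpow_div (Nat.cast_nonneg N) hδ
  calc Real.log N ^ m ≤ ((N : ℝ) ^ (ε / (m + 1)) / (ε / (m + 1))) ^ m :=
        pow_le_pow_left₀ (Real.log_natCast_nonneg N) h1 m
    _ = (1 / (ε / (m + 1))) ^ m * (N : ℝ) ^ (ε / (m + 1) * m) := by
        rw [div_eq_mul_one_div, mul_pow, mul_comm, ← Real.rpow_mul_natCast (by positivity)]
    _ ≤ _ := by
        gcongr
        rw [div_mul_eq_mul_div, div_le_iff₀ (by positivity)]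
        nlinarith

/-- The main error bound, without logarithms. -/
theorem exists_norm_sub_approx_le (d : ℕ) (hd : 1 ≤ d) {α : ℝ} (hα : 1 / 2 < α) {γ : ℕ → ℝ}
    (hγ : ∀ j, 0 < γ j) {t : ℝ} (ht0 : 0 < t) (ht1 : t < 1) {τ : ℝ} (hτ0 : 0 < τ)
    (hτ : τ ≤ α - 1 / 2) :
    ∃ C : ℝ, 0 < C ∧ ∀ N : ℕ, N.Prime → ∀ β : ℝ, (β = α ∨ (1 ≤ α ∧ β = ⌊α⌋)) →
      ∀ g : Fin d → ℕ, IsCBC β (fun j => γ j ^ (β / α)) N g →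
      worstCaseError α γ (approx (cross d α γ (truncation d α γ N)) N g
        (adaptiveShifts d α γ N g (truncation d α γ N) t)) ≤
        ENNReal.ofReal (C * (N : ℝ) ^ (-α + 1 / 2 + τ)) := by
  have hα0 : 0 < α := by linarith
  obtain ⟨C₁, hC₁, hpoly⟩ := exists_length_adaptiveShifts_le d hd hα hγ ht0 ht1
  -- The exponent 2d - 1 is d from √S plus d - 1 from R. Half of τ pays for these logarithms, the
  -- other half for taking q slightly above 1/α.
  obtain ⟨C₂, hC₂, hlog⟩ := exists_log_pow_le (2 * d - 1) (by positivity : 0 < τ / 2)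
  have hα' : 0 < α - τ / 2 := by linarith
  set q : ℝ := 1 / (α - τ / 2) with hqdef
  have hq : q ∈ Set.Ioc (1 / α) 2 := by
    constructor
    · exact one_div_lt_one_div_of_lt hα' (by linarith)
    · rw [hqdef, div_le_iff₀ hα']
      linarith
  have hq0 := pos_of_mem_Ioc hα0 hq
  have hZ := one_le_zetaProd d hγ (one_lt_mul_of_mem_Ioc hα0 hq)
  have hqinv : 1 / q = α - τ / 2 := by rw [hqdef, one_div_one_div]
  set Z := zetaProd d α γ q with hZdef
  set c : ℝ := (Z⁻¹) ^ (1 / q) * (1 / 2) ^ (1 / q) with hc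
  have hc0 : 0 < c := by positivity
  set K : ℝ := √(c ^ (q - 2) * Z) with hK
  set K' : ℝ := 1 + √(C₁ / (1 - t)) * C₁ * C₂ with hK'
  have ht : 0 < 1 - t := by linarith
  have hK0 : 0 ≤ K := Real.sqrt_nonneg _
  have hK'0 : 0 < K' := by positivity
  refine ⟨K' * K + 1, by positivity, fun N hN β hβ g hg => ?_⟩
  obtain ⟨hR, hS⟩ := hpoly N hN β hβ g hg
  obtain ⟨-, hstable, -⟩ := adaptiveShifts_spec d α γ N g (truncation d α γ N) ht0 ht1
  set M := truncation d α γ N with hM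
  set Y := adaptiveShifts d α γ N g M t with hY
  have hM0 : 0 < M := truncation_pos hα hγ hN.two_le
  have hN1 : (1 : ℝ) ≤ N := by exact_mod_cast hN.one_le
  have hN0 : (0 : ℝ) < N := by linarith
  have hlN0 : 0 ≤ Real.log N := Real.log_natCast_nonneg N
  have hMlow : c * (N : ℝ) ^ (1 / q) ≤ M := by
    refine le_trans (le_of_eq ?_) (truncTerm_le_truncation (d := d) hα0 hγ hN.two_le hq)
    rw [truncTerm_eq hα0 hγ hq, hc, div_eq_mul_one_div (N : ℝ) 2,
      Real.mul_rpow (by positivity) (by positivity)]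
    ring
  have htail : √(M ^ (q - 2) * Z) ≤ K * (N : ℝ) ^ (1 / 2 - α + τ / 2) := by
    have h1 : M ^ (q - 2) * Z ≤ c ^ (q - 2) * Z * (N : ℝ) ^ ((1 / 2 - α + τ / 2) * 2) := by
      have h2 : M ^ (q - 2) ≤ (c * (N : ℝ) ^ (1 / q)) ^ (q - 2) :=
        Real.rpow_le_rpow_of_nonpos (by positivity) hMlow (by linarith [hq.2])
      rw [Real.mul_rpow hc0.le (by positivity), ← Real.rpow_mul hN0.le] at h2
      -- The tail M^{(q-2)/2} becomes N^{1/2 - 1/q} with 1/q = α - τ/2.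
      have h3 : 1 / q * (q - 2) = (1 / 2 - α + τ / 2) * 2 := by
        rw [mul_sub, one_div_mul_cancel hq0.ne', hqinv]
        ring
      rw [h3] at h2
      calc M ^ (q - 2) * Z ≤ c ^ (q - 2) * (N : ℝ) ^ ((1 / 2 - α + τ / 2) * 2) * Z := by gcongr
        _ = _ := by ring
    refine (Real.sqrt_le_sqrt h1).trans (le_of_eq ?_)
    rw [Real.sqrt_mul (by positivity), Real.rpow_mul hN0.le, Real.rpow_two,
      Real.sqrt_sq (by positivity)]
  have hfac : 1 + √(Y.length / (1 - t)) * maxFiber (cross d α γ M) N g ≤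
      K' * (N : ℝ) ^ (τ / 2) := by
    have h1 : √(Y.length / (1 - t)) ≤ √(C₁ / (1 - t)) * Real.log N ^ d := by
      have h2 : (Y.length : ℝ) / (1 - t) ≤ C₁ / (1 - t) * (Real.log N ^ d) ^ 2 := by
        rw [div_mul_eq_mul_div, ← pow_mul, mul_comm d 2]
        gcongr
      refine (Real.sqrt_le_sqrt h2).trans (le_of_eq ?_)
      rw [Real.sqrt_mul (by positivity), Real.sqrt_sq (by positivity)]
    have h3 : (1 : ℝ) ≤ (N : ℝ) ^ (τ / 2) := Real.one_le_rpow hN1 (by linarith)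
    calc 1 + √(Y.length / (1 - t)) * maxFiber (cross d α γ M) N g
        ≤ 1 + √(C₁ / (1 - t)) * Real.log N ^ d * (C₁ * Real.log N ^ (d - 1)) := by gcongr
      _ = 1 + √(C₁ / (1 - t)) * C₁ * Real.log N ^ (2 * d - 1) := by
        rw [show 2 * d - 1 = d + (d - 1) by omega, pow_add]
        ring
      _ ≤ (N : ℝ) ^ (τ / 2) + √(C₁ / (1 - t)) * C₁ * (C₂ * (N : ℝ) ^ (τ / 2)) := by
        gcongr
        exact hlog N hN.two_le
      _ = K' * (N : ℝ) ^ (τ / 2) := by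
        rw [hK']
        ring
  refine iSup_le fun f => iSup_le fun hf => iSup_le fun x => ?_
  rw [← ofReal_norm]
  refine ENNReal.ofReal_le_ofReal ?_
  refine (norm_sub_approx_le hN.one_le _ g Y ht1 hstable f (hf.summable hα hγ) x).trans ?_
  have hout := (outerSum_le hα hγ hq hM0 hf).trans htail
  calc _ ≤ K' * (N : ℝ) ^ (τ / 2) * (K * (N : ℝ) ^ (1 / 2 - α + τ / 2)) := by
        refine mul_le_mul hfac hout (tsum_nonneg fun k => ?_) (by positivity)
        split_ifs <;> positivity
    _ = K' * K * (N : ℝ) ^ (-α + 1 / 2 + τ) := by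
        rw [mul_mul_mul_comm, ← Real.rpow_add hN0]
        congr 2
        ring
    _ ≤ _ := by
        gcongr
        linarith

/-- For negative E the logarithm is replaced by x^ε/ε with ε so small that the exponent εE + κ =
κ/(1 - E) stays nonnegative. -/
theorem exists_le_log_rpow_mul_rpow (E : ℝ) {κ : ℝ} (hκ : 0 < κ) :
    ∃ c : ℝ, 0 < c ∧ ∀ x : ℝ, 2 ≤ x → c ≤ Real.log x ^ E * x ^ κ := by
  have hl2 : 0 < Real.log 2 := Real.log_pos one_lt_two
  rcases le_total 0 E with hE | hE
  · refine ⟨Real.log 2 ^ E, by positivity, fun x hx => ?_⟩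
    have h1 : Real.log 2 ≤ Real.log x := Real.log_le_log two_pos hx
    refine (Real.rpow_le_rpow hl2.le h1 hE).trans (le_mul_of_one_le_right ?_ ?_)
    · exact Real.rpow_nonneg (hl2.le.trans h1) _
    · exact Real.one_le_rpow (by linarith) hκ.le
  · set ε := κ / (1 - E) with hε
    have hε0 : 0 < ε := div_pos hκ (by linarith)
    refine ⟨(1 / ε) ^ E, by positivity, fun x hx => ?_⟩
    have hx0 : 0 < x := by linarith
    have h1 : Real.log 2 ≤ Real.log x := Real.log_le_log two_pos hx
    have h2 := Real.log_le_rpow_div hx0.le hε0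
    have h3 : (x ^ ε / ε) ^ E ≤ Real.log x ^ E :=
      Real.rpow_le_rpow_of_nonpos (hl2.trans_le h1) h2 hE
    calc (1 / ε) ^ E ≤ (1 / ε) ^ E * x ^ (ε * E + κ) := by
          refine le_mul_of_one_le_right (by positivity) (Real.one_le_rpow (by linarith) ?_)
          rw [hε, div_mul_eq_mul_div, div_add' _ _ _ (by linarith)]
          exact div_nonneg (by nlinarith) (by linarith)
      _ = (x ^ ε / ε) ^ E * x ^ κ := by
          rw [div_eq_mul_one_div (x ^ ε), Real.mul_rpow (by positivity) (by positivity),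
            ← Real.rpow_mul hx0.le, Real.rpow_add hx0]
          ring
      _ ≤ _ := by gcongr

/-- Comparison of the rates in the number of lattice points and in the number of samples. -/
theorem rate_le_rate {d : ℕ} (hd : 1 ≤ d) {κ K : ℝ} (hκ : 0 ≤ κ) (hK : 0 < K) {N S : ℕ}
    (hN : 2 ≤ N) (hS : 1 ≤ S) (hSK : (S : ℝ) ≤ K * Real.log N ^ (2 * d)) :
    Real.log N ^ (((d : ℝ) - 1) / 2) * (N : ℝ) ^ (-κ) ≤
      K ^ κ * (Real.log (N * S : ℕ) ^ (((d : ℝ) - 1) / 2 + 2 * d * κ) *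
        ((N * S : ℕ) : ℝ) ^ (-κ)) := by
  have hN2 : (2 : ℝ) ≤ N := by exact_mod_cast hN
  have hS1 : (1 : ℝ) ≤ S := by exact_mod_cast hS
  have hd1 : (1 : ℝ) ≤ d := by exact_mod_cast hd
  have hl : 0 < Real.log N := Real.log_pos (by linarith)
  have hle : Real.log N ≤ Real.log (N * S : ℕ) := by
    refine Real.log_le_log (by linarith) ?_
    push_cast
    nlinarith
  have h1 : Real.log N ^ (((d : ℝ) - 1) / 2 + 2 * d * κ) ≤
      Real.log (N * S : ℕ) ^ (((d : ℝ) - 1) / 2 + 2 * d * κ) :=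
    Real.rpow_le_rpow hl.le hle (by have : 0 ≤ (d : ℝ) - 1 := by linarith
                                    positivity)
  have h2 : (K * Real.log N ^ (2 * d)) ^ (-κ) ≤ (S : ℝ) ^ (-κ) :=
    Real.rpow_le_rpow_of_nonpos (by linarith) hSK (by linarith)
  -- The extra exponent 2dκ of the logarithm compensates exactly for the loss S^{-κ} when S is
  -- replaced by its upper bound.
  have h3 : K ^ κ * (Real.log N ^ (((d : ℝ) - 1) / 2 + 2 * d * κ) *
      (K * Real.log N ^ (2 * d)) ^ (-κ)) = Real.log N ^ (((d : ℝ) - 1) / 2) := by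
    rw [Real.mul_rpow hK.le (by positivity), ← Real.rpow_natCast, ← Real.rpow_mul hl.le,
      Real.rpow_neg hK.le, mul_left_comm (Real.log N ^ _), ← mul_assoc,
      mul_inv_cancel₀ (Real.rpow_pos_of_pos hK κ).ne', one_mul, ← Real.rpow_add hl]
    congr 1
    push_cast
    ring
  rw [Nat.cast_mul, Real.mul_rpow (by linarith) (by linarith), ← h3]
  push_cast at h1 ⊢
  calc _ = K ^ κ * (Real.log N ^ (((d : ℝ) - 1) / 2 + 2 * d * κ) *
        ((N : ℝ) ^ (-κ) * (K * Real.log N ^ (2 * d)) ^ (-κ))) := by ring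
    _ ≤ _ := by
        gcongr
        exact Real.rpow_nonneg (hl.le.trans (by simpa using hle)) _

end Korobov

end

theorem theorem6p2 (d : ℕ) (hd : 1 ≤ d) (α : ℝ) (hα : 1 / 2 < α)
    (γ : ℕ → ℝ) (hγ : ∀ j, 0 < γ j) (t : ℝ) (ht0 : 0 < t) (ht1 : t < 1)
    (τ : ℝ) (hτ0 : 0 < τ) (hτ1 : τ ≤ 1) :
    ∃ C : ℝ, 0 < C ∧
      ∀ (N : ℕ), N.Prime →
      -- the smoothness used in the component-by-component construction: `α` or `⌊α⌋ ≥ 1`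
      ∀ (β : ℝ), (β = α ∨ (1 ≤ α ∧ β = ⌊α⌋)) →
      ∀ (g : Fin d → ℕ), Korobov.IsCBC β (fun j => γ j ^ (β / α)) N g →
      ∀ (M : ℝ), M = Korobov.truncation d α γ N →
      ∀ (Y : List (UnitAddTorus (Fin d))), Y = Korobov.adaptiveShifts d α γ N g M t →
      ∀ (Ntot : ℕ), Ntot = N * Y.length →
        -- all least-squares systems are uniquely solvable
        (∀ l ∈ Korobov.cross d α γ M,
          LinearIndependent ℂ
            (Korobov.systemMatrix (Korobov.fiber (Korobov.cross d α γ M) N g l) Y).col) ∧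
        Korobov.worstCaseError α γ (Korobov.approx (Korobov.cross d α γ M) N g Y) ≤
          ENNReal.ofReal
            (C * (Real.log N ^ (((d : ℝ) - 1) / 2) * (N : ℝ) ^ (-α + 1 / 2 + τ))) ∧
        Korobov.worstCaseError α γ (Korobov.approx (Korobov.cross d α γ M) N g Y) ≤
          ENNReal.ofReal
            (C * (Real.log Ntot ^ ((2 * α - 1 / 2 - 2 * τ) * d - 1 / 2) *
              (Ntot : ℝ) ^ (-α + 1 / 2 + τ))) ∧
        (τ ≤ α - 1 / 2 →
          Real.log N ^ (((d : ℝ) - 1) / 2) * (N : ℝ) ^ (-α + 1 / 2 + τ) ≤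
            C * (Real.log Ntot ^ ((2 * α - 1 / 2 - 2 * τ) * d - 1 / 2) *
              (Ntot : ℝ) ^ (-α + 1 / 2 + τ))) := by
  have hl2 : 0 < Real.log 2 := Real.log_pos one_lt_two
  have hd1 : (0 : ℝ) ≤ (d : ℝ) - 1 := by
    have : (1 : ℝ) ≤ d := by exact_mod_cast hd
    linarith
  obtain ⟨K, hK, hpoly⟩ := Korobov.exists_length_adaptiveShifts_le d hd hα hγ ht0 ht1
  -- For τ above α - 1/2 the capped value gives a bounded error, which is all that is needed in that
  -- range.
  obtain ⟨C₀, hC₀, herr⟩ := Korobov.exists_norm_sub_approx_le d hd hα hγ ht0 ht1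
    (lt_min hτ0 (sub_pos.2 hα)) (min_le_right τ (α - 1 / 2))
  set E : ℝ := (2 * α - 1 / 2 - 2 * τ) * d - 1 / 2 with hE
  obtain ⟨c₂, hc₂, hlow⟩ : ∃ c : ℝ, 0 < c ∧ (α - 1 / 2 < τ →
      ∀ x : ℝ, 2 ≤ x → c ≤ Real.log x ^ E * x ^ (-α + 1 / 2 + τ)) := by
    by_cases h : α - 1 / 2 < τ
    · obtain ⟨c, hc, h'⟩ := Korobov.exists_le_log_rpow_mul_rpow E
        (by linarith : 0 < -α + 1 / 2 + τ)
      exact ⟨c, hc, fun _ => h'⟩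
    · exact ⟨1, one_pos, fun h' => absurd h' h⟩
  -- The logarithmic factor in the first bound is at least its value at N = 2; L normalizes it to be
  -- at least 1.
  set L : ℝ := (Real.log 2 ^ (((d : ℝ) - 1) / 2))⁻¹ with hL
  have hL0 : 0 < L := by positivity
  set P : ℝ := K ^ (α - 1 / 2 - τ) with hP
  have hP0 : 0 < P := by positivity
  refine ⟨C₀ * L + (C₀ * L) * P + C₀ / c₂ + P, by positivity, ?_⟩
  rintro N hN β hβ g hg M rfl Y rfl Ntot rfl
  obtain ⟨hS1, hstable, -⟩ :=
    Korobov.adaptiveShifts_spec d α γ N g (Korobov.truncation d α γ N) ht0 ht1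
  obtain ⟨-, hS⟩ := hpoly N hN β hβ g hg
  have herr' := herr N hN β hβ g hg
  set Y := Korobov.adaptiveShifts d α γ N g (Korobov.truncation d α γ N) t with hY
  have hN2 : (2 : ℝ) ≤ N := by exact_mod_cast hN.two_le
  have hlN : Real.log 2 ≤ Real.log N := Real.log_le_log two_pos hN2
  have hlN0 : 0 < Real.log N := hl2.trans_le hlN
  have hNtot : (2 : ℝ) ≤ (N * Y.length : ℕ) := by
    exact_mod_cast hN.two_le.trans (Nat.le_mul_of_pos_right N hS1)
  have hlt0 : 0 < Real.log (N * Y.length : ℕ) := Real.log_pos (by linarith)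
  have hrate : τ ≤ α - 1 / 2 →
      Real.log N ^ (((d : ℝ) - 1) / 2) * (N : ℝ) ^ (-α + 1 / 2 + τ) ≤
        P * (Real.log (N * Y.length : ℕ) ^ E * ((N * Y.length : ℕ) : ℝ) ^ (-α + 1 / 2 + τ)) := by
    intro h
    have := Korobov.rate_le_rate hd (sub_nonneg.2 h) hK hN.two_le hS1 hS
    rwa [show ((d : ℝ) - 1) / 2 + 2 * d * (α - 1 / 2 - τ) = E by rw [hE]; ring,
      show -(α - 1 / 2 - τ) = -α + 1 / 2 + τ by ring] at this
  have hfirst : C₀ * (N : ℝ) ^ (-α + 1 / 2 + min τ (α - 1 / 2)) ≤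
      C₀ * L * (Real.log N ^ (((d : ℝ) - 1) / 2) * (N : ℝ) ^ (-α + 1 / 2 + τ)) := by
    have h1 : 1 ≤ L * Real.log N ^ (((d : ℝ) - 1) / 2) := by
      rw [hL, inv_mul_eq_div, one_le_div (by positivity)]
      gcongr
    have h2 : (N : ℝ) ^ (-α + 1 / 2 + min τ (α - 1 / 2)) ≤ (N : ℝ) ^ (-α + 1 / 2 + τ) :=
      Real.rpow_le_rpow_of_exponent_le (by linarith) (by linarith [min_le_left τ (α - 1 / 2)])
    calc C₀ * (N : ℝ) ^ (-α + 1 / 2 + min τ (α - 1 / 2))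
        ≤ C₀ * (1 * (N : ℝ) ^ (-α + 1 / 2 + τ)) := by rw [one_mul]; gcongr
      _ ≤ C₀ * ((L * Real.log N ^ (((d : ℝ) - 1) / 2)) * (N : ℝ) ^ (-α + 1 / 2 + τ)) := by gcongr
      _ = _ := by ring
  have hD0 : 0 < C₀ / c₂ := by positivity
  have hCL : 0 < C₀ * L := by positivity
  have hCLP : 0 < C₀ * L * P := by positivity
  refine ⟨fun l hl => Korobov.linearIndependent_col_of_le _ (sub_pos.2 ht1)
    (hstable l hl).le_systemMatrix, ?_, ?_, fun h => (hrate h).trans ?_⟩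
  · refine herr'.trans (ENNReal.ofReal_le_ofReal (hfirst.trans ?_))
    gcongr
    linarith
  · refine herr'.trans (ENNReal.ofReal_le_ofReal ?_)
    rcases le_or_gt τ (α - 1 / 2) with h | h
    · refine hfirst.trans ((mul_le_mul_of_nonneg_left (hrate h) hCL.le).trans ?_)
      rw [← mul_assoc]
      gcongr
      linarith
    -- The power of N_tot is now positive, so the claimed bound is at least a positive constant,
    -- even if the logarithm has a negative exponent.
    · have h1 := hlow h _ hNtot
      rw [min_eq_right h.le, show -α + 1 / 2 + (α - 1 / 2) = 0 by ring, Real.rpow_zero, mul_one]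
      calc C₀ = C₀ / c₂ * c₂ := by field_simp
        _ ≤ C₀ / c₂ * (Real.log (N * Y.length : ℕ) ^ E *
            ((N * Y.length : ℕ) : ℝ) ^ (-α + 1 / 2 + τ)) := by gcongr
        _ ≤ _ := by
          gcongr
          linarith
  · gcongr
    linarith
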